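/- Setting. Let $H_{\mathbb Z}$ be a free $\mathbb Z$-module of finite rank $2n$ with a non-degenerate alternating form $\langle\,,\rangle$, let $h^{p,-p-1}=h^{-p-1,p}$ ($p\in\mathbb Z$) be Hodge numbers of weight $-1$ with total $2n$, let $D\subset\check D$ be the period domain and its compact dual (so $F\in D$ satisfies $i^{p-q}\langle x,\bar x\rangle>0$ for $0\ne x\in H^{p,q}$), and let $G=\mathrm{Aut}(H_{\mathbb R},\langle\,,\rangle)$, $G_{\mathbb C}=\mathrm{Aut}(H_{\mathbb C},\langle\,,\rangle)$, $\mathfrak g=\mathrm{Lie}\,G$. For $F\in D$ put $H^{ev}(F)=\bigoplus_{p\text{ even}}H^{p,-p-1}$, $H^{od}(F)=\bigoplus_{p\text{ odd}}H^{p,-p-1}$, let $K_F\subset G$ be the stabilizer of $H^{ev}(F)$ (the maximal compact subgroup containing the isotropy group of $F$), and $C_F=K_F F$. Let $\mathcal M_{\check D}=\{gC_F : g\in G_{\mathbb C}, F\in D\}$, $\mathcal M_D=\{C\in\mathcal M_{\check D} : C\subset D\}$, and let $\mathcal M_D^{cl}$ be the closure of $\mathcal M_D$ in the homogeneous space $\mathcal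 M_{\check D}$. Let $\mathcal B$ be the Siegel space of Lagrangian subspaces $V\subset H_{\mathbb C}$ with $i\langle x,\bar x\rangle>0$ for $0\neq x\in V$, and $\mathcal B^{cl}$ its closure in the Lagrangian Grassmannian. For a real subspace $U\subset H_{\mathbb R}$ the Satake boundary component attached to $U$ is $\{V\in\mathcal B^{cl} : V\cap H_{\mathbb R}=U\}$. The projection $p^{ev}$ sends $gC_F$ to $gH^{ev}(F)$, and $p^{od}$ sends $gC_F$ to $gH^{od}(F)$, except that if $h^{p,-p-1}=0$ for all even (resp. odd) $p\ge 0$, then $p^{ev}(gC_F)$ (resp. $p^{od}(gC_F)$) is defined to be the complex conjugate of $gH^{od}(F)$ (resp. of $gH^{ev}(F)$). A nilpotent cone $\sigma\subset\mathfrak g$ is a convex cone generated by finitely many rational, mutually commuting nilpotent elements; $\sigma^\circ$ is its relative interior and $\sigma_{\mathbb C}$ its complex span. A $\sigma$-nilpotent orbit is a set $\exp(\sigma_{\mathbb C})F$ with $F\in\check D$ such that for every $N\in\sigma^\circ$ one has $\exp(zN)F\in D$ for $\mathrm{Im}\,z\gg0$, and $NF^p\subset F^{p-1}$ for all $N\in\sigma$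 and all $p$; $\mathbb B(\sigma)$ is the set of all of them. For $N^2=0$ let $W(N)$ be the filtration $W_0=H_{\mathbb R}$, $W_{-1}=\mathrm{Ker}\,N$, $W_{-2}=\mathrm{Im}\,N$, $W_{-3}=0$, and let $I^{p,q}$ be Deligne's subspaces of $(W(N),F)$. The cone $\sigma$ is even-type (resp. odd-type) if for every $\sigma$-nilpotent orbit $\exp(\sigma_{\mathbb C})F$ and every $N\in\sigma^\circ$ one has $N^2=0$ and $I^{p,-p}=0$ for all odd (resp. even) $p$. For $N\in\sigma^\circ$ and $F$ in a $\sigma$-nilpotent orbit, let $\delta\in L^{-1,-1}_{\mathbb R}(W(N),F)\subset\mathfrak g$ (that is, $\delta$ is real and maps each $I^{p,q}$ into $\bigoplus_{r<p,\,s<q}I^{r,s}$) be such that $\hat F=e^{-i\delta}F$ makes $(W(N),\hat F)$ an $\mathbb R$-split mixed Hodge structure, let $H,N^+\in\mathfrak g$ be such that $H=p+q+1$ on the $I^{p,q}$ of $(W(N),\hat F)$, $[H,N]=-2N$, $[H,N^+]=2N^+$, $[N^+,N]=H$, and put $F_0=\exp(iN)\hat F$, $C_0=C_{F_0}$, $X=\tfrac12(iN-H+iN^+)$.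 Corollary 2.7. Let $\sigma$ be an even-type (resp. odd-type) nilpotent cone. If $\mathbb B(\sigma)\neq\emptyset$, then the filtration $W(\sigma):=W(N)$ does not depend on $N\in\sigma^\circ$. Let $\mathbb B_S(\sigma)$ be the Satake boundary component attached to $W(\sigma)_{-2}$ and $\overline{\mathbb B_S(\sigma)}=\{\overline V : V\in\mathbb B_S(\sigma)\}$. Then $p^{ev}$ (resp. $p^{od}$) gives a well-defined map $\mathbb B(\sigma)\to\mathbb B_S(\sigma)$ (resp. $\mathbb B(\sigma)\to\overline{\mathbb B_S(\sigma)}$), $Z\mapsto p^{ev}(\exp(X)C_0)$ (resp. $p^{od}(\exp(X)C_0)$). That is: for every $Z\in\mathbb B(\sigma)$, $N\in\sigma^\circ$ and $F\in Z$, the cycle $\exp(X)C_0$ exists, is uniquely determined by $(N,F)$ and lies in $\mathcal M_D^{cl}$; $p^{ev}$ (resp. $p^{od}$) has exactly one value at it; and this value depends only on $Z$, not on $N\in\sigma^\circ$ and $F\in Z$, and lies in $\mathbb B_S(\sigma)$ (resp. $\overline{\mathbb B_S(\sigma)}$). -/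

import Mathlib

open scoped Matrix

noncomputable section

namespace HodgeCycle

variable {ι : Type*} [Fintype ι] [DecidableEq ι]

/-- The discrete data of polarized Hodge structures of weight `-1`: the lattice `H_ℤ = ℤ^ι`
(a basis has been chosen) with its non-degenerate alternating form `⟨ , ⟩`, given by its Gram
matrix `Q`, and the Hodge numbers `h p = h^{p,-p-1}`. -/
structure PolData (ι : Type*) [Fintype ι] [DecidableEq ι] where
  Q : Matrix ι ι ℤ
  alternating : Qᵀ = -Q
  nondegenerate : Q.det ≠ 0
  h : ℤ →₀ ℕ
  h_symm : ∀ p : ℤ, h (-1 - p) = h p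
  h_total : ∑ p ∈ h.support, h p = Fintype.card ι

/-! ### Linear algebra in `H_ℝ = ℝ^ι` and `H_ℂ = ℂ^ι` -/

/-- A real vector seen in `H_ℂ`. -/
def vecC (x : ι → ℝ) : ι → ℂ := fun i => (x i : ℂ)

/-- A real endomorphism seen as an endomorphism of `H_ℂ`. -/
def matC (A : Matrix ι ι ℝ) : Matrix ι ι ℂ := A.map (fun t : ℝ => (t : ℂ))

/-- The complexification `U_ℂ` of a real subspace `U`. -/
def complexify (U : Submodule ℝ (ι → ℝ)) : Submodule ℂ (ι → ℂ) :=
  Submodule.span ℂ (vecC '' (U : Set (ι → ℝ)))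

/-- The complex conjugate of a subspace of `H_ℂ`. -/
def conjSub (V : Submodule ℂ (ι → ℂ)) : Submodule ℂ (ι → ℂ) where
  carrier := {x | star x ∈ V}
  add_mem' := by
    intro a b ha hb
    simpa using V.add_mem ha hb
  zero_mem' := by simp
  smul_mem' := by
    intro c x hx
    simpa using V.smul_mem (star c) hx

/-- Decreasing families of subspaces of `H_ℂ` are taken from this type. -/
abbrev Filt (ι : Type*) := ℤ → Submodule ℂ (ι → ℂ)

/-- The image `g V`. -/
def actV (g : Matrix ι ι ℂ) (V : Submodule ℂ (ι → ℂ)) : Submodule ℂ (ι → ℂ) :=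
  V.map g.mulVecLin

/-- The filtration `g F`. -/
def actF (g : Matrix ι ι ℂ) (F : Filt ι) : Filt ι := fun p => actV g (F p)

/-- The set of filtrations `g C`. -/
def actS (g : Matrix ι ι ℂ) (C : Set (Filt ι)) : Set (Filt ι) := actF g '' C

namespace PolData

variable (P : PolData ι)

def QC : Matrix ι ι ℂ := P.Q.map (fun m : ℤ => (m : ℂ))

def QR : Matrix ι ι ℝ := P.Q.map (fun m : ℤ => (m : ℝ))

/-- The form `⟨x, y⟩` on `H_ℂ`. -/
def pairing (x y : ι → ℂ) : ℂ := x ⬝ᵥ (P.QC *ᵥ y)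

/-- `G_ℂ = Aut(H_ℂ, ⟨ , ⟩)`. -/
def GC : Set (Matrix ι ι ℂ) := {g | gᵀ * P.QC * g = P.QC}

/-- `G = Aut(H_ℝ, ⟨ , ⟩)`. -/
def GR : Set (Matrix ι ι ℝ) := {g | gᵀ * P.QR * g = P.QR}

/-- `𝔤 = Lie G`. -/
def lieG : Set (Matrix ι ι ℝ) := {A | Aᵀ * P.QR + P.QR * A = 0}

/-! ### Period domain -/

/-- The compact dual `Ď`: the filtrations with `dim F^p = ∑_{r ≥ p} h^{r,-r-1}` and
`⟨F^p, F^{-p}⟩ = 0`. -/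
def compactDual : Set (Filt ι) :=
  {F | Antitone F ∧
    (∀ p, Module.finrank ℂ (F p) = ∑ r ∈ P.h.support with p ≤ r, P.h r) ∧
    ∀ p, ∀ x ∈ F p, ∀ y ∈ F (-p), P.pairing x y = 0}

/-- `H^{p,-p-1} = F^p ∩ conj F^{-p-1}`. -/
def _root_.HodgeCycle.hodge (F : Filt ι) (p : ℤ) : Submodule ℂ (ι → ℂ) :=
  F p ⊓ conjSub (F (-1 - p))

/-- The period domain `D`: the members of `Ď` that define Hodge structures of weight `-1`
polarized by `⟨ , ⟩`, that is `i^{p-q} ⟨x, conj x⟩ > 0` on `H^{p,q}`, `q = -p-1`. (The number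
whose real part is taken is automatically real.) -/
def periodDomain : Set (Filt ι) :=
  {F | F ∈ P.compactDual ∧
    (∀ p, IsCompl (F p) (conjSub (F (-p)))) ∧
    ∀ p, ∀ x ∈ hodge F p, x ≠ 0 → 0 < (Complex.I ^ (2 * p + 1) * P.pairing x (star x)).re}

/-- `H^ev`, the sum of the `H^{p,-p-1}` with `p` even. -/
def _root_.HodgeCycle.evenPart (F : Filt ι) : Submodule ℂ (ι → ℂ) :=
  ⨆ p : ℤ, ⨆ _ : Even p, hodge F p

/-- `H^od`, the sum of the `H^{p,-p-1}` with `p` odd. -/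
def _root_.HodgeCycle.oddPart (F : Filt ι) : Submodule ℂ (ι → ℂ) :=
  ⨆ p : ℤ, ⨆ _ : Odd p, hodge F p

/-! ### Cycle spaces -/

/-- The maximal compact subgroup `K_F` of `G` that contains the isotropy group of `F ∈ D`: the
stabilizer in `G` of `H^ev` (equivalently of the pair `H^ev`, `H^od = conj H^ev`), which is the
unitary group of the positive definite hermitian form `i⟨x, conj y⟩` on `H^ev`. -/
def maxCompact (F : Filt ι) : Set (Matrix ι ι ℝ) :=
  {k | k ∈ P.GR ∧ actV (matC k) (evenPart F) = evenPart F}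

/-- The compact cycle `K_F F` through `F ∈ D`. -/
def cycle (F : Filt ι) : Set (Filt ι) :=
  {F' | ∃ k ∈ P.maxCompact F, F' = actF (matC k) F}

/-- `M_Ď`, the set of all translates `g C_F` with `g ∈ G_ℂ`. (Since `G` is transitive on `D`, it
is the set of translates of one cycle, for any choice of the base point.) -/
def cyclesDual : Set (Set (Filt ι)) :=
  {C | ∃ g ∈ P.GC, ∃ F ∈ P.periodDomain, C = actS g (P.cycle F)}

/-- The cycle space `M_D`. -/
def cycleSpace : Set (Set (Filt ι)) := {C | C ∈ P.cyclesDual ∧ C ⊆ P.periodDomain}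

/-- The topological closure of `M_D` in the homogeneous space `M_Ď` of `G_ℂ`. Orbit maps of a
homogeneous space are open, so the sets `U C`, for `U` a neighbourhood of `1` in `G_ℂ`, are a
neighbourhood basis of `C`; hence `C` is in the closure iff there are `g ∈ G_ℂ` arbitrarily
close to `1` with `g C ∈ M_D`. -/
def cycleSpaceClosure : Set (Set (Filt ι)) :=
  {C | C ∈ P.cyclesDual ∧
    (1 : Matrix ι ι ℂ) ∈ closure {g | g ∈ P.GC ∧ actS g C ∈ P.cycleSpace}}

/-- The graph of `p^ev`: `C = g C_F` goes to `V = g H^ev(F)`, the first component of the pair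
`(g H^ev, g H^od)` attached to `C`. If all even `p` with `h^{p,-p-1} ≠ 0` are negative, then `C`
is determined by `W = g H^od` alone, and `p^ev` is `W` followed by complex conjugation. -/
def EvenProj (C : Set (Filt ι)) (V : Submodule ℂ (ι → ℂ)) : Prop :=
  ∃ g ∈ P.GC, ∃ F ∈ P.periodDomain, C = actS g (P.cycle F) ∧
    (((∃ p : ℤ, 0 ≤ p ∧ Even p ∧ P.h p ≠ 0) ∧ V = actV g (evenPart F)) ∨
      ((¬ ∃ p : ℤ, 0 ≤ p ∧ Even p ∧ P.h p ≠ 0) ∧ V = conjSub (actV g (oddPart F))))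

/-- The graph of `p^od`: `C = g C_F` goes to `W = g H^od(F)`. If all odd `p` with
`h^{p,-p-1} ≠ 0` are negative (for instance if `D` is a Siegel space, `h^{p,-p-1} = 0` for
`p ≠ 0, -1`), then `C` is determined by `V = g H^ev` alone, and `p^od` is `V` followed by complex
conjugation. -/
def OddProj (C : Set (Filt ι)) (W : Submodule ℂ (ι → ℂ)) : Prop :=
  ∃ g ∈ P.GC, ∃ F ∈ P.periodDomain, C = actS g (P.cycle F) ∧
    (((∃ p : ℤ, 0 ≤ p ∧ Odd p ∧ P.h p ≠ 0) ∧ W = actV g (oddPart F)) ∨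
      ((¬ ∃ p : ℤ, 0 ≤ p ∧ Odd p ∧ P.h p ≠ 0) ∧ W = conjSub (actV g (evenPart F))))

/-! ### The Siegel space and its boundary components -/

/-- The Grassmannian of Lagrangian subspaces of `H_ℂ`. -/
def lagrangians : Set (Submodule ℂ (ι → ℂ)) :=
  {V | 2 * Module.finrank ℂ V = Fintype.card ι ∧ ∀ x ∈ V, ∀ y ∈ V, P.pairing x y = 0}

/-- The bounded symmetric domain `B` (Siegel space): the Lagrangian subspaces on which the
hermitian form `i⟨x, conj y⟩` is positive definite; with the sign conventions of `periodDomain`,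
`H^ev` is such a subspace. -/
def siegel : Set (Submodule ℂ (ι → ℂ)) :=
  {V | V ∈ P.lagrangians ∧ ∀ x ∈ V, x ≠ 0 → 0 < (Complex.I * P.pairing x (star x)).re}

/-- The topological closure of `B` in its compact dual, the homogeneous space of Lagrangian
subspaces under `G_ℂ`. -/
def siegelClosure : Set (Submodule ℂ (ι → ℂ)) :=
  {V | V ∈ P.lagrangians ∧
    (1 : Matrix ι ι ℂ) ∈ closure {g | g ∈ P.GC ∧ actV g V ∈ P.siegel}}

/-- The Satake boundary component of `B` that corresponds to a real isotropic subspace `U`: the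
points `V` of the closure of `B` with `V ∩ H_ℝ = U`. -/
def satake (U : Submodule ℝ (ι → ℝ)) : Set (Submodule ℂ (ι → ℂ)) :=
  {V | V ∈ P.siegelClosure ∧ ∀ x : ι → ℝ, vecC x ∈ V ↔ x ∈ U}

/-- The complex conjugate of the Satake boundary component, in the closure of `conj B`. -/
def satakeConj (U : Submodule ℝ (ι → ℝ)) : Set (Submodule ℂ (ι → ℂ)) :=
  {W | conjSub W ∈ P.satake U}

/-! ### Weight filtration, Deligne decomposition, nilpotent orbits -/

/-- The monodromy weight filtration (shifted by `-1`) of `N` with `N^2 = 0`: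
`W_0 = H_ℝ`, `W_{-1} = Ker N`, `W_{-2} = Im N`, `W_{-3} = 0`. -/
def _root_.HodgeCycle.weight (N : Matrix ι ι ℝ) (k : ℤ) : Submodule ℝ (ι → ℝ) :=
  if 0 ≤ k then ⊤
  else if k = -1 then LinearMap.ker N.mulVecLin
  else if k = -2 then LinearMap.range N.mulVecLin
  else ⊥

/-- Deligne's subspace `I^{p,q}` of `(W(N), F)`. -/
def _root_.HodgeCycle.deligne (N : Matrix ι ι ℝ) (F : Filt ι) (p q : ℤ) :
    Submodule ℂ (ι → ℂ) :=
  F p ⊓ complexify (weight N (p + q)) ⊓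
    ((conjSub (F q) ⊓ complexify (weight N (p + q))) ⊔
      ⨆ j : ℤ, ⨆ _ : 2 ≤ j, conjSub (F (q - j + 1)) ⊓ complexify (weight N (p + q - j)))

/-- The relative interior `σ°` of a cone `σ`. -/
def _root_.HodgeCycle.relInt (σ : PointedCone ℝ (Matrix ι ι ℝ)) : Set (Matrix ι ι ℝ) :=
  intrinsicInterior ℝ (σ : Set (Matrix ι ι ℝ))

/-- A rational nilpotent cone: the convex cone in `𝔤` generated by finitely many rational, mutually
commuting nilpotent elements. -/
def IsNilpotentCone (σ : PointedCone ℝ (Matrix ι ι ℝ)) : Prop :=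
  ∃ s : Finset (Matrix ι ι ℚ),
    (∀ A ∈ s, A.map (fun t : ℚ => (t : ℝ)) ∈ P.lieG ∧ IsNilpotent A) ∧
    (∀ A ∈ s, ∀ B ∈ s, A * B = B * A) ∧
    σ = PointedCone.hull ℝ ((fun A : Matrix ι ι ℚ => A.map (fun t : ℚ => (t : ℝ))) '' (s : Set _))

/-- `exp(σ_ℂ) F`, where `σ_ℂ` is the complex span of `σ`. -/
def _root_.HodgeCycle.expOrbit (σ : PointedCone ℝ (Matrix ι ι ℝ)) (F : Filt ι) :
    Set (Filt ι) :=
  {F' | ∃ M ∈ Submodule.span ℂ (matC '' (σ : Set (Matrix ι ι ℝ))),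
    F' = actF (NormedSpace.exp M) F}

/-- The filtration `F` generates a nilpotent orbit `(σ, exp(σ_ℂ) F)`, for a nilpotent cone `σ`. -/
def GeneratesOrbit (σ : PointedCone ℝ (Matrix ι ι ℝ)) (F : Filt ι) : Prop :=
  F ∈ P.compactDual ∧
  (∀ N ∈ relInt σ, ∃ c : ℝ, ∀ z : ℂ, c < z.im →
    actF (NormedSpace.exp (z • matC N)) F ∈ P.periodDomain) ∧
  ∀ N ∈ σ, ∀ p, actV (matC N) (F p) ≤ F (p - 1)

/-- The set of all `σ`-nilpotent orbits (with `σ` fixed, an orbit is the set `exp(σ_ℂ) F`). -/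
def nilpotentOrbits (σ : PointedCone ℝ (Matrix ι ι ℝ)) : Set (Set (Filt ι)) :=
  {Z | ∃ F, P.GeneratesOrbit σ F ∧ Z = expOrbit σ F}

/-- The nilpotent cone `σ` is of even-type: for every `σ`-nilpotent orbit, `N^2 = 0` for
`N ∈ σ°`, and `I^{p,-p} = 0` for all odd `p`. -/
def IsEvenCone (σ : PointedCone ℝ (Matrix ι ι ℝ)) : Prop :=
  P.IsNilpotentCone σ ∧ ∀ F, P.GeneratesOrbit σ F → ∀ N ∈ relInt σ,
    N * N = 0 ∧ ∀ p : ℤ, Odd p → deligne N F p (-p) = ⊥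

/-- The nilpotent cone `σ` is of odd-type: for every `σ`-nilpotent orbit, `N^2 = 0` for
`N ∈ σ°`, and `I^{p,-p} = 0` for all even `p`. -/
def IsOddCone (σ : PointedCone ℝ (Matrix ι ι ℝ)) : Prop :=
  P.IsNilpotentCone σ ∧ ∀ F, P.GeneratesOrbit σ F → ∀ N ∈ relInt σ,
    N * N = 0 ∧ ∀ p : ℤ, Even p → deligne N F p (-p) = ⊥

/-- The weight filtration `W(σ)`, the common value of `W(N)` for `N ∈ σ°`. (The supremum makes it
total; that all `W(N)` agree is part of the theorem that uses it.) -/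
def _root_.HodgeCycle.coneWeight (σ : PointedCone ℝ (Matrix ι ι ℝ)) (k : ℤ) :
    Submodule ℝ (ι → ℝ) :=
  ⨆ N ∈ relInt σ, weight N k

/-! ### The boundary cycle of a pair `(N, F)` -/

/-- `δ ∈ L^{-1,-1}_ℝ(W(N), F)` and `(W(N), exp(-iδ) F)` is `ℝ`-split. -/
def IsDelta (N : Matrix ι ι ℝ) (F : Filt ι) (δ : Matrix ι ι ℝ) : Prop :=
  δ ∈ P.lieG ∧
  (∀ p q, actV (matC δ) (deligne N F p q) ≤
    ⨆ r : ℤ, ⨆ s : ℤ, ⨆ _ : r < p ∧ s < q, deligne N F r s) ∧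
  ∀ p q, conjSub (deligne N (actF (NormedSpace.exp (-(Complex.I • matC δ))) F) p q) =
    deligne N (actF (NormedSpace.exp (-(Complex.I • matC δ))) F) q p

/-- `(N, H, N⁺)` is the image of the standard generators `(n₋, h, n₊)` of `sl₂` under the
homomorphism attached to the `ℝ`-split `(W(N), F)`, normalized by `H = p + q + 1` on `I^{p,q}`. -/
def IsSl2 (N : Matrix ι ι ℝ) (F : Filt ι) (H Np : Matrix ι ι ℝ) : Prop :=
  H ∈ P.lieG ∧ Np ∈ P.lieG ∧
  (∀ p q, ∀ v ∈ deligne N F p q, matC H *ᵥ v = ((p : ℂ) + q + 1) • v) ∧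
  H * N - N * H = -(2 • N) ∧ H * Np - Np * H = 2 • Np ∧ Np * N - N * Np = H

/-- `X = (iN - H + iN⁺)/2`. -/
def _root_.HodgeCycle.cayleyX (N H Np : Matrix ι ι ℝ) : Matrix ι ι ℂ :=
  (1 / 2 : ℂ) • (Complex.I • matC N - matC H + Complex.I • matC Np)

/-- `C = exp(X) C_0`, where `C_0` is the cycle through `F_0 = exp(iN) F̂`, `F̂ = exp(-iδ) F`, and
`δ`, `X` are attached to `(N, F)`. -/
def IsBoundaryCycle (N : Matrix ι ι ℝ) (F : Filt ι) (C : Set (Filt ι)) : Prop :=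
  ∃ δ H Np : Matrix ι ι ℝ, ∃ Fhat : Filt ι,
    P.IsDelta N F δ ∧ Fhat = actF (NormedSpace.exp (-(Complex.I • matC δ))) F ∧
    P.IsSl2 N Fhat H Np ∧
    C = actS (NormedSpace.exp (cayleyX N H Np))
      (P.cycle (actF (NormedSpace.exp (Complex.I • matC N)) Fhat))

end PolData

end HodgeCycle

end

/-!
For `σ` of even type put `e = 0`, and for `σ` of odd type put `e = 1`. Everything reduces to linear
algebra, because `N^2 = 0` leaves only the weights `0, -1, -2`: the exponentials in the statement
are `exp M = 1 + M`, and a pair `(N, F)` is controlled by `I^{p,-p}`, by the Hodge components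
`I^{p,-p-1}` inside `Ker N`, and by `Im N`. The structure `LMHS` axiomatizes what is needed: a
horizontal `F` for which `Ker N ∩ H^{p,-p-1}` is polarized. Dimension counts derive from it that
`(W(N), F)` is a mixed Hodge structure (`LMHS.step`, `LMHS.iSup_delZero_sup_ker`).

*Independence of `N`.* On `I^{p,-p}` the form `(-1)^p ⟨x, N conj x⟩` is positive, as one sees from
the positivity on `exp(iyN) F` for `y → ∞`. Since `I^{p,-p} = 0` unless `p ≡ e` modulo `2`, the
form `(-1)^e ⟨x, N conj x⟩` is semidefinite on the whole space, with radical `Ker N`. Writing `N` as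
a sum of two elements of `σ°` shows that all of them have the same kernel
(`IsTypedCone.kerC_le`), hence, by duality, the same image and the same `W(N)`. Moreover `σ_ℂ` maps
`W_0` to `W_{-2}` and kills `W_{-1}`, so that all members of a nilpotent orbit induce the same
filtrations on the graded pieces (`IsTypedCone.typedLMHS_of_mem`).

*Existence and uniqueness of the cycle.* Let `Y` be the grading operator, equal to `p + q + 1` on
`I^{p,q}`. A structure is `ℝ`-split iff `Y` is real, and passing to `exp(-iδ) F` replaces `Y` by
`Y - 2iδ`; so `δ = (Y - conj Y) / 4i` is the only choice, and it works
(`TypedLMHS.existsUnique_isDelta`). Then `H = Y`, and `N⁺` is the inverse of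
`N : ⨁ I^{p,-p} → Im N`, extended by `0` (`TypedLMHS.exists_isSl2`, `LMHS.isSl2_unique`).

*The limit.* Let `A_e` be the sum of the `I^{p,-p-1}` with `p ≡ e`, and `I` the sum of the
`I^{p,-p}`. The subspaces of parity `e` and `e + 1` attached to `F_0 = exp(iN) F̂` are
`A_e + (1 + iN) I` and `A_{e+1} + (1 - iN) I` (`TypedLMHS.mem_periodDomain`). One has `X^2 = 0`, and
`1 + cX` fixes the second subspace and maps the first one to
`A_e + {(1 - c) v + i (1 + c) N v | v ∈ I}` (`actV_cayleyX_tilt`). The hermitian form `i⟨x, conj x⟩`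
has the sign `(-1)^e` there exactly as long as `|c| < 1`, or `I = 0`. A translate of a cycle lies
in `D` as soon as the form has the right signs on its two subspaces (`actS_cycle_subset`). So
`exp(X) C_0`, which is the case `c = 1`, is a limit of cycles in `D`, and its subspace of parity
`e` is `A_e + Im N`.

*The value.* The cycle determines the subspaces by which the projection is defined
(`actV_part_le`), and in the exceptional case, in which the projection is defined through the
parity `e + 1`, the part `I` vanishes. So the value is `A_e + W_{-2}`
(`parityProj_cayleyX_iff`), which depends on the orbit only. The limit argument that applies to the
cycle also puts this Lagrangian subspace in the closure of the Siegel space or of its conjugate, and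
since `A_e` and its conjugate `A_{e+1}` are independent modulo `W_{-2}`, its real points are those
of `W_{-2}` (`TypedLMHS.vecC_mem_delPart_sup_range`).
-/

set_option linter.unusedSectionVars false

noncomputable section

namespace HodgeCycle

variable {ι : Type*} [Fintype ι] [DecidableEq ι]

/-! ### Real structure on `H_ℂ` -/

lemma matC_mul (A B : Matrix ι ι ℝ) : matC (A * B) = matC A * matC B :=
  Matrix.map_mul (f := Complex.ofRealHom)

lemma matC_add (A B : Matrix ι ι ℝ) : matC (A + B) = matC A + matC B := by
  ext i j; simp [matC]

lemma matC_sub (A B : Matrix ι ι ℝ) : matC (A - B) = matC A - matC B := by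
  ext i j; simp [matC]

lemma matC_neg (A : Matrix ι ι ℝ) : matC (-A) = -matC A := by
  ext i j; simp [matC]

lemma matC_smul (t : ℝ) (A : Matrix ι ι ℝ) : matC (t • A) = (t : ℂ) • matC A := by
  ext i j; simp [matC]

lemma matC_zero : matC (0 : Matrix ι ι ℝ) = 0 := by
  ext i j; simp [matC]

lemma matC_one : matC (1 : Matrix ι ι ℝ) = 1 := by
  ext i j; by_cases h : i = j <;> simp [matC, Matrix.one_apply, h]

lemma matC_transpose (A : Matrix ι ι ℝ) : matC Aᵀ = (matC A)ᵀ := rfl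

lemma matC_injective : Function.Injective (matC : Matrix ι ι ℝ → Matrix ι ι ℂ) := by
  intro A B h
  ext i j
  have := congrFun (congrFun h i) j
  simpa [matC] using this

lemma star_mulVec' (A : Matrix ι ι ℂ) (x : ι → ℂ) :
    star (A *ᵥ x) = A.map star *ᵥ star x := by
  ext i; simp [Matrix.mulVec, dotProduct]

lemma matC_map_star (A : Matrix ι ι ℝ) : (matC A).map star = matC A := by
  ext i j; simp [matC]

lemma star_matC_mulVec (A : Matrix ι ι ℝ) (x : ι → ℂ) :
    star (matC A *ᵥ x) = matC A *ᵥ star x := by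
  rw [star_mulVec', matC_map_star]

lemma matC_mulVec_vecC (A : Matrix ι ι ℝ) (x : ι → ℝ) : matC A *ᵥ vecC x = vecC (A *ᵥ x) := by
  ext i; simp [Matrix.mulVec, dotProduct, matC, vecC]

lemma star_vecC (x : ι → ℝ) : star (vecC x) = vecC x := by
  ext i; simp [vecC]

lemma exists_matC_of_map_star {A : Matrix ι ι ℂ} (h : A.map star = A) :
    ∃ R : Matrix ι ι ℝ, matC R = A := by
  refine ⟨A.map Complex.re, ?_⟩
  ext i j
  have := congrFun (congrFun h i) j
  simp only [Matrix.map_apply] at this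
  simpa [matC] using (Complex.conj_eq_iff_re.1 this)

lemma ext_mulVec {A B : Matrix ι ι ℂ} (h : ∀ x, A *ᵥ x = B *ᵥ x) : A = B :=
  Matrix.mulVec_injective (funext h)

lemma mem_conjSub {V : Submodule ℂ (ι → ℂ)} {x : ι → ℂ} : x ∈ conjSub V ↔ star x ∈ V := Iff.rfl

lemma conjSub_conjSub (V : Submodule ℂ (ι → ℂ)) : conjSub (conjSub V) = V := by
  ext x; simp [mem_conjSub]

/-- Complex conjugation of subspaces, as an automorphism of the lattice of subspaces. -/
def conjIso : Submodule ℂ (ι → ℂ) ≃o Submodule ℂ (ι → ℂ) where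
  toFun := conjSub
  invFun := conjSub
  left_inv := conjSub_conjSub
  right_inv := conjSub_conjSub
  map_rel_iff' := by
    intro V W
    constructor
    · intro h x hx
      have := @h (star x) (by simpa [mem_conjSub] using hx)
      simpa [mem_conjSub] using this
    · intro h x hx
      exact h hx

lemma conjSub_mono {V W : Submodule ℂ (ι → ℂ)} (h : V ≤ W) : conjSub V ≤ conjSub W :=
  fun _ hx => h hx

lemma conjSub_sup (V W : Submodule ℂ (ι → ℂ)) : conjSub (V ⊔ W) = conjSub V ⊔ conjSub W :=
  conjIso.map_sup V W

lemma conjSub_iSup {κ : Sort*} (V : κ → Submodule ℂ (ι → ℂ)) :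
    conjSub (⨆ i, V i) = ⨆ i, conjSub (V i) :=
  conjIso.map_iSup V

lemma finrank_conjSub (V : Submodule ℂ (ι → ℂ)) :
    Module.finrank ℂ (conjSub V) = Module.finrank ℂ V := by
  have : Module.rank ℂ (conjSub V) = Module.rank ℂ V := by
    refine rank_eq_of_equiv_equiv (star : ℂ → ℂ)
      { toFun := fun x => ⟨star (x : ι → ℂ), x.2⟩
        invFun := fun x => ⟨star (x : ι → ℂ), by simp [mem_conjSub]⟩
        left_inv := fun x => by simp
        right_inv := fun x => by simp
        map_add' := fun x y => by ext; simp } star_involutive.bijective ?_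
    intro r m
    ext i
    simp
  simp [Module.finrank, this]

/-! ### Action of matrices on subspaces -/

lemma mem_actV {g : Matrix ι ι ℂ} {V : Submodule ℂ (ι → ℂ)} {x : ι → ℂ} :
    x ∈ actV g V ↔ ∃ y ∈ V, g *ᵥ y = x := by
  simp [actV]

lemma mulVec_mem_actV {g : Matrix ι ι ℂ} {V : Submodule ℂ (ι → ℂ)} {x : ι → ℂ} (hx : x ∈ V) :
    g *ᵥ x ∈ actV g V := mem_actV.2 ⟨x, hx, rfl⟩

lemma actV_le {g : Matrix ι ι ℂ} {V W : Submodule ℂ (ι → ℂ)} :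
    actV g V ≤ W ↔ ∀ x ∈ V, g *ᵥ x ∈ W := by
  constructor
  · intro h x hx; exact h (mulVec_mem_actV hx)
  · intro h x hx
    obtain ⟨y, hy, rfl⟩ := mem_actV.1 hx
    exact h y hy

lemma actV_mono (g : Matrix ι ι ℂ) {V W : Submodule ℂ (ι → ℂ)} (h : V ≤ W) :
    actV g V ≤ actV g W := Submodule.map_mono h

lemma actV_sup (g : Matrix ι ι ℂ) (V W : Submodule ℂ (ι → ℂ)) :
    actV g (V ⊔ W) = actV g V ⊔ actV g W := Submodule.map_sup _ _ _

lemma actV_mul (g h : Matrix ι ι ℂ) (V : Submodule ℂ (ι → ℂ)) :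
    actV (g * h) V = actV g (actV h V) := by
  simp only [actV, Matrix.mulVecLin_mul, Submodule.map_comp]

lemma actV_one (V : Submodule ℂ (ι → ℂ)) : actV 1 V = V := by
  simp [actV]

lemma actF_mul (g h : Matrix ι ι ℂ) (F : Filt ι) : actF (g * h) F = actF g (actF h F) := by
  funext p; exact actV_mul g h (F p)

lemma actF_one (F : Filt ι) : actF 1 F = F := by
  funext p; exact actV_one (F p)

lemma actS_mul (g h : Matrix ι ι ℂ) (C : Set (Filt ι)) : actS (g * h) C = actS g (actS h C) := by
  simp only [actS, Set.image_image, actF_mul]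

lemma conjSub_actV (g : Matrix ι ι ℂ) (V : Submodule ℂ (ι → ℂ)) :
    conjSub (actV g V) = actV (g.map star) (conjSub V) := by
  ext x
  rw [mem_conjSub, mem_actV, mem_actV]
  constructor
  · rintro ⟨y, hy, h⟩
    refine ⟨star y, by simpa [mem_conjSub] using hy, ?_⟩
    rw [← star_mulVec', h, star_star]
  · rintro ⟨y, hy, h⟩
    refine ⟨star y, hy, ?_⟩
    rw [← h, star_mulVec']
    congr 1
    ext i j; simp

lemma conjSub_actV_matC (g : Matrix ι ι ℝ) (V : Submodule ℂ (ι → ℂ)) :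
    conjSub (actV (matC g) V) = actV (matC g) (conjSub V) := by
  rw [conjSub_actV, matC_map_star]

/-! ### The exponential of a square-zero matrix -/

lemma exp_eq_one_add {M : Matrix ι ι ℂ} (h : M * M = 0) : NormedSpace.exp M = 1 + M := by
  rw [NormedSpace.exp_eq_tsum ℂ]
  have h2 : ∀ n : ℕ, n ∉ Finset.range 2 → ((n.factorial : ℂ))⁻¹ • M ^ n = 0 := by
    intro n hn
    obtain ⟨k, rfl⟩ := Nat.exists_eq_add_of_le (not_lt.1 (fun h => hn (Finset.mem_range.2 h)))
    rw [pow_add, pow_two, h, zero_mul, smul_zero]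
  simp only
  rw [tsum_eq_sum h2]
  simp [Finset.sum_range_succ]

namespace PolData

variable (P : PolData ι)

/-! ### The alternating form -/

lemma pairing_add_left (x y z : ι → ℂ) : P.pairing (x + y) z = P.pairing x z + P.pairing y z := by
  simp [pairing, add_dotProduct]

lemma pairing_add_right (x y z : ι → ℂ) : P.pairing x (y + z) = P.pairing x y + P.pairing x z := by
  simp [pairing, Matrix.mulVec_add]

lemma pairing_smul_left (c : ℂ) (x y : ι → ℂ) : P.pairing (c • x) y = c * P.pairing x y := by
  simp [pairing]

lemma pairing_smul_right (c : ℂ) (x y : ι → ℂ) : P.pairing x (c • y) = c * P.pairing x y := by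
  simp [pairing, Matrix.mulVec_smul]

lemma pairing_neg_left (x y : ι → ℂ) : P.pairing (-x) y = -P.pairing x y := by
  simp [pairing]

lemma pairing_neg_right (x y : ι → ℂ) : P.pairing x (-y) = -P.pairing x y := by
  simp [pairing, Matrix.mulVec_neg]

lemma pairing_sub_left (x y z : ι → ℂ) : P.pairing (x - y) z = P.pairing x z - P.pairing y z := by
  simp [pairing, sub_dotProduct]

lemma pairing_sub_right (x y z : ι → ℂ) : P.pairing x (y - z) = P.pairing x y - P.pairing x z := by
  simp [pairing, Matrix.mulVec_sub]

lemma pairing_zero_left (x : ι → ℂ) : P.pairing 0 x = 0 := by simp [pairing]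

lemma pairing_zero_right (x : ι → ℂ) : P.pairing x 0 = 0 := by simp [pairing]

lemma pairing_sum_left {κ : Type*} (s : Finset κ) (f : κ → ι → ℂ) (y : ι → ℂ) :
    P.pairing (∑ i ∈ s, f i) y = ∑ i ∈ s, P.pairing (f i) y := by
  simp [pairing, sum_dotProduct]

lemma pairing_sum_right {κ : Type*} (s : Finset κ) (x : ι → ℂ) (f : κ → ι → ℂ) :
    P.pairing x (∑ i ∈ s, f i) = ∑ i ∈ s, P.pairing x (f i) := by
  simp [pairing, Matrix.mulVec_sum, dotProduct_sum]

lemma QC_transpose : P.QCᵀ = -P.QC := by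
  have := P.alternating
  ext i j
  have h := congrFun (congrFun this i) j
  simp only [Matrix.transpose_apply, Matrix.neg_apply, QC, Matrix.map_apply] at h ⊢
  rw [h]; simp

lemma matC_QR : matC P.QR = P.QC := by
  ext i j; simp [matC, QR, QC]

lemma pairing_swap (x y : ι → ℂ) : P.pairing y x = -P.pairing x y := by
  unfold pairing
  rw [Matrix.dotProduct_mulVec, ← Matrix.mulVec_transpose, QC_transpose, Matrix.neg_mulVec,
    neg_dotProduct, dotProduct_comm]

lemma star_pairing (x y : ι → ℂ) : star (P.pairing x y) = P.pairing (star x) (star y) := by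
  simp [pairing, dotProduct, Matrix.mulVec, QC]

lemma QC_nondegenerate : P.QC.Nondegenerate := by
  apply Matrix.nondegenerate_of_det_ne_zero
  have : P.QC.det = ((P.Q.det : ℤ) : ℂ) := by
    have := (Int.castRingHom ℂ).map_det P.Q
    simpa [QC] using this.symm
  rw [this]
  exact_mod_cast P.nondegenerate

lemma eq_zero_of_pairing {x : ι → ℂ} (h : ∀ y, P.pairing x y = 0) : x = 0 :=
  P.QC_nondegenerate.eq_zero_of_ortho h

/-- The annihilator of a subspace under the alternating form. -/
def orth (V : Submodule ℂ (ι → ℂ)) : Submodule ℂ (ι → ℂ) :=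
  (Matrix.toBilin' P.QC).orthogonal V

lemma mem_orth {V : Submodule ℂ (ι → ℂ)} {y : ι → ℂ} :
    y ∈ P.orth V ↔ ∀ x ∈ V, P.pairing x y = 0 := by
  simp [orth, LinearMap.BilinForm.mem_orthogonal_iff,
    Matrix.toBilin'_apply', pairing]

lemma finrank_orth (V : Submodule ℂ (ι → ℂ)) :
    Module.finrank ℂ (P.orth V) + Module.finrank ℂ V = Fintype.card ι := by
  have := LinearMap.BilinForm.finrank_orthogonal P.QC_nondegenerate.toBilin' V
  have h2 := Submodule.finrank_le V
  rw [Module.finrank_fintype_fun_eq_card] at this h2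
  unfold orth
  omega

/-- The complex Lie algebra of `G_ℂ`. -/
def spC : Set (Matrix ι ι ℂ) := {A | Aᵀ * P.QC + P.QC * A = 0}

lemma pairing_mulVec (A : Matrix ι ι ℂ) (x y : ι → ℂ) :
    P.pairing (A *ᵥ x) y = x ⬝ᵥ ((Aᵀ * P.QC) *ᵥ y) := by
  unfold pairing
  rw [← Matrix.mulVec_mulVec, Matrix.dotProduct_mulVec x, Matrix.vecMul_transpose]

lemma eq_of_dotProduct_mulVec {A B : Matrix ι ι ℂ}
    (h : ∀ x y : ι → ℂ, x ⬝ᵥ (A *ᵥ y) = x ⬝ᵥ (B *ᵥ y)) : A = B := by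
  apply ext_mulVec
  intro y
  exact dotProduct_eq _ _ (fun x => by rw [dotProduct_comm, h x y, dotProduct_comm])

lemma mem_spC {A : Matrix ι ι ℂ} :
    A ∈ P.spC ↔ ∀ x y, P.pairing (A *ᵥ x) y = -P.pairing x (A *ᵥ y) := by
  constructor
  · intro h x y
    rw [pairing_mulVec, eq_neg_of_add_eq_zero_left h]
    simp [pairing, Matrix.neg_mulVec, Matrix.mulVec_mulVec]
  · intro h
    have : Aᵀ * P.QC = -(P.QC * A) := by
      apply eq_of_dotProduct_mulVec
      intro x y
      rw [← pairing_mulVec, h]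
      simp [pairing, Matrix.neg_mulVec, Matrix.mulVec_mulVec]
    simp [spC, this]

lemma mem_GC {g : Matrix ι ι ℂ} :
    g ∈ P.GC ↔ ∀ x y, P.pairing (g *ᵥ x) (g *ᵥ y) = P.pairing x y := by
  constructor
  · intro h x y
    rw [pairing_mulVec, Matrix.mulVec_mulVec, h]; rfl
  · intro h
    apply eq_of_dotProduct_mulVec
    intro x y
    rw [← Matrix.mulVec_mulVec, ← pairing_mulVec, h]; rfl

lemma matC_mem_spC {A : Matrix ι ι ℝ} : matC A ∈ P.spC ↔ A ∈ P.lieG := by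
  have : (matC A)ᵀ * P.QC + P.QC * matC A = matC (Aᵀ * P.QR + P.QR * A) := by
    rw [matC_add, matC_mul, matC_mul, matC_QR, matC_transpose]
  simp only [spC, lieG, Set.mem_ofPred_eq, this]
  rw [← matC_zero]
  exact matC_injective.eq_iff

lemma matC_mem_GC {A : Matrix ι ι ℝ} : matC A ∈ P.GC ↔ A ∈ P.GR := by
  have : (matC A)ᵀ * P.QC * matC A = matC (Aᵀ * P.QR * A) := by
    rw [matC_mul, matC_mul, matC_QR, matC_transpose]
  simp only [GC, GR, Set.mem_ofPred_eq, this]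
  rw [← matC_QR]
  exact matC_injective.eq_iff

lemma GC_one : (1 : Matrix ι ι ℂ) ∈ P.GC := by
  rw [mem_GC]; simp

lemma GC_map_star {g : Matrix ι ι ℂ} (hg : g ∈ P.GC) : g.map star ∈ P.GC := by
  rw [mem_GC] at *
  intro x y
  have := congrArg star (hg (star x) (star y))
  rw [star_pairing, star_pairing, star_mulVec', star_mulVec'] at this
  simpa using this

lemma GC_injective {g : Matrix ι ι ℂ} (hg : g ∈ P.GC) {x y : ι → ℂ} (h : g *ᵥ x = g *ᵥ y) :
    x = y := by
  rw [← sub_eq_zero]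
  apply P.eq_zero_of_pairing
  intro z
  rw [← P.mem_GC.1 hg, Matrix.mulVec_sub, h, sub_self, pairing_zero_left]

lemma finrank_actV {g : Matrix ι ι ℂ} (hg : g ∈ P.GC) (V : Submodule ℂ (ι → ℂ)) :
    Module.finrank ℂ (actV g V) = Module.finrank ℂ V :=
  (Submodule.equivMapOfInjective g.mulVecLin (fun _ _ h => P.GC_injective hg h) V).symm.finrank_eq

lemma mulVec_mem_actV_iff {g : Matrix ι ι ℂ} (hg : g ∈ P.GC) {V : Submodule ℂ (ι → ℂ)}
    {x : ι → ℂ} : g *ᵥ x ∈ actV g V ↔ x ∈ V := by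
  constructor
  · intro h
    obtain ⟨y, hy, hxy⟩ := mem_actV.1 h
    rwa [← P.GC_injective hg hxy]
  · exact mulVec_mem_actV

lemma one_add_mem_GC {M : Matrix ι ι ℂ} (hM : M ∈ P.spC) (h2 : M * M = 0) : 1 + M ∈ P.GC := by
  rw [mem_GC]
  rw [mem_spC] at hM
  intro x y
  have h3 : M *ᵥ (M *ᵥ y) = 0 := by rw [Matrix.mulVec_mulVec, h2, Matrix.zero_mulVec]
  simp only [Matrix.add_mulVec, Matrix.one_mulVec, pairing_add_left, pairing_add_right, hM, h3,
    pairing_zero_right]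
  ring

lemma spC_smul {A : Matrix ι ι ℂ} (c : ℂ) (hA : A ∈ P.spC) : c • A ∈ P.spC := by
  rw [mem_spC] at *
  intro x y
  simp [Matrix.smul_mulVec, pairing_smul_left, pairing_smul_right, hA x y]

lemma spC_add {A B : Matrix ι ι ℂ} (hA : A ∈ P.spC) (hB : B ∈ P.spC) : A + B ∈ P.spC := by
  rw [mem_spC] at *
  intro x y
  rw [Matrix.add_mulVec, Matrix.add_mulVec, pairing_add_left, pairing_add_right, hA, hB]
  ring

lemma spC_map_star {A : Matrix ι ι ℂ} (hA : A ∈ P.spC) : A.map star ∈ P.spC := by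
  rw [mem_spC] at *
  intro x y
  have := congrArg star (hA (star x) (star y))
  rw [star_neg, star_pairing, star_pairing, star_mulVec', star_mulVec'] at this
  simpa using this

/-! ### The hermitian form -/

/-- The hermitian form `i⟨x, conj y⟩`, linear in `x` and antilinear in `y`. -/
def herm (x y : ι → ℂ) : ℂ := Complex.I * P.pairing x (star y)

lemma star_herm (x y : ι → ℂ) : star (P.herm x y) = P.herm y x := by
  have : star Complex.I = -Complex.I := Complex.conj_I
  rw [herm, star_mul, star_pairing, star_star, pairing_swap, this, herm]
  ring

lemma herm_self (x : ι → ℂ) : ((P.herm x x).re : ℂ) = P.herm x x :=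
  Complex.conj_eq_iff_re.1 (P.star_herm x x)

lemma herm_add_left (x y z : ι → ℂ) : P.herm (x + y) z = P.herm x z + P.herm y z := by
  simp only [herm, pairing_add_left, mul_add]

lemma herm_add_right (x y z : ι → ℂ) : P.herm x (y + z) = P.herm x y + P.herm x z := by
  simp only [herm, star_add, pairing_add_right, mul_add]

lemma herm_sub_left (x y z : ι → ℂ) : P.herm (x - y) z = P.herm x z - P.herm y z := by
  simp only [herm, pairing_sub_left, mul_sub]

lemma herm_sub_right (x y z : ι → ℂ) : P.herm x (y - z) = P.herm x y - P.herm x z := by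
  simp only [herm, star_sub, pairing_sub_right, mul_sub]

lemma herm_smul_left (c : ℂ) (x y : ι → ℂ) : P.herm (c • x) y = c * P.herm x y := by
  simp only [herm, pairing_smul_left]; ring

lemma herm_smul_right (c : ℂ) (x y : ι → ℂ) : P.herm x (c • y) = star c * P.herm x y := by
  simp only [herm, star_smul, pairing_smul_right]; ring

lemma herm_zero_left (x : ι → ℂ) : P.herm 0 x = 0 := by simp [herm, pairing_zero_left]

lemma herm_eq_zero_comm {x y : ι → ℂ} : P.herm x y = 0 ↔ P.herm y x = 0 := by
  rw [← star_herm, star_eq_zero]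

end PolData

/-! ### Filtrations and parity -/

/-- The sign `(-1)^p`. -/
def sgn (p : ℤ) : ℝ := (-1 : ℝ) ^ p

lemma sgn_add_one (p : ℤ) : sgn (p + 1) = -sgn p := by
  unfold sgn
  rw [zpow_add_one₀ (by norm_num)]; ring

lemma sgn_mul_self (p : ℤ) : sgn p * sgn p = 1 := by
  unfold sgn
  rw [← mul_zpow]; norm_num

lemma sgn_eq_of_even {p e : ℤ} (h : Even (p + e)) : sgn p = sgn e := by
  have h1 : sgn p * sgn e = 1 := by
    unfold sgn
    rw [← zpow_add₀ (by norm_num)]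
    exact h.neg_one_zpow
  have := sgn_mul_self e
  calc sgn p = sgn p * (sgn e * sgn e) := by rw [this, mul_one]
    _ = sgn e := by rw [← mul_assoc, h1, one_mul]

lemma I_zpow (p : ℤ) : Complex.I ^ (2 * p + 1) = (sgn p : ℂ) * Complex.I := by
  unfold sgn
  rw [zpow_add_one₀ Complex.I_ne_zero, zpow_mul]
  congr 1
  push_cast
  congr 1
  exact Complex.I_sq

/-- Descending induction along a filtration that is eventually zero. -/
lemma filt_le_of_step {F G : Filt ι} (hG : Antitone G) {b : ℤ} (hb : ∀ p, b ≤ p → F p = ⊥)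
    (h : ∀ p, F p ≤ F (p + 1) ⊔ G p) (p : ℤ) : F p ≤ G p := by
  rcases le_total b p with hp | hp
  · rw [hb p hp]; exact bot_le
  · induction p, hp using Int.leInductionDown with
    | base => rw [hb b le_rfl]; exact bot_le
    | pred n hn ih =>
      refine (h (n - 1)).trans (sup_le ?_ le_rfl)
      rw [sub_add_cancel]
      exact ih.trans (hG (by omega))

/-- The sum of the `H^{p,-p-1}` with `p ≡ e` modulo `2`. -/
def part (e : ℤ) (F : Filt ι) : Submodule ℂ (ι → ℂ) :=
  ⨆ p : ℤ, ⨆ _ : Even (p + e), hodge F p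

lemma part_congr {e e' : ℤ} (h : Even (e + e')) (F : Filt ι) : part e F = part e' F := by
  unfold part
  congr 1
  funext p
  have : Even (p + e) ↔ Even (p + e') := by
    rw [Int.even_add] at *
    rw [Int.even_add]; tauto
  simp only [this]

lemma evenPart_eq (F : Filt ι) : evenPart F = part 0 F := by
  simp [evenPart, part]

lemma oddPart_eq (F : Filt ι) : oddPart F = part 1 F := by
  simp only [oddPart, part, Int.even_add_one, Int.not_even_iff_odd]

lemma part_add_two (e : ℤ) (F : Filt ι) : part (e + 1 + 1) F = part e F :=
  part_congr (by use e + 1; ring) F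

lemma hodge_le_part {F : Filt ι} {e p : ℤ} (h : Even (p + e)) : hodge F p ≤ part e F :=
  le_iSup₂_of_le p h le_rfl

lemma mem_hodge {F : Filt ι} {p : ℤ} {x : ι → ℂ} :
    x ∈ hodge F p ↔ x ∈ F p ∧ star x ∈ F (-1 - p) := Iff.rfl

lemma star_mem_hodge {F : Filt ι} {p : ℤ} {x : ι → ℂ} (hx : x ∈ hodge F p) :
    star x ∈ hodge F (-1 - p) := by
  rw [mem_hodge] at *
  refine ⟨hx.2, ?_⟩
  rw [star_star]
  have : -1 - (-1 - p) = p := by ring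
  rw [this]; exact hx.1

lemma conjSub_hodge (F : Filt ι) (p : ℤ) : conjSub (hodge F p) = hodge F (-1 - p) := by
  ext x
  rw [mem_conjSub]
  constructor
  · intro h; simpa using star_mem_hodge h
  · intro h
    have := star_mem_hodge h
    have h2 : -1 - (-1 - p) = p := by ring
    rwa [h2] at this

lemma even_reflect {p e : ℤ} : Even (-1 - p + (e + 1)) ↔ Even (p + e) := by
  constructor <;> rintro ⟨r, hr⟩
  · exact ⟨e - r, by omega⟩
  · exact ⟨e - r, by omega⟩

/-- Conjugation exchanges sums over the two parities of a family that it reflects. -/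
lemma conjSub_iSup_parity {V : ℤ → Submodule ℂ (ι → ℂ)}
    (hV : ∀ p, conjSub (V p) = V (-1 - p)) (e : ℤ) :
    conjSub (⨆ p : ℤ, ⨆ _ : Even (p + e), V p) = ⨆ p : ℤ, ⨆ _ : Even (p + (e + 1)), V p := by
  simp only [conjSub_iSup, hV]
  apply le_antisymm
  · refine iSup₂_le fun p hp => ?_
    exact le_iSup₂_of_le (-1 - p) (even_reflect.2 hp) le_rfl
  · refine iSup₂_le fun p hp => ?_
    have h2 : -1 - (-1 - p) = p := by ring
    refine le_iSup₂_of_le (-1 - p) ?_ (by rw [h2])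
    rw [← even_reflect, h2]
    exact hp

lemma conjSub_part (e : ℤ) (F : Filt ι) : conjSub (part e F) = part (e + 1) F :=
  conjSub_iSup_parity (conjSub_hodge F) e

namespace PolData

variable (P : PolData ι)

lemma re_I_zpow_pairing (p : ℤ) (x : ι → ℂ) :
    (Complex.I ^ (2 * p + 1) * P.pairing x (star x)).re = sgn p * (P.herm x x).re := by
  rw [I_zpow, mul_assoc, ← herm, Complex.re_ofReal_mul]

/-- An element of the sum of subspaces that are mutually orthogonal for the sesquilinear form
`⟨x, A conj y⟩` decomposes so that the values of the form add up. -/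
lemma exists_orthogonal_decomposition {κ : Type*} {V : κ → Submodule ℂ (ι → ℂ)}
    (A : Matrix ι ι ℂ)
    (hV : ∀ p q, p ≠ q → ∀ x ∈ V p, ∀ y ∈ V q, P.pairing x (A *ᵥ star y) = 0)
    {x : ι → ℂ} (hx : x ∈ ⨆ p, V p) :
    ∃ f : κ →₀ (ι → ℂ), (∀ p, f p ∈ V p) ∧ ∑ p ∈ f.support, f p = x ∧
      P.pairing x (A *ᵥ star x) = ∑ p ∈ f.support, P.pairing (f p) (A *ᵥ star (f p)) := by
  obtain ⟨f, hf, rfl⟩ := (Submodule.mem_iSup_iff_exists_finsupp V x).1 hx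
  refine ⟨f, hf, rfl, ?_⟩
  simp only [Finsupp.sum, star_sum, Matrix.mulVec_sum, pairing_sum_left, pairing_sum_right]
  refine Finset.sum_congr rfl fun p hp => ?_
  exact Finset.sum_eq_single p (fun q _ hq => hV q p hq _ (hf q) _ (hf p))
    (fun h => absurd hp h)

lemma nonneg_of_mem_iSup {κ : Type*} {V : κ → Submodule ℂ (ι → ℂ)} (A : Matrix ι ι ℂ)
    (hV : ∀ p q, p ≠ q → ∀ x ∈ V p, ∀ y ∈ V q, P.pairing x (A *ᵥ star y) = 0)
    (h0 : ∀ p, ∀ x ∈ V p, 0 ≤ (P.pairing x (A *ᵥ star x)).re)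
    {x : ι → ℂ} (hx : x ∈ ⨆ p, V p) : 0 ≤ (P.pairing x (A *ᵥ star x)).re := by
  obtain ⟨f, hf, -, h⟩ := P.exists_orthogonal_decomposition A hV hx
  rw [h, Complex.re_sum]
  exact Finset.sum_nonneg fun p _ => h0 p _ (hf p)

lemma pos_of_mem_iSup {κ : Type*} {V : κ → Submodule ℂ (ι → ℂ)} (A : Matrix ι ι ℂ)
    (hV : ∀ p q, p ≠ q → ∀ x ∈ V p, ∀ y ∈ V q, P.pairing x (A *ᵥ star y) = 0)
    (h0 : ∀ p, ∀ x ∈ V p, x ≠ 0 → 0 < (P.pairing x (A *ᵥ star x)).re)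
    {x : ι → ℂ} (hx : x ∈ ⨆ p, V p) (hx0 : x ≠ 0) : 0 < (P.pairing x (A *ᵥ star x)).re := by
  obtain ⟨f, hf, hs, h⟩ := P.exists_orthogonal_decomposition A hV hx
  rw [h, Complex.re_sum]
  refine Finset.sum_pos (fun p hp => h0 p _ (hf p) (Finsupp.mem_support_iff.1 hp)) ?_
  by_contra hne
  rw [Finset.not_nonempty_iff_eq_empty] at hne
  rw [hne, Finset.sum_empty] at hs
  exact hx0 hs.symm

/-! ### The compact dual -/

variable {P}

lemma pairing_eq_zero {F : Filt ι} (hF : F ∈ P.compactDual) {a b : ℤ} (hab : 0 ≤ a + b)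
    {x y : ι → ℂ} (hx : x ∈ F a) (hy : y ∈ F b) : P.pairing x y = 0 :=
  hF.2.2 a x hx y (hF.1 (by omega) hy)

lemma exists_bot {F : Filt ι} (hF : F ∈ P.compactDual) : ∃ b : ℤ, ∀ p, b ≤ p → F p = ⊥ := by
  obtain ⟨b, hb⟩ := P.h.support.bddAbove
  refine ⟨b + 1, fun p hp => ?_⟩
  rw [← Submodule.finrank_eq_zero (R := ℂ), hF.2.1 p]
  apply Finset.sum_eq_zero
  intro r hr
  rw [Finset.mem_filter] at hr
  have := hb hr.1
  omega

lemma exists_top {F : Filt ι} (hF : F ∈ P.compactDual) : ∃ a : ℤ, ∀ p, p ≤ a → F p = ⊤ := by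
  obtain ⟨b, hb⟩ := P.h.support.bddBelow
  refine ⟨b, fun p hp => ?_⟩
  apply Submodule.eq_top_of_finrank_eq
  rw [hF.2.1 p, Module.finrank_fintype_fun_eq_card, ← P.h_total]
  congr 1
  apply Finset.filter_true_of_mem
  intro r hr
  exact hp.trans (hb hr)

lemma finrank_add_finrank_neg {F : Filt ι} (hF : F ∈ P.compactDual) (p : ℤ) :
    Module.finrank ℂ (F p) + Module.finrank ℂ (F (-p)) = Fintype.card ι := by
  rw [hF.2.1, hF.2.1, ← P.h_total, ← Finset.sum_filter_add_sum_filter_not P.h.support (p ≤ ·)]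
  congr 1
  refine Finset.sum_nbij' (fun r => -1 - r) (fun r => -1 - r) ?_ ?_ ?_ ?_ ?_
  · intro r hr
    simp only [Finset.mem_filter, Finsupp.mem_support_iff, P.h_symm] at hr ⊢
    exact ⟨hr.1, by omega⟩
  · intro r hr
    simp only [Finset.mem_filter, Finsupp.mem_support_iff, P.h_symm] at hr ⊢
    exact ⟨hr.1, by omega⟩
  · intro r _; ring
  · intro r _; ring
  · intro r _; rw [P.h_symm]

lemma orth_eq {F : Filt ι} (hF : F ∈ P.compactDual) (p : ℤ) : P.orth (F p) = F (-p) := by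
  symm
  apply Submodule.eq_of_le_of_finrank_eq
  · intro y hy
    rw [mem_orth]
    exact fun x hx => hF.2.2 p x hx y hy
  · have := finrank_add_finrank_neg hF p
    have := P.finrank_orth (F p)
    omega

lemma eq_succ_of_h_eq_zero {F : Filt ι} (hF : F ∈ P.compactDual) {p : ℤ} (hp : P.h p = 0) :
    F p = F (p + 1) := by
  symm
  apply Submodule.eq_of_le_of_finrank_eq (hF.1 (by omega))
  rw [hF.2.1, hF.2.1]
  congr 1
  ext r
  simp only [Finset.mem_filter, Finsupp.mem_support_iff]
  constructor
  · rintro ⟨h1, h2⟩; exact ⟨h1, by omega⟩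
  · rintro ⟨h1, h2⟩
    refine ⟨h1, ?_⟩
    have : p ≠ r := by rintro rfl; exact h1 hp
    omega

lemma actF_mem_compactDual {F : Filt ι} (hF : F ∈ P.compactDual) {g : Matrix ι ι ℂ}
    (hg : g ∈ P.GC) : actF g F ∈ P.compactDual := by
  refine ⟨fun a b hab => actV_mono g (hF.1 hab), fun p => ?_, fun p x hx y hy => ?_⟩
  · rw [← hF.2.1 p]; exact P.finrank_actV hg _
  · obtain ⟨x', hx', rfl⟩ := mem_actV.1 hx
    obtain ⟨y', hy', rfl⟩ := mem_actV.1 hy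
    rw [P.mem_GC.1 hg]
    exact hF.2.2 p x' hx' y' hy'

/-! ### The period domain -/

lemma hodge_pos {F : Filt ι} (hF : F ∈ P.periodDomain) {p : ℤ} {x : ι → ℂ} (hx : x ∈ hodge F p)
    (h0 : x ≠ 0) : 0 < sgn p * (P.herm x x).re := by
  rw [← re_I_zpow_pairing]
  exact hF.2.2 p x hx h0

lemma eq_zero_of_mem_of_star_mem {F : Filt ι} (hF : F ∈ P.periodDomain) {a b : ℤ}
    (hab : 0 ≤ a + b) {x : ι → ℂ} (hx : x ∈ F a) (hy : star x ∈ F b) : x = 0 := by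
  have := (hF.2.1 a).disjoint
  rw [Submodule.disjoint_def] at this
  exact this x hx (hF.1.1 (by omega) hy)

lemma le_succ_sup_hodge {F : Filt ι} (hF : F ∈ P.periodDomain) (p : ℤ) :
    F p ≤ F (p + 1) ⊔ hodge F p := by
  intro x hx
  have : x ∈ F (p + 1) ⊔ conjSub (F (-(p + 1))) := by
    rw [(hF.2.1 (p + 1)).sup_eq_top]; trivial
  obtain ⟨a, ha, b, hb, rfl⟩ := Submodule.mem_sup.1 this
  have h1 : a ∈ F p := hF.1.1 (by omega) ha
  refine Submodule.add_mem_sup ha ⟨?_, ?_⟩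
  · simpa using (F p).sub_mem hx h1
  · have h2 : -1 - p = -(p + 1) := by ring
    rw [h2]; exact hb

lemma herm_hodge_eq_zero {F : Filt ι} (hF : F ∈ P.compactDual) {p q : ℤ} (hpq : p ≠ q)
    {x y : ι → ℂ} (hx : x ∈ hodge F p) (hy : y ∈ hodge F q) : P.herm x y = 0 := by
  rcases lt_or_gt_of_ne hpq with h | h
  · rw [herm_eq_zero_comm, herm, pairing_eq_zero hF (by omega) hy.1 hx.2, mul_zero]
  · rw [herm, pairing_eq_zero hF (by omega) hx.1 hy.2, mul_zero]

lemma herm_eq_pairing (x y : ι → ℂ) (c : ℂ) :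
    c * P.herm x y = P.pairing x (((c * Complex.I) • (1 : Matrix ι ι ℂ)) *ᵥ star y) := by
  rw [Matrix.smul_mulVec, Matrix.one_mulVec, pairing_smul_right, herm, mul_assoc]

/-- The hermitian form is definite of sign `(-1)^e` on a sum of mutually orthogonal subspaces
`V p`, `p ≡ e`, on which it has sign `(-1)^p`. -/
lemma herm_pos_of_parity {V : ℤ → Submodule ℂ (ι → ℂ)} {e : ℤ}
    (hV : ∀ p q, p ≠ q → ∀ x ∈ V p, ∀ y ∈ V q, P.herm x y = 0)
    (h0 : ∀ p, ∀ x ∈ V p, x ≠ 0 → 0 < sgn p * (P.herm x x).re)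
    {x : ι → ℂ} (hx : x ∈ ⨆ p : ℤ, ⨆ _ : Even (p + e), V p) (hx0 : x ≠ 0) :
    0 < sgn e * (P.herm x x).re := by
  rw [← Complex.re_ofReal_mul, herm_eq_pairing]
  have hle : ∀ p, (⨆ _ : Even (p + e), V p) ≤ V p := fun p => iSup_le fun _ => le_rfl
  refine P.pos_of_mem_iSup _ ?_ ?_ hx hx0
  · intro p q hpq x hx y hy
    rw [← herm_eq_pairing, hV p q hpq x (hle p hx) y (hle q hy), mul_zero]
  · intro p x hx hx0
    rw [← herm_eq_pairing, Complex.re_ofReal_mul]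
    by_cases hp : Even (p + e)
    · rw [← sgn_eq_of_even hp]
      exact h0 p x (hle p hx) hx0
    · rw [iSup_neg hp, Submodule.mem_bot] at hx
      exact absurd hx hx0

lemma part_pos {F : Filt ι} (hF : F ∈ P.periodDomain) {e : ℤ} {x : ι → ℂ} (hx : x ∈ part e F)
    (h0 : x ≠ 0) : 0 < sgn e * (P.herm x x).re :=
  herm_pos_of_parity (fun _ _ hpq _ hx _ hy => herm_hodge_eq_zero hF.1 hpq hx hy)
    (fun _ _ hx h0 => hodge_pos hF hx h0) hx h0

lemma part_sup_part {F : Filt ι} (hF : F ∈ P.periodDomain) (e : ℤ) :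
    part e F ⊔ part (e + 1) F = ⊤ := by
  obtain ⟨b, hb⟩ := exists_bot hF.1
  obtain ⟨a, ha⟩ := exists_top hF.1
  rw [eq_top_iff, ← ha a le_rfl]
  refine filt_le_of_step (G := fun _ => part e F ⊔ part (e + 1) F) antitone_const hb
    (fun p => (le_succ_sup_hodge hF p).trans (sup_le_sup le_rfl ?_)) a
  by_cases hp : Even (p + e)
  · exact (hodge_le_part hp).trans le_sup_left
  · refine (hodge_le_part ?_).trans le_sup_right
    rw [← add_assoc]
    exact Int.even_add_one.2 hp

/-- Two subspaces on which the hermitian form has opposite signs are disjoint. -/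
lemma eq_zero_of_pos_of_neg {e : ℤ} {V W : Submodule ℂ (ι → ℂ)}
    (hV : ∀ x ∈ V, x ≠ 0 → 0 < sgn e * (P.herm x x).re)
    (hW : ∀ x ∈ W, x ≠ 0 → 0 < sgn (e + 1) * (P.herm x x).re) {x : ι → ℂ} (h1 : x ∈ V)
    (h2 : x ∈ W) : x = 0 := by
  by_contra h0
  have h1 := hV x h1 h0
  have h2 := hW x h2 h0
  rw [sgn_add_one] at h2
  linarith

lemma part_isCompl {F : Filt ι} (hF : F ∈ P.periodDomain) (e : ℤ) :
    IsCompl (part e F) (part (e + 1) F) :=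
  ⟨Submodule.disjoint_def.2 fun _ h1 h2 =>
      eq_zero_of_pos_of_neg (fun _ hx h0 => part_pos hF hx h0) (fun _ hx h0 => part_pos hF hx h0)
        h1 h2,
    codisjoint_iff.2 (part_sup_part hF e)⟩

lemma finrank_part {F : Filt ι} (hF : F ∈ P.periodDomain) (e : ℤ) :
    2 * Module.finrank ℂ (part e F) = Fintype.card ι := by
  have h := Submodule.finrank_add_eq_of_isCompl (part_isCompl hF e)
  rw [← conjSub_part, finrank_conjSub, Module.finrank_fintype_fun_eq_card] at h
  omega

/-- A family that `⟨ , ⟩` pairs like the Hodge components is isotropic within one parity. -/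
lemma isotropic_of_parity {V : ℤ → Submodule ℂ (ι → ℂ)} {e : ℤ}
    (hV : ∀ p q, p + q ≠ -1 → ∀ x ∈ V p, ∀ y ∈ V q, P.pairing x y = 0)
    {x y : ι → ℂ} (hx : x ∈ ⨆ p : ℤ, ⨆ _ : Even (p + e), V p)
    (hy : y ∈ ⨆ p : ℤ, ⨆ _ : Even (p + e), V p) : P.pairing x y = 0 := by
  suffices h : (⨆ p : ℤ, ⨆ _ : Even (p + e), V p) ≤ P.orth (⨆ p : ℤ, ⨆ _ : Even (p + e), V p) from
    P.mem_orth.1 (h hy) x hx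
  refine iSup₂_le fun q hq y hy => ?_
  suffices h : (⨆ p : ℤ, ⨆ _ : Even (p + e), V p) ≤ P.orth (V q) by
    rw [mem_orth]
    intro x hx
    rw [pairing_swap, P.mem_orth.1 (h hx) y hy, neg_zero]
  refine iSup₂_le fun p hp x hx => ?_
  rw [mem_orth]
  intro y hy
  refine hV q p ?_ y hy x hx
  obtain ⟨r, hr⟩ := hp
  obtain ⟨s, hs⟩ := hq
  omega

lemma pairing_hodge_eq_zero {F : Filt ι} (hF : F ∈ P.compactDual) {p q : ℤ} (hpq : p + q ≠ -1)
    {x y : ι → ℂ} (hx : x ∈ hodge F p) (hy : y ∈ hodge F q) : P.pairing x y = 0 := by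
  rcases lt_or_gt_of_ne hpq with h | h
  · rw [← star_eq_zero, star_pairing]
    exact pairing_eq_zero hF (by omega) hx.2 hy.2
  · exact pairing_eq_zero hF (by omega) hx.1 hy.1

lemma part_isotropic {F : Filt ι} (hF : F ∈ P.compactDual) {e : ℤ} {x y : ι → ℂ}
    (hx : x ∈ part e F) (hy : y ∈ part e F) : P.pairing x y = 0 :=
  isotropic_of_parity (fun _ _ hpq _ hx _ hy => pairing_hodge_eq_zero hF hpq hx hy) hx hy

/-! ### Filtrations graded by a definite pair -/

/-- The step `F^p / F^{p+1}` is represented in `V` if `p ≡ e`, and in `W` otherwise. -/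
def GradedBy (e : ℤ) (F : Filt ι) (V W : Submodule ℂ (ι → ℂ)) : Prop :=
  ∀ p, (Even (p + e) → F p ≤ F (p + 1) ⊔ (F p ⊓ V)) ∧
    (Even (p + (e + 1)) → F p ≤ F (p + 1) ⊔ (F p ⊓ W))

lemma GradedBy.swap {e : ℤ} {F : Filt ι} {V W : Submodule ℂ (ι → ℂ)} (h : GradedBy e F V W) :
    GradedBy (e + 1) F W V := fun p =>
  ⟨(h p).2, fun hp => (h p).1 (by obtain ⟨r, hr⟩ := hp; exact ⟨r - 1, by omega⟩)⟩

lemma even_or (p e : ℤ) : Even (p + e) ∨ Even (p + (e + 1)) := by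
  rcases Int.even_or_odd (p + e) with h | ⟨r, hr⟩
  · exact Or.inl h
  · exact Or.inr ⟨r + 1, by omega⟩

lemma GradedBy.act {e : ℤ} {F : Filt ι} {V W : Submodule ℂ (ι → ℂ)} (h : GradedBy e F V W)
    (g : Matrix ι ι ℂ) : GradedBy e (actF g F) (actV g V) (actV g W) := by
  have key : ∀ p, ∀ V : Submodule ℂ (ι → ℂ), F p ≤ F (p + 1) ⊔ (F p ⊓ V) →
      actF g F p ≤ actF g F (p + 1) ⊔ (actF g F p ⊓ actV g V) := by
    intro p V h
    refine (actV_mono g h).trans ?_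
    rw [actV_sup]
    exact sup_le_sup le_rfl (le_inf (actV_mono g inf_le_left) (actV_mono g inf_le_right))
  exact fun p => ⟨fun hp => key p V ((h p).1 hp), fun hp => key p W ((h p).2 hp)⟩

lemma gradedBy_part {F : Filt ι} (hF : F ∈ P.periodDomain) (e : ℤ) :
    GradedBy e F (part e F) (part (e + 1) F) := fun p =>
  ⟨fun hp => (le_succ_sup_hodge hF p).trans
    (sup_le_sup le_rfl (le_inf inf_le_left (hodge_le_part hp))),
   fun hp => (le_succ_sup_hodge hF p).trans
    (sup_le_sup le_rfl (le_inf inf_le_left (hodge_le_part hp)))⟩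

lemma GradedBy.le_sup {e : ℤ} {F : Filt ι} {V W : Submodule ℂ (ι → ℂ)} (h : GradedBy e F V W)
    (hF : F ∈ P.compactDual) (p : ℤ) : F p ≤ (F p ⊓ V) ⊔ (F p ⊓ W) := by
  obtain ⟨b, hb⟩ := exists_bot hF
  refine filt_le_of_step (G := fun p => (F p ⊓ V) ⊔ (F p ⊓ W)) ?_ hb (fun p => ?_) p
  · exact fun a b hab => sup_le_sup (inf_le_inf_right _ (hF.1 hab)) (inf_le_inf_right _ (hF.1 hab))
  · rcases even_or p e with hp | hp
    · exact ((h p).1 hp).trans (sup_le_sup le_rfl le_sup_left)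
    · exact ((h p).2 hp).trans (sup_le_sup le_rfl le_sup_right)

lemma GradedBy.mem_succ {e : ℤ} {F : Filt ι} {V W : Submodule ℂ (ι → ℂ)} (h : GradedBy e F V W)
    (hF : F ∈ P.compactDual) (hVW : ∀ x, x ∈ V → x ∈ W → x = 0) {p : ℤ} (hp : Even (p + e))
    {x : ι → ℂ} (hx : x ∈ F p) (hxW : x ∈ W) : x ∈ F (p + 1) := by
  obtain ⟨y, hy, v, hv, hyv⟩ := Submodule.mem_sup.1 ((h p).1 hp hx)
  obtain ⟨a, ha, b, hb, hab⟩ := Submodule.mem_sup.1 (h.le_sup hF (p + 1) hy)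
  have : x - b = a + v := by rw [← hyv, ← hab]; abel
  have h0 : x - b = 0 := hVW _ (by rw [this]; exact V.add_mem ha.2 hv.2) (W.sub_mem hxW hb.2)
  rw [sub_eq_zero.1 h0]
  exact hb.1

/-- Since `x ∈ H^{p,-p-1}` is orthogonal to `F^{p+1}`, its component in the negative subspace
contributes to `h(x,x)` with the positive sign. -/
lemma GradedBy.hodge_pos {e : ℤ} {F : Filt ι} {V W : Submodule ℂ (ι → ℂ)} (h : GradedBy e F V W)
    (hF : F ∈ P.compactDual) (hV : ∀ x ∈ V, x ≠ 0 → 0 < sgn e * (P.herm x x).re)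
    (hW : ∀ x ∈ W, x ≠ 0 → 0 < sgn (e + 1) * (P.herm x x).re) {p : ℤ} (hp : Even (p + e))
    {x : ι → ℂ} (hx : x ∈ hodge F p) (h0 : x ≠ 0) : 0 < sgn p * (P.herm x x).re := by
  obtain ⟨a, ha, b, hb, rfl⟩ := Submodule.mem_sup.1 (h.le_sup hF p hx.1)
  have hb1 := h.mem_succ hF (fun _ => eq_zero_of_pos_of_neg hV hW) hp hb.1 hb.2
  have hbx : P.herm b (a + b) = 0 := by
    rw [herm, pairing_eq_zero hF (by omega) hb1 hx.2, mul_zero]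
  have hxb := P.herm_eq_zero_comm.1 hbx
  have key : P.herm (a + b) (a + b) = P.herm a a - P.herm b b := by
    simp only [herm_add_left, herm_add_right] at hbx hxb ⊢
    linear_combination hbx + hxb
  rw [sgn_eq_of_even hp, key, Complex.sub_re, mul_sub]
  have hV' : 0 ≤ sgn e * (P.herm a a).re := by
    by_cases ha0 : a = 0
    · simp [ha0, herm_zero_left]
    · exact (hV a ha.2 ha0).le
  by_cases hb0 : b = 0
  · subst hb0
    have := hV a ha.2 (by simpa using h0)
    simpa [herm_zero_left] using this
  · have := hW b hb.2 hb0
    rw [sgn_add_one] at this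
    linarith

/-- A point of the compact dual that is graded by a pair of subspaces on which the hermitian form
has the right signs is in the period domain. The pair need not be orthogonal. -/
lemma GradedBy.mem_periodDomain {e : ℤ} {F : Filt ι} {V W : Submodule ℂ (ι → ℂ)}
    (h : GradedBy e F V W) (hF : F ∈ P.compactDual)
    (hV : ∀ x ∈ V, x ≠ 0 → 0 < sgn e * (P.herm x x).re)
    (hW : ∀ x ∈ W, x ≠ 0 → 0 < sgn (e + 1) * (P.herm x x).re) : F ∈ P.periodDomain := by
  refine ⟨hF, fun p => ?_, fun p x hx h0 => ?_⟩
  · have hd : Disjoint (F p) (conjSub (F (-p))) := by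
      rw [Submodule.disjoint_def]
      intro x hx hx'
      obtain ⟨a, ha, b, hb, rfl⟩ := Submodule.mem_sup.1 (h.le_sup hF p hx)
      have h1 : P.herm a (a + b) = 0 := by
        rw [herm, pairing_eq_zero hF (by omega) ha.1 hx', mul_zero]
      have h2 : P.herm b (a + b) = 0 := by
        rw [herm, pairing_eq_zero hF (by omega) hb.1 hx', mul_zero]
      have h3 : P.herm (a + b) b = 0 := P.herm_eq_zero_comm.1 h2
      rw [herm_add_right] at h1
      rw [herm_add_left] at h3
      have h4 : P.herm a a = P.herm b b := by linear_combination h1 - h3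
      have h5 : ¬ (a ≠ 0 ∧ b ≠ 0) := by
        rintro ⟨ha0, hb0⟩
        have := hV a ha.2 ha0
        have := hW b hb.2 hb0
        rw [sgn_add_one, ← h4] at this
        linarith
      by_cases ha0 : a = 0
      · subst ha0
        by_cases hb0 : b = 0
        · simp [hb0]
        · have := hW b hb.2 hb0
          rw [← h4, herm_zero_left] at this
          simp at this
      · have := hV a ha.2 ha0
        have hb0 : b = 0 := by by_contra hb0; exact h5 ⟨ha0, hb0⟩
        rw [h4, hb0, herm_zero_left] at this
        simp at this
    refine ⟨hd, codisjoint_iff.2 ?_⟩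
    apply Submodule.eq_top_of_disjoint _ _ _ hd
    rw [finrank_conjSub, finrank_add_finrank_neg hF, Module.finrank_fintype_fun_eq_card]
  · rw [re_I_zpow_pairing]
    rcases even_or p e with hp | hp
    · exact h.hodge_pos hF hV hW hp hx h0
    · refine h.swap.hodge_pos hF hW (fun x hx h0 => ?_) hp hx h0
      rw [sgn_add_one, sgn_add_one, neg_neg]
      exact hV x hx h0

lemma GradedBy.hodge_le {e : ℤ} {F : Filt ι} {V W : Submodule ℂ (ι → ℂ)}
    (h : GradedBy e F V W) (hF : F ∈ P.periodDomain) (hVW : ∀ x, x ∈ V → x ∈ W → x = 0)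
    (hconj : conjSub V = W) {p : ℤ} (hp : Even (p + e)) : hodge F p ≤ V := by
  intro x hx
  obtain ⟨a, ha, b, hb, rfl⟩ := Submodule.mem_sup.1 (h.le_sup hF.1 p hx.1)
  have hb1 := h.mem_succ hF.1 hVW hp hb.1 hb.2
  obtain ⟨a', ha', b', hb', hab⟩ := Submodule.mem_sup.1 (h.le_sup hF.1 (-1 - p) hx.2)
  have ha1 : a' ∈ F (-1 - p + 1) :=
    h.swap.mem_succ hF.1 (fun x h1 h2 => hVW x h2 h1) (even_reflect.2 hp) ha'.1 ha'.2
  have h1 : b - star a' = star b' - a := by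
    have := congrArg star hab
    rw [star_star, star_add] at this
    rw [sub_eq_sub_iff_add_eq_add, add_comm b a, add_comm (star b')]
    exact this.symm
  have hW : star a' ∈ W := by rw [← hconj, mem_conjSub, star_star]; exact ha'.2
  have hV : star b' ∈ V := by
    have : b' ∈ conjSub V := by rw [hconj]; exact hb'.2
    exact this
  have h2 : b - star a' = 0 := hVW _ (by rw [h1]; exact V.sub_mem hV ha.2) (W.sub_mem hb.2 hW)
  have h3 : b = 0 := by
    refine eq_zero_of_mem_of_star_mem hF (a := p + 1) (b := -1 - p + 1) (by omega) hb1 ?_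
    rw [sub_eq_zero.1 h2, star_star]
    exact ha1
  rw [h3, add_zero]
  exact ha.2

/-- A conjugate pair that grades a point of the period domain is its pair of parity parts. -/
lemma GradedBy.part_eq {e : ℤ} {F : Filt ι} {V W : Submodule ℂ (ι → ℂ)}
    (h : GradedBy e F V W) (hF : F ∈ P.periodDomain) (hVW : ∀ x, x ∈ V → x ∈ W → x = 0)
    (hconj : conjSub V = W) : part e F = V ∧ part (e + 1) F = W := by
  have h1 : part e F ≤ V := iSup₂_le fun p hp => h.hodge_le hF hVW hconj hp
  have h2 : part (e + 1) F ≤ W := iSup₂_le fun p hp =>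
    h.swap.hodge_le hF (fun x h1 h2 => hVW x h2 h1) (by rw [← hconj, conjSub_conjSub]) hp
  have h3 : V ≤ part e F := by
    intro v hv
    have : v ∈ part e F ⊔ part (e + 1) F := by rw [part_sup_part hF]; trivial
    obtain ⟨a, ha, b, hb, rfl⟩ := Submodule.mem_sup.1 this
    have : b = 0 := hVW b (by simpa using V.sub_mem hv (h1 ha)) (h2 hb)
    rw [this, add_zero]; exact ha
  have h4 : part e F = V := le_antisymm h1 h3
  exact ⟨h4, by rw [← conjSub_part, h4, hconj]⟩

/-! ### The cycle of a point of the period domain -/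

lemma actV_part_of_mem_maxCompact {F : Filt ι} {k : Matrix ι ι ℝ} (hk : k ∈ P.maxCompact F)
    (e : ℤ) : actV (matC k) (part e F) = part e F := by
  have h0 : actV (matC k) (part 0 F) = part 0 F := by rw [← evenPart_eq]; exact hk.2
  rcases Int.even_or_odd e with he | he
  · rw [part_congr (e' := 0) (by simpa using he) F, h0]
  · have h1 : actV (matC k) (part (0 + 1) F) = part (0 + 1) F := by
      rw [← conjSub_part, ← conjSub_actV_matC, h0]
    rw [part_congr (e' := 0 + 1) (by simpa using he.add_one) F, h1]

/-- A translate `g C_F` lies in the period domain as soon as the hermitian form has the right signs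
on the two subspaces attached to it. -/
lemma actS_cycle_subset {F : Filt ι} (hF : F ∈ P.periodDomain) {g : Matrix ι ι ℂ}
    (hg : g ∈ P.GC) {e : ℤ}
    (hV : ∀ x ∈ actV g (part e F), x ≠ 0 → 0 < sgn e * (P.herm x x).re)
    (hW : ∀ x ∈ actV g (part (e + 1) F), x ≠ 0 → 0 < sgn (e + 1) * (P.herm x x).re) :
    actS g (P.cycle F) ⊆ P.periodDomain := by
  rintro _ ⟨_, ⟨k, hk, rfl⟩, rfl⟩
  have h := ((gradedBy_part hF e).act (matC k)).act g
  rw [actV_part_of_mem_maxCompact hk, actV_part_of_mem_maxCompact hk] at h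
  exact h.mem_periodDomain
    (actF_mem_compactDual (actF_mem_compactDual hF.1 (P.matC_mem_GC.2 hk.1)) hg) hV hW

end PolData

namespace PolData

variable {P : PolData ι}

/-! ### The unitary group acts transitively on the lines of a parity part -/

lemma mem_maxCompact_of_actV_part {F : Filt ι} {k : Matrix ι ι ℝ} (hk : k ∈ P.GR) {e : ℤ}
    (h : actV (matC k) (part e F) = part e F) : k ∈ P.maxCompact F := by
  refine ⟨hk, ?_⟩
  rw [evenPart_eq]
  rcases Int.even_or_odd e with he | he
  · rw [part_congr (e' := e) (by simpa using he) F, h]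
  · have h1 : actV (matC k) (part (e + 1) F) = part (e + 1) F := by
      rw [← conjSub_part, ← conjSub_actV_matC, h]
    rw [part_congr (e' := e + 1) (by simpa using he.add_one) F, h1]

lemma vecMulVec_vecMul_mulVec (a b x : ι → ℂ) :
    Matrix.vecMulVec a (b ᵥ* P.QC) *ᵥ x = P.pairing b x • a := by
  rw [Matrix.vecMulVec_mulVec, pairing, Matrix.dotProduct_mulVec]
  ext i; simp [mul_comm]

/-- The reflection in a non-isotropic vector `w` of the hermitian space `part e F`, extended to
`H_ℂ` by complex conjugation. -/
lemma exists_reflection {F : Filt ι} (hF : F ∈ P.periodDomain) {e : ℤ} {w : ι → ℂ}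
    (hw : w ∈ part e F) (hw0 : w ≠ 0) :
    ∃ k ∈ P.maxCompact F, ∀ x ∈ part e F,
      matC k *ᵥ x = x - (2 * P.herm x w / P.herm w w) • w := by
  set c : ℂ := P.pairing w (star w) with hc
  have hc0 : c ≠ 0 := by
    intro h
    have := part_pos hF hw hw0
    rw [herm, ← hc, h] at this
    simp at this
  have hcs : P.pairing (star w) w = -c := by rw [hc, ← pairing_swap]
  have hstar : star c = -c := by rw [hc, star_pairing, star_star, hcs]
  have hww : P.pairing w w = 0 := part_isotropic hF.1 hw hw
  have hwws : P.pairing (star w) (star w) = 0 := by rw [← star_pairing, hww, star_zero]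
  set α : ℂ := 2 / c with hα
  have hαc : α * c = 2 := by rw [hα]; field_simp
  have hαs : star α = -α := by
    rw [hα, star_div₀, hstar, div_neg]
    congr 2
    exact Complex.conj_ofNat 2
  set K : Matrix ι ι ℂ := 1 + α • (Matrix.vecMulVec w (star w ᵥ* P.QC) -
    Matrix.vecMulVec (star w) (w ᵥ* P.QC)) with hK
  have hKx : ∀ x, K *ᵥ x = x + α • (P.pairing (star w) x • w - P.pairing w x • star w) := by
    intro x
    rw [hK, Matrix.add_mulVec, Matrix.smul_mulVec, Matrix.sub_mulVec, vecMulVec_vecMul_mulVec,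
      vecMulVec_vecMul_mulVec, Matrix.one_mulVec]
  have hKs : K.map star = K := by
    apply ext_mulVec
    intro x
    have h1 : K.map star *ᵥ x = star (K *ᵥ star x) := by rw [star_mulVec', star_star]
    rw [h1, hKx, hKx]
    simp only [star_add, star_smul, star_sub, star_pairing, star_star, hαs, smul_sub, neg_smul]
    abel
  obtain ⟨k, hk⟩ := exists_matC_of_map_star hKs
  have hKV : ∀ x ∈ part e F, K *ᵥ x = x - (2 * P.herm x w / P.herm w w) • w := by
    intro x hx
    rw [hKx, part_isotropic hF.1 hw hx, zero_smul, sub_zero, smul_smul, sub_eq_add_neg,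
      ← neg_smul]
    congr 2
    rw [pairing_swap, herm, herm, ← hc, hα]
    have := Complex.I_ne_zero
    field_simp
  have hKG : K ∈ P.GC := by
    rw [mem_GC]
    intro x y
    rw [hKx, hKx]
    simp only [pairing_add_left, pairing_add_right, pairing_smul_left, pairing_smul_right,
      pairing_sub_left, pairing_sub_right, hww, hwws, hcs, ← hc]
    rw [P.pairing_swap w x, P.pairing_swap (star w) x]
    linear_combination (-α * (P.pairing (star w) x * P.pairing w y -
      P.pairing (star w) y * P.pairing w x)) * hαc
  refine ⟨k, mem_maxCompact_of_actV_part (P.matC_mem_GC.1 (by rw [hk]; exact hKG)) (e := e) ?_, ?_⟩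
  · rw [hk]
    apply Submodule.eq_of_le_of_finrank_eq
    · rw [actV_le]
      intro x hx
      rw [hKV x hx]
      exact Submodule.sub_mem _ hx (Submodule.smul_mem _ _ hw)
    · exact P.finrank_actV hKG _
  · rw [hk]; exact hKV

/-- Two vectors of the same length whose hermitian product is real are exchanged by the reflection
in their difference, up to sign. -/
lemma exists_maxCompact_smul {F : Filt ι} (hF : F ∈ P.periodDomain) {e : ℤ} {x v : ι → ℂ}
    (hx : x ∈ part e F) (hv : v ∈ part e F) (hx0 : x ≠ 0) :
    ∃ k ∈ P.maxCompact F, ∃ c : ℂ, v = c • (matC k *ᵥ x) := by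
  have h1 : (1 : Matrix ι ι ℝ) ∈ P.maxCompact F :=
    ⟨by rw [← matC_mem_GC, matC_one]; exact P.GC_one, by rw [matC_one, actV_one]⟩
  by_cases hv0 : v = 0
  · exact ⟨1, h1, 0, by rw [hv0, zero_smul]⟩
  have ha := part_pos hF hx hx0
  have hb := part_pos hF hv hv0
  -- The scalar `μ` rotates `v` so that its product with `x` is real and gives it the length of `x`.
  obtain ⟨u, hu1, hu2⟩ : ∃ u : ℂ, star u * u = 1 ∧ star (star u * P.herm x v) =
      star u * P.herm x v := by
    by_cases h0 : P.herm x v = 0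
    · exact ⟨1, by simp, by simp [h0]⟩
    · have hn : ((‖P.herm x v‖ : ℝ) : ℂ) ≠ 0 := by simpa using h0
      have hnn : star (P.herm x v) * P.herm x v = (‖P.herm x v‖ : ℂ) * (‖P.herm x v‖ : ℂ) := by
        have := Complex.conj_mul' (P.herm x v)
        rw [← pow_two]; exact this
      have hs : star ((‖P.herm x v‖ : ℝ) : ℂ) = ((‖P.herm x v‖ : ℝ) : ℂ) := Complex.conj_ofReal _
      refine ⟨P.herm x v / ‖P.herm x v‖, ?_, ?_⟩
      · rw [star_div₀, hs]
        field_simp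
        rw [pow_two]; exact hnn
      · rw [star_mul, star_star, star_div₀, hs]
        ring
  set t : ℝ := Real.sqrt ((sgn e * (P.herm x x).re) / (sgn e * (P.herm v v).re)) with ht
  have ht0 : 0 < t := Real.sqrt_pos.2 (div_pos ha hb)
  have htt : t * t * (P.herm v v).re = (P.herm x x).re := by
    have h2 : t * t * (sgn e * (P.herm v v).re) = sgn e * (P.herm x x).re := by
      rw [ht, Real.mul_self_sqrt (div_pos ha hb).le, div_mul_cancel₀ _ hb.ne']
    have hs := sgn_mul_self e
    linear_combination sgn e * h2 - (t * t * (P.herm v v).re - (P.herm x x).re) * hs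
  have hts : star (t : ℂ) = (t : ℂ) := Complex.conj_ofReal _
  have hu0 : u ≠ 0 := by rintro rfl; simp at hu1
  set μ : ℂ := (t : ℂ) * u with hμ
  have hμ0 : μ ≠ 0 := mul_ne_zero (by exact_mod_cast ht0.ne') hu0
  have hlen : P.herm (μ • v) (μ • v) = P.herm x x := by
    rw [herm_smul_left, herm_smul_right, ← P.herm_self x, ← P.herm_self v, ← htt, hμ, star_mul, hts]
    push_cast
    linear_combination (t : ℂ) * t * ((P.herm v v).re : ℂ) * hu1
  have hreal : P.herm (μ • v) x = P.herm x (μ • v) := by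
    have hxr : P.herm x (μ • v) = (t : ℂ) * (star u * P.herm x v) := by
      rw [herm_smul_right, hμ, star_mul, hts]; ring
    rw [← star_herm, hxr, star_mul, hu2, hts, mul_comm]
  have hvμ : v = μ⁻¹ • (μ • v) := by rw [smul_smul, inv_mul_cancel₀ hμ0, one_smul]
  by_cases hw0 : x - μ • v = 0
  · refine ⟨1, h1, μ⁻¹, ?_⟩
    rw [matC_one, Matrix.one_mulVec, sub_eq_zero.1 hw0]
    exact hvμ
  · have hw : x - μ • v ∈ part e F := Submodule.sub_mem _ hx (Submodule.smul_mem _ _ hv)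
    obtain ⟨k, hk, hkx⟩ := exists_reflection hF hw hw0
    refine ⟨k, hk, μ⁻¹, ?_⟩
    have hww : P.herm (x - μ • v) (x - μ • v) ≠ 0 := by
      intro h
      have := part_pos hF hw hw0
      rw [h] at this
      simp at this
    have h2 : 2 * P.herm x (x - μ • v) = P.herm (x - μ • v) (x - μ • v) := by
      simp only [herm_sub_left, herm_sub_right, hlen, hreal]
      ring
    rw [hkx x hx, h2, div_self hww, one_smul, sub_sub_cancel]
    exact hvμ

/-! ### The cycle determines its parity subspaces -/

lemma le_orth_iff {V W : Submodule ℂ (ι → ℂ)} :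
    V ≤ P.orth W ↔ ∀ x ∈ W, ∀ y ∈ V, P.pairing x y = 0 := by
  constructor
  · intro h x hx y hy; exact P.mem_orth.1 (h hy) x hx
  · intro h y hy; exact P.mem_orth.2 fun x hx => h x hx y hy

lemma orth_eq_self {V : Submodule ℂ (ι → ℂ)} (h : V ∈ P.lagrangians) : P.orth V = V := by
  symm
  apply Submodule.eq_of_le_of_finrank_eq (le_orth_iff.2 h.2)
  have := P.finrank_orth V
  have := h.1
  omega

lemma part_mem_lagrangians {F : Filt ι} (hF : F ∈ P.periodDomain) (e : ℤ) :
    part e F ∈ P.lagrangians :=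
  ⟨finrank_part hF e, fun _ hx _ hy => part_isotropic hF.1 hx hy⟩

lemma actV_mem_lagrangians {V : Submodule ℂ (ι → ℂ)} (hV : V ∈ P.lagrangians)
    {g : Matrix ι ι ℂ} (hg : g ∈ P.GC) : actV g V ∈ P.lagrangians := by
  refine ⟨by rw [P.finrank_actV hg, hV.1], fun x hx y hy => ?_⟩
  obtain ⟨x', hx', rfl⟩ := mem_actV.1 hx
  obtain ⟨y', hy', rfl⟩ := mem_actV.1 hy
  rw [P.mem_GC.1 hg, hV.2 _ hx' _ hy']

lemma actV_isCompl {V W : Submodule ℂ (ι → ℂ)} (h : IsCompl V W) {g : Matrix ι ι ℂ}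
    (hg : g ∈ P.GC) : IsCompl (actV g V) (actV g W) := by
  constructor
  · rw [Submodule.disjoint_def]
    intro x hx hy
    obtain ⟨x', hx', rfl⟩ := mem_actV.1 hx
    have hy' := (P.mulVec_mem_actV_iff hg).1 hy
    rw [Submodule.disjoint_def.1 h.disjoint x' hx' hy', Matrix.mulVec_zero]
  · rw [codisjoint_iff, ← actV_sup, h.sup_eq_top]
    apply Submodule.eq_top_of_finrank_eq
    rw [P.finrank_actV hg, finrank_top]

/-- The involution attached to a pair of complementary Lagrangian subspaces. -/
lemma exists_involution {V W : Submodule ℂ (ι → ℂ)} (hV : V ∈ P.lagrangians)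
    (hW : W ∈ P.lagrangians) (h : IsCompl V W) :
    ∃ J ∈ P.spC, (∀ x ∈ V, J *ᵥ x = x) ∧ ∀ x ∈ W, J *ᵥ x = -x := by
  have h1 : ∀ x ∈ V, LinearMap.toMatrix' (V.projection W h - W.projection V h.symm) *ᵥ x = x := by
    intro x hx
    rw [LinearMap.toMatrix'_mulVec, LinearMap.sub_apply,
      Submodule.projection_apply_of_mem_left h hx,
      Submodule.projection_apply_of_mem_right h.symm hx, sub_zero]
  have h2 : ∀ x ∈ W, LinearMap.toMatrix' (V.projection W h - W.projection V h.symm) *ᵥ x = -x := by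
    intro x hx
    rw [LinearMap.toMatrix'_mulVec, LinearMap.sub_apply,
      Submodule.projection_apply_of_mem_right h hx,
      Submodule.projection_apply_of_mem_left h.symm hx, zero_sub]
  refine ⟨_, ?_, h1, h2⟩
  rw [mem_spC]
  intro x y
  have hx : x ∈ V ⊔ W := by rw [h.sup_eq_top]; trivial
  have hy : y ∈ V ⊔ W := by rw [h.sup_eq_top]; trivial
  obtain ⟨a, ha, b, hb, rfl⟩ := Submodule.mem_sup.1 hx
  obtain ⟨c, hc, d, hd, rfl⟩ := Submodule.mem_sup.1 hy
  simp only [Matrix.mulVec_add, h1 a ha, h2 b hb, h1 c hc, h2 d hd, pairing_add_left,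
    pairing_add_right, pairing_neg_left, pairing_neg_right, hV.2 a ha c hc, hW.2 b hb d hd]
  ring

lemma GradedBy.mulVec_sub_mem {e : ℤ} {F : Filt ι} {V W : Submodule ℂ (ι → ℂ)}
    (h : GradedBy e F V W) (hF : F ∈ P.compactDual) {J : Matrix ι ι ℂ}
    (h1 : ∀ x ∈ V, J *ᵥ x = x) (h2 : ∀ x ∈ W, J *ᵥ x = -x) {p : ℤ} {x : ι → ℂ} (hx : x ∈ F p) :
    J *ᵥ x - (if Even (p + e) then (1 : ℂ) else -1) • x ∈ F (p + 1) := by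
  have hst : ∀ y ∈ F (p + 1), J *ᵥ y ∈ F (p + 1) := by
    intro y hy
    obtain ⟨a, ha, b, hb, rfl⟩ := Submodule.mem_sup.1 (h.le_sup hF _ hy)
    rw [Matrix.mulVec_add, h1 a ha.2, h2 b hb.2]
    exact (F (p + 1)).add_mem ha.1 ((F (p + 1)).neg_mem hb.1)
  by_cases hp : Even (p + e)
  · obtain ⟨y, hy, v, hv, rfl⟩ := Submodule.mem_sup.1 ((h p).1 hp hx)
    rw [if_pos hp, one_smul, Matrix.mulVec_add, h1 v hv.2, add_sub_add_right_eq_sub]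
    exact (F (p + 1)).sub_mem (hst y hy) hy
  · obtain ⟨y, hy, v, hv, rfl⟩ := Submodule.mem_sup.1 ((h p).2 ((even_or p e).resolve_left hp) hx)
    rw [if_neg hp, Matrix.mulVec_add, h2 v hv.2]
    have : J *ᵥ y + -v - (-1 : ℂ) • (y + v) = J *ᵥ y + y := by
      rw [neg_one_smul]; abel
    rw [this]
    exact (F (p + 1)).add_mem (hst y hy) hy

lemma exists_ne_zero_mem_hodge {F : Filt ι} (hF : F ∈ P.periodDomain) {p : ℤ} (hp : P.h p ≠ 0) :
    ∃ x ∈ hodge F p, x ≠ 0 := by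
  by_contra hcon
  push Not at hcon
  have h1 : hodge F p = ⊥ := (Submodule.eq_bot_iff _).2 hcon
  have h2 : F p = F (p + 1) := by
    refine le_antisymm ?_ (hF.1.1 (by omega))
    have := le_succ_sup_hodge hF p
    rwa [h1, sup_bot_eq] at this
  have h3 := hF.1.2.1 p
  rw [h2, hF.1.2.1 (p + 1)] at h3
  have h4 : (P.h.support.filter fun r => p ≤ r) =
      insert p (P.h.support.filter fun r => p + 1 ≤ r) := by
    ext r
    simp only [Finset.mem_filter, Finsupp.mem_support_iff, Finset.mem_insert]
    constructor
    · rintro ⟨a, b⟩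
      rcases eq_or_lt_of_le b with h | h
      · exact Or.inl h.symm
      · exact Or.inr ⟨a, h⟩
    · rintro (rfl | ⟨a, b⟩)
      · exact ⟨hp, le_rfl⟩
      · exact ⟨a, by omega⟩
  rw [h4, Finset.sum_insert (by simp)] at h3
  omega

/-- If `H^{p,-p-1} ≠ 0` for some `p ≥ 0` with `p ≡ e`, the cycle determines its subspace of
parity `e`. The difference `B` of the involutions of two pairs of subspaces raises every filtration
of the cycle, so that `⟨Bx, x⟩ = 0` on the translates of `H^{p,-p-1}`, which cover a whole
Lagrangian subspace; hence `B` preserves that subspace, and it is nilpotent. -/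
lemma actV_part_le {F F' : Filt ι} (hF : F ∈ P.periodDomain) (hF' : F' ∈ P.periodDomain)
    {g g' : Matrix ι ι ℂ} (hg : g ∈ P.GC) (hg' : g' ∈ P.GC)
    (hC : actS g (P.cycle F) = actS g' (P.cycle F')) {e p : ℤ} (hp0 : 0 ≤ p) (hp : Even (p + e))
    (hhp : P.h p ≠ 0) : actV g' (part e F') ≤ actV g (part e F) := by
  have hcompl := actV_isCompl (part_isCompl hF e) hg
  obtain ⟨J₁, hJ₁, hJ₁V, hJ₁W⟩ := exists_involution
    (actV_mem_lagrangians (part_mem_lagrangians hF e) hg)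
    (actV_mem_lagrangians (part_mem_lagrangians hF (e + 1)) hg) hcompl
  have hL' := actV_mem_lagrangians (part_mem_lagrangians hF' e) hg'
  obtain ⟨J₂, hJ₂, hJ₂V, hJ₂W⟩ := exists_involution hL'
    (actV_mem_lagrangians (part_mem_lagrangians hF' (e + 1)) hg')
    (actV_isCompl (part_isCompl hF' e) hg')
  set B := J₁ - J₂ with hB
  have hBsp : ∀ x y, P.pairing (B *ᵥ x) y = -P.pairing x (B *ᵥ y) := by
    intro x y
    rw [hB, Matrix.sub_mulVec, Matrix.sub_mulVec, pairing_sub_left, pairing_sub_right,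
      P.mem_spC.1 hJ₁, P.mem_spC.1 hJ₂]
    ring
  have hraise : ∀ k ∈ P.maxCompact F', ∀ p, ∀ x ∈ actF g' (actF (matC k) F') p,
      B *ᵥ x ∈ actF g' (actF (matC k) F') (p + 1) := by
    intro k hk p x hx
    have hmem : actF g' (actF (matC k) F') ∈ actS g (P.cycle F) := by
      rw [hC]; exact ⟨_, ⟨k, hk, rfl⟩, rfl⟩
    obtain ⟨_, ⟨l, hl, rfl⟩, hl2⟩ := hmem
    have hdual : actF g' (actF (matC k) F') ∈ P.compactDual :=
      actF_mem_compactDual (actF_mem_compactDual hF'.1 (P.matC_mem_GC.2 hk.1)) hg'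
    have h1 := ((gradedBy_part hF e).act (matC l)).act g
    rw [actV_part_of_mem_maxCompact hl, actV_part_of_mem_maxCompact hl, hl2] at h1
    have h2 := ((gradedBy_part hF' e).act (matC k)).act g'
    rw [actV_part_of_mem_maxCompact hk, actV_part_of_mem_maxCompact hk] at h2
    have := Submodule.sub_mem _ (h1.mulVec_sub_mem hdual hJ₁V hJ₁W hx)
      (h2.mulVec_sub_mem hdual hJ₂V hJ₂W hx)
    rwa [sub_sub_sub_cancel_right, ← Matrix.sub_mulVec] at this
  obtain ⟨x, hx, hx0⟩ := exists_ne_zero_mem_hodge hF' hhp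
  have hq : ∀ v ∈ actV g' (part e F'), P.pairing (B *ᵥ v) v = 0 := by
    intro v hv
    obtain ⟨v', hv', rfl⟩ := mem_actV.1 hv
    obtain ⟨k, hk, c, rfl⟩ := exists_maxCompact_smul hF' (hodge_le_part hp hx) hv' hx0
    have hdual : actF g' (actF (matC k) F') ∈ P.compactDual :=
      actF_mem_compactDual (actF_mem_compactDual hF'.1 (P.matC_mem_GC.2 hk.1)) hg'
    have hm : g' *ᵥ (matC k *ᵥ x) ∈ actF g' (actF (matC k) F') p :=
      mulVec_mem_actV (mulVec_mem_actV hx.1)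
    rw [Matrix.mulVec_smul, Matrix.mulVec_smul, pairing_smul_left, pairing_smul_right,
      pairing_eq_zero hdual (by omega) (hraise k hk p _ hm) hm, mul_zero, mul_zero]
  have hBV : ∀ v ∈ actV g' (part e F'), B *ᵥ v ∈ actV g' (part e F') := by
    intro v hv
    rw [← orth_eq_self hL', mem_orth]
    intro u hu
    have h := hq (u + v) (Submodule.add_mem _ hu hv)
    rw [Matrix.mulVec_add, pairing_add_left, pairing_add_right, pairing_add_right, hq u hu,
      hq v hv, hBsp u v, P.pairing_swap u (B *ᵥ v)] at h
    linear_combination (-1 / 2 : ℂ) * h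
  intro u hu
  have hsq : ∀ x, J₁ *ᵥ (J₁ *ᵥ x) = x := by
    intro x
    have : x ∈ actV g (part e F) ⊔ actV g (part (e + 1) F) := by rw [hcompl.sup_eq_top]; trivial
    obtain ⟨a, ha, b, hb, rfl⟩ := Submodule.mem_sup.1 this
    rw [Matrix.mulVec_add, hJ₁V a ha, hJ₁W b hb, Matrix.mulVec_add, Matrix.mulVec_neg, hJ₁V a ha,
      hJ₁W b hb, neg_neg]
  have hJB : ∀ v ∈ actV g' (part e F'), J₁ *ᵥ v = v + B *ᵥ v := by
    intro v hv
    rw [hB, Matrix.sub_mulVec, hJ₂V v hv]; abel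
  have hBB : B *ᵥ (B *ᵥ u) = (-2 : ℂ) • (B *ᵥ u) := by
    have h1 := hsq u
    rw [hJB u hu, Matrix.mulVec_add, hJB u hu, hJB _ (hBV u hu)] at h1
    have h2 : u + B *ᵥ u + (B *ᵥ u + B *ᵥ B *ᵥ u) - u = 0 := by rw [h1, sub_self]
    rw [eq_comm, ← sub_eq_zero, ← neg_eq_zero, ← h2, neg_smul, two_smul]
    abel
  have hpow : ∀ n : ℕ, ∃ y, y = (-2 : ℂ) ^ n • (B *ᵥ u) ∧ ∀ a,
      u ∈ actF g' F' a → y ∈ actF g' F' (a + n + 1) := by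
    have hone : (1 : Matrix ι ι ℝ) ∈ P.maxCompact F' :=
      ⟨by rw [← matC_mem_GC, matC_one]; exact P.GC_one, by rw [matC_one, actV_one]⟩
    have hr := hraise 1 hone
    rw [matC_one, actF_one] at hr
    intro n
    induction n with
    | zero => exact ⟨B *ᵥ u, by simp, fun a ha => by simpa using hr a u ha⟩
    | succ n ih =>
      obtain ⟨y, hy, hya⟩ := ih
      refine ⟨B *ᵥ y, ?_, fun a ha => ?_⟩
      · rw [hy, Matrix.mulVec_smul, hBB, smul_smul, pow_succ]
      · have := hr _ y (hya a ha)
        have h2 : a + (n + 1 : ℕ) + 1 = a + n + 1 + 1 := by push_cast; ring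
        rwa [h2]
  have hBu : B *ᵥ u = 0 := by
    have hd := actF_mem_compactDual hF'.1 hg'
    obtain ⟨a, ha⟩ := exists_top hd
    obtain ⟨b, hb⟩ := exists_bot hd
    obtain ⟨y, hy, hya⟩ := hpow (b - a).toNat
    have h1 := hya a (by rw [ha a le_rfl]; trivial)
    rw [hb _ (by have := Int.self_le_toNat (b - a); omega), Submodule.mem_bot] at h1
    rw [h1] at hy
    exact (smul_eq_zero.1 hy.symm).resolve_left (pow_ne_zero _ (by norm_num))
  have hJu : J₁ *ᵥ u = u := by rw [hJB u hu, hBu, add_zero]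
  have : u ∈ actV g (part e F) ⊔ actV g (part (e + 1) F) := by rw [hcompl.sup_eq_top]; trivial
  obtain ⟨a, ha, b, hb, rfl⟩ := Submodule.mem_sup.1 this
  rw [Matrix.mulVec_add, hJ₁V a ha, hJ₁W b hb, add_right_inj] at hJu
  have hb0 : b = 0 := by
    have := neg_eq_iff_add_eq_zero.1 hJu
    rw [← two_smul ℂ b] at this
    exact (smul_eq_zero.1 this).resolve_left two_ne_zero
  rw [hb0, add_zero]
  exact ha

lemma actV_part_eq {F F' : Filt ι} (hF : F ∈ P.periodDomain) (hF' : F' ∈ P.periodDomain)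
    {g g' : Matrix ι ι ℂ} (hg : g ∈ P.GC) (hg' : g' ∈ P.GC)
    (hC : actS g (P.cycle F) = actS g' (P.cycle F')) {e p : ℤ} (hp0 : 0 ≤ p) (hp : Even (p + e))
    (hhp : P.h p ≠ 0) : actV g (part e F) = actV g' (part e F') :=
  le_antisymm (actV_part_le hF' hF hg' hg hC.symm hp0 hp hhp)
    (actV_part_le hF hF' hg hg' hC hp0 hp hhp)

variable (P) in
/-- The graph of the projection of the cycle space to the factor of parity `e`: `p^ev` for even
`e` and `p^od` for odd `e`. -/
def ParityProj (e : ℤ) (C : Set (Filt ι)) (V : Submodule ℂ (ι → ℂ)) : Prop :=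
  ∃ g ∈ P.GC, ∃ F ∈ P.periodDomain, C = actS g (P.cycle F) ∧
    (((∃ p : ℤ, 0 ≤ p ∧ Even (p + e) ∧ P.h p ≠ 0) ∧ V = actV g (part e F)) ∨
      ((¬ ∃ p : ℤ, 0 ≤ p ∧ Even (p + e) ∧ P.h p ≠ 0) ∧ V = conjSub (actV g (part (e + 1) F))))

lemma evenProj_iff {C : Set (Filt ι)} {V : Submodule ℂ (ι → ℂ)} :
    P.EvenProj C V ↔ P.ParityProj 0 C V := by
  simp only [EvenProj, ParityProj, evenPart_eq, oddPart_eq, add_zero, zero_add]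

lemma oddProj_iff {C : Set (Filt ι)} {V : Submodule ℂ (ι → ℂ)} :
    P.OddProj C V ↔ P.ParityProj 1 C V := by
  simp only [OddProj, ParityProj, evenPart_eq, oddPart_eq, Int.even_add_one,
    Int.not_even_iff_odd]
  have : ∀ F : Filt ι, part (1 + 1) F = part 0 F := fun F => by
    rw [← part_add_two 0 F, zero_add]
  simp only [this]

/-- `ParityProj` is single valued: if the first clause does not apply, then the opposite parity
occurs in degrees `p ≥ 0`, unless `H = 0`. -/
lemma ParityProj.eq_of_eq {e : ℤ} {F F' : Filt ι} (hF : F ∈ P.periodDomain)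
    (hF' : F' ∈ P.periodDomain) {g g' : Matrix ι ι ℂ} (hg : g ∈ P.GC) (hg' : g' ∈ P.GC)
    (hC : actS g (P.cycle F) = actS g' (P.cycle F'))
    (hno : ¬ ∃ p : ℤ, 0 ≤ p ∧ Even (p + e) ∧ P.h p ≠ 0) :
    actV g (part (e + 1) F) = actV g' (part (e + 1) F') := by
  by_cases h : ∃ p : ℤ, 0 ≤ p ∧ Even (p + (e + 1)) ∧ P.h p ≠ 0
  · obtain ⟨p, hp0, hp, hhp⟩ := h
    exact actV_part_eq hF hF' hg hg' hC hp0 hp hhp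
  · have hz : ∀ p, 0 ≤ p → P.h p = 0 := by
      intro p hp
      by_contra hne
      rcases even_or p e with h1 | h1
      · exact hno ⟨p, hp, h1, hne⟩
      · exact h ⟨p, hp, h1, hne⟩
    have hz' : ∀ p, P.h p = 0 := by
      intro p
      rcases le_or_gt 0 p with hp | hp
      · exact hz p hp
      · rw [← P.h_symm]; exact hz _ (by omega)
    have hcard : Fintype.card ι = 0 := by
      rw [← P.h_total]; exact Finset.sum_eq_zero fun p _ => hz' p
    have := Fintype.card_eq_zero_iff.1 hcard
    exact Subsingleton.elim _ _

lemma parityProj_iff_of_exists {e : ℤ} {F : Filt ι} (hF : F ∈ P.periodDomain)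
    {g : Matrix ι ι ℂ} (hg : g ∈ P.GC)
    (h : ∃ p : ℤ, 0 ≤ p ∧ Even (p + e) ∧ P.h p ≠ 0) {V : Submodule ℂ (ι → ℂ)} :
    P.ParityProj e (actS g (P.cycle F)) V ↔ V = actV g (part e F) := by
  constructor
  · rintro ⟨g', hg', F', hF', hC, ⟨-, rfl⟩ | ⟨hno, -⟩⟩
    · obtain ⟨p, hp0, hp, hhp⟩ := h
      exact (actV_part_eq hF hF' hg hg' hC hp0 hp hhp).symm
    · exact absurd h hno
  · rintro rfl
    exact ⟨g, hg, F, hF, rfl, Or.inl ⟨h, rfl⟩⟩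

lemma parityProj_iff_of_not_exists {e : ℤ} {F : Filt ι} (hF : F ∈ P.periodDomain)
    {g : Matrix ι ι ℂ} (hg : g ∈ P.GC)
    (h : ¬ ∃ p : ℤ, 0 ≤ p ∧ Even (p + e) ∧ P.h p ≠ 0) {V : Submodule ℂ (ι → ℂ)} :
    P.ParityProj e (actS g (P.cycle F)) V ↔ V = conjSub (actV g (part (e + 1) F)) := by
  constructor
  · rintro ⟨g', hg', F', hF', hC, ⟨h', -⟩ | ⟨-, rfl⟩⟩
    · exact absurd h' h
    · rw [ParityProj.eq_of_eq hF hF' hg hg' hC h]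
  · rintro rfl
    exact ⟨g, hg, F, hF, rfl, Or.inr ⟨h, rfl⟩⟩

end PolData

/-! ### Complexified weight filtration and Deligne's subspaces -/

/-- The image of `N` in `H_ℂ`. -/
def rangeC (N : Matrix ι ι ℝ) : Submodule ℂ (ι → ℂ) := LinearMap.range (matC N).mulVecLin

/-- The kernel of `N` in `H_ℂ`. -/
def kerC (N : Matrix ι ι ℝ) : Submodule ℂ (ι → ℂ) := LinearMap.ker (matC N).mulVecLin

lemma mem_rangeC {N : Matrix ι ι ℝ} {x : ι → ℂ} : x ∈ rangeC N ↔ ∃ y, matC N *ᵥ y = x := by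
  simp [rangeC]

lemma mem_kerC {N : Matrix ι ι ℝ} {x : ι → ℂ} : x ∈ kerC N ↔ matC N *ᵥ x = 0 := by
  simp [kerC]

lemma mulVec_mem_rangeC (N : Matrix ι ι ℝ) (x : ι → ℂ) : matC N *ᵥ x ∈ rangeC N :=
  mem_rangeC.2 ⟨x, rfl⟩

lemma star_mem_rangeC {N : Matrix ι ι ℝ} {x : ι → ℂ} (hx : x ∈ rangeC N) :
    star x ∈ rangeC N := by
  obtain ⟨y, rfl⟩ := mem_rangeC.1 hx
  rw [star_matC_mulVec]; exact mulVec_mem_rangeC _ _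

lemma star_mem_kerC {N : Matrix ι ι ℝ} {x : ι → ℂ} (hx : x ∈ kerC N) : star x ∈ kerC N := by
  rw [mem_kerC] at *
  rw [← star_matC_mulVec, hx, star_zero]

lemma conjSub_rangeC (N : Matrix ι ι ℝ) : conjSub (rangeC N) = rangeC N := by
  ext x
  rw [mem_conjSub]
  exact ⟨fun h => by simpa using star_mem_rangeC h, star_mem_rangeC⟩

lemma conjSub_kerC (N : Matrix ι ι ℝ) : conjSub (kerC N) = kerC N := by
  ext x
  rw [mem_conjSub]
  exact ⟨fun h => by simpa using star_mem_kerC h, star_mem_kerC⟩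

lemma finrank_rangeC_add_finrank_kerC (N : Matrix ι ι ℝ) :
    Module.finrank ℂ (rangeC N) + Module.finrank ℂ (kerC N) = Fintype.card ι := by
  rw [rangeC, kerC, LinearMap.finrank_range_add_finrank_ker, Module.finrank_fintype_fun_eq_card]

lemma exists_vecC_add (x : ι → ℂ) : ∃ a b : ι → ℝ, x = vecC a + Complex.I • vecC b := by
  refine ⟨fun i => (x i).re, fun i => (x i).im, ?_⟩
  ext i
  simp only [vecC, Pi.add_apply, Pi.smul_apply, smul_eq_mul]
  rw [mul_comm]; exact (Complex.re_add_im (x i)).symm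

lemma vecC_add_inj {a b c d : ι → ℝ}
    (h : vecC a + Complex.I • vecC b = vecC c + Complex.I • vecC d) : a = c ∧ b = d := by
  constructor <;> ext i
  · simpa [vecC] using congrArg Complex.re (congrFun h i)
  · simpa [vecC] using congrArg Complex.im (congrFun h i)

lemma vecC_zero : vecC (0 : ι → ℝ) = 0 := by ext i; simp [vecC]

lemma vecC_mem_complexify {U : Submodule ℝ (ι → ℝ)} {x : ι → ℝ} (hx : x ∈ U) :
    vecC x ∈ complexify U := Submodule.subset_span ⟨x, hx, rfl⟩

lemma complexify_top : complexify (⊤ : Submodule ℝ (ι → ℝ)) = ⊤ := by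
  rw [eq_top_iff]
  intro x _
  obtain ⟨a, b, rfl⟩ := exists_vecC_add x
  exact Submodule.add_mem _ (vecC_mem_complexify trivial)
    (Submodule.smul_mem _ _ (vecC_mem_complexify trivial))

lemma complexify_bot : complexify (⊥ : Submodule ℝ (ι → ℝ)) = ⊥ := by
  simp [complexify, vecC_zero]

lemma complexify_range (N : Matrix ι ι ℝ) :
    complexify (LinearMap.range N.mulVecLin) = rangeC N := by
  apply le_antisymm
  · refine Submodule.span_le.2 ?_
    rintro _ ⟨_, ⟨y, rfl⟩, rfl⟩
    exact mem_rangeC.2 ⟨vecC y, matC_mulVec_vecC N y⟩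
  · intro x hx
    obtain ⟨y, rfl⟩ := mem_rangeC.1 hx
    obtain ⟨a, b, rfl⟩ := exists_vecC_add y
    rw [Matrix.mulVec_add, Matrix.mulVec_smul, matC_mulVec_vecC, matC_mulVec_vecC]
    exact Submodule.add_mem _ (vecC_mem_complexify ⟨a, rfl⟩)
      (Submodule.smul_mem _ _ (vecC_mem_complexify ⟨b, rfl⟩))

lemma complexify_ker (N : Matrix ι ι ℝ) :
    complexify (LinearMap.ker N.mulVecLin) = kerC N := by
  apply le_antisymm
  · refine Submodule.span_le.2 ?_
    rintro _ ⟨y, hy, rfl⟩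
    have hy : N *ᵥ y = 0 := hy
    exact mem_kerC.2 (by rw [matC_mulVec_vecC, hy, vecC_zero])
  · intro x hx
    rw [mem_kerC] at hx
    obtain ⟨a, b, rfl⟩ := exists_vecC_add x
    rw [Matrix.mulVec_add, Matrix.mulVec_smul, matC_mulVec_vecC, matC_mulVec_vecC] at hx
    have h := vecC_add_inj (c := 0) (d := 0) (by rw [hx, vecC_zero]; simp)
    exact Submodule.add_mem _ (vecC_mem_complexify h.1)
      (Submodule.smul_mem _ _ (vecC_mem_complexify h.2))

lemma vecC_mem_rangeC {N : Matrix ι ι ℝ} {x : ι → ℝ} :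
    vecC x ∈ rangeC N ↔ x ∈ LinearMap.range N.mulVecLin := by
  constructor
  · intro h
    obtain ⟨y, hy⟩ := mem_rangeC.1 h
    obtain ⟨a, b, rfl⟩ := exists_vecC_add y
    rw [Matrix.mulVec_add, Matrix.mulVec_smul, matC_mulVec_vecC, matC_mulVec_vecC] at hy
    have h := vecC_add_inj (c := x) (d := 0) (by rw [hy, vecC_zero]; simp)
    exact ⟨a, h.1⟩
  · rintro ⟨y, rfl⟩
    exact mem_rangeC.2 ⟨vecC y, matC_mulVec_vecC N y⟩

lemma complexify_weight_nonneg (N : Matrix ι ι ℝ) {k : ℤ} (hk : 0 ≤ k) :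
    complexify (weight N k) = ⊤ := by
  rw [weight, if_pos hk, complexify_top]

lemma complexify_weight_neg_one (N : Matrix ι ι ℝ) {k : ℤ} (hk : k = -1) :
    complexify (weight N k) = kerC N := by
  subst hk
  rw [weight, if_neg (by norm_num), if_pos rfl, complexify_ker]

lemma complexify_weight_neg_two (N : Matrix ι ι ℝ) {k : ℤ} (hk : k = -2) :
    complexify (weight N k) = rangeC N := by
  subst hk
  rw [weight, if_neg (by norm_num), if_neg (by norm_num), if_pos rfl, complexify_range]

lemma complexify_weight_le (N : Matrix ι ι ℝ) {k : ℤ} (hk : k ≤ -3) :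
    complexify (weight N k) = ⊥ := by
  rw [weight, if_neg (by omega), if_neg (by omega), if_neg (by omega), complexify_bot]

lemma deligne_of_le (N : Matrix ι ι ℝ) (F : Filt ι) {p q : ℤ} (h : p + q ≤ -3) :
    deligne N F p q = ⊥ := by
  rw [deligne, complexify_weight_le N h]; simp

lemma deligne_neg_two (N : Matrix ι ι ℝ) (F : Filt ι) {p q : ℤ} (h : p + q = -2) :
    deligne N F p q = F p ⊓ conjSub (F q) ⊓ rangeC N := by
  have h1 : (⨆ j : ℤ, ⨆ _ : 2 ≤ j, conjSub (F (q - j + 1)) ⊓ complexify (weight N (p + q - j))) =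
      ⊥ := by
    refine le_bot_iff.1 (iSup₂_le fun j hj => ?_)
    rw [complexify_weight_le N (by omega), inf_bot_eq]
  rw [deligne, complexify_weight_neg_two N h, h1, sup_bot_eq, inf_inf_inf_comm, inf_idem]

lemma deligne_neg_one (N : Matrix ι ι ℝ) (F : Filt ι) {p q : ℤ} (h : p + q = -1) :
    deligne N F p q = hodge F p ⊓ kerC N := by
  have h1 : (⨆ j : ℤ, ⨆ _ : 2 ≤ j, conjSub (F (q - j + 1)) ⊓ complexify (weight N (p + q - j))) =
      ⊥ := by
    refine le_bot_iff.1 (iSup₂_le fun j hj => ?_)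
    rw [complexify_weight_le N (by omega), inf_bot_eq]
  have hq : q = -1 - p := by omega
  rw [deligne, complexify_weight_neg_one N h, h1, sup_bot_eq, inf_inf_inf_comm, inf_idem, hq]
  rfl

/-- The subspaces `I^{p,-p}`, which split off `Gr_0^W`. -/
def delZero (N : Matrix ι ι ℝ) (F : Filt ι) (p : ℤ) : Submodule ℂ (ι → ℂ) := deligne N F p (-p)

lemma mem_delZero {N : Matrix ι ι ℝ} {F : Filt ι} {p : ℤ} {x : ι → ℂ} :
    x ∈ delZero N F p ↔ x ∈ F p ∧
      ∃ a ∈ F (-p), ∃ u ∈ F (-p - 1), u ∈ rangeC N ∧ x = star a + star u := by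
  have h1 : (⨆ j : ℤ, ⨆ _ : 2 ≤ j,
      conjSub (F (-p - j + 1)) ⊓ complexify (weight N (p + -p - j))) =
      conjSub (F (-p - 1)) ⊓ rangeC N := by
    apply le_antisymm
    · refine iSup₂_le fun j hj => ?_
      rcases eq_or_lt_of_le hj with h | h
      · subst h
        rw [complexify_weight_neg_two N (by omega)]
        have : -p - 2 + 1 = -p - 1 := by ring
        rw [this]
      · rw [complexify_weight_le N (by omega), inf_bot_eq]; exact bot_le
    · refine le_iSup₂_of_le 2 le_rfl ?_
      rw [complexify_weight_neg_two N (by omega)]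
      have : -p - 2 + 1 = -p - 1 := by ring
      rw [this]
  rw [delZero, deligne, h1, complexify_weight_nonneg N (by omega), inf_top_eq, inf_top_eq,
    Submodule.mem_inf, Submodule.mem_sup]
  refine and_congr_right fun _ => ⟨?_, ?_⟩
  · rintro ⟨a, ha, u, hu, rfl⟩
    exact ⟨star a, ha, star u, hu.1, star_mem_rangeC hu.2, by simp⟩
  · rintro ⟨a, ha, u, hu, hu', rfl⟩
    exact ⟨star a, by simpa [mem_conjSub] using ha, star u,
      ⟨by simpa [mem_conjSub] using hu, star_mem_rangeC hu'⟩, rfl⟩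

lemma exists_of_mem_deligne_pos {N : Matrix ι ι ℝ} {F : Filt ι} (hF : Antitone F) {p q : ℤ}
    (h : 1 ≤ p + q) {x : ι → ℂ} (hx : x ∈ deligne N F p q) :
    x ∈ F p ∧ ∃ a ∈ F (1 - p), ∃ b ∈ F (-p), b ∈ kerC N ∧ ∃ u ∈ F (-p - 1), u ∈ rangeC N ∧
      x = star a + star b + star u := by
  have h1 : (⨆ j : ℤ, ⨆ _ : 2 ≤ j, conjSub (F (q - j + 1)) ⊓ complexify (weight N (p + q - j))) ≤
      conjSub (F (1 - p)) ⊔ (conjSub (F (-p)) ⊓ kerC N) ⊔ (conjSub (F (-p - 1)) ⊓ rangeC N) := by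
    refine iSup₂_le fun j hj => ?_
    rcases le_or_gt 0 (p + q - j) with hk | hk
    · exact inf_le_left.trans ((conjSub_mono (hF (by omega))).trans
        (le_sup_left.trans le_sup_left))
    · rcases eq_or_lt_of_le (show p + q - j ≤ -1 by omega) with hk | hk
      · rw [complexify_weight_neg_one N hk]
        have : q - j + 1 = -p := by omega
        rw [this]
        exact le_sup_right.trans le_sup_left
      · rcases eq_or_lt_of_le (show p + q - j ≤ -2 by omega) with hk | hk
        · rw [complexify_weight_neg_two N hk]
          have : q - j + 1 = -p - 1 := by omega
          rw [this]
          exact le_sup_right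
        · rw [complexify_weight_le N (by omega), inf_bot_eq]; exact bot_le
  rw [deligne, complexify_weight_nonneg N (by omega), inf_top_eq, inf_top_eq] at hx
  refine ⟨hx.1, ?_⟩
  have h2 := sup_le (((conjSub_mono (hF (show 1 - p ≤ q by omega))).trans le_sup_left).trans
    le_sup_left) h1 hx.2
  obtain ⟨y, hy, u, hu, rfl⟩ := Submodule.mem_sup.1 h2
  obtain ⟨a, ha, b, hb, rfl⟩ := Submodule.mem_sup.1 hy
  exact ⟨star a, ha, star b, hb.1, star_mem_kerC hb.2, star u, hu.1, star_mem_rangeC hu.2,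
    by simp⟩

namespace PolData

variable {P : PolData ι}

lemma orth_orth (V : Submodule ℂ (ι → ℂ)) : P.orth (P.orth V) = V := by
  symm
  apply Submodule.eq_of_le_of_finrank_eq
  · intro x hx
    rw [mem_orth]
    intro y hy
    rw [pairing_swap, P.mem_orth.1 hy x hx, neg_zero]
  · have := P.finrank_orth V
    have := P.finrank_orth (P.orth V)
    omega

lemma orth_sup (V W : Submodule ℂ (ι → ℂ)) : P.orth (V ⊔ W) = P.orth V ⊓ P.orth W := by
  ext y
  rw [Submodule.mem_inf, mem_orth, mem_orth, mem_orth]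
  constructor
  · intro h
    exact ⟨fun x hx => h x (Submodule.mem_sup_left hx),
      fun x hx => h x (Submodule.mem_sup_right hx)⟩
  · rintro ⟨h1, h2⟩ x hx
    obtain ⟨a, ha, b, hb, rfl⟩ := Submodule.mem_sup.1 hx
    rw [pairing_add_left, h1 a ha, h2 b hb, add_zero]

lemma finrank_actV_add (A : Matrix ι ι ℂ) (V : Submodule ℂ (ι → ℂ)) :
    Module.finrank ℂ (actV A V) + Module.finrank ℂ (V ⊓ LinearMap.ker A.mulVecLin : Submodule _ _) =
      Module.finrank ℂ V := by
  have h := LinearMap.finrank_range_add_finrank_ker (A.mulVecLin.domRestrict V)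
  rw [LinearMap.range_domRestrict, LinearMap.ker_domRestrict] at h
  rw [← h, actV]
  congr 1
  rw [← Submodule.map_comap_subtype]
  exact Submodule.finrank_map_subtype_eq V _

end PolData

/-- The subspaces `I^{p,-p-1}`, which are the Hodge components that lie in the kernel of `N`. -/
def delOne (N : Matrix ι ι ℝ) (F : Filt ι) (p : ℤ) : Submodule ℂ (ι → ℂ) := hodge F p ⊓ kerC N

namespace PolData

/-! ### Limiting mixed Hodge structures of a square-zero `N` -/

/-- A horizontal pair `(N, F)` with `N^2 = 0` such that the Hodge components in the kernel of `N`
are polarized. This one positivity condition already makes `(W(N), F)` a mixed Hodge structure. -/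
structure LMHS (P : PolData ι) (N : Matrix ι ι ℝ) (F : Filt ι) : Prop where
  lie : N ∈ P.lieG
  sq : N * N = 0
  dual : F ∈ P.compactDual
  hor : ∀ p, ∀ x ∈ F p, matC N *ᵥ x ∈ F (p - 1)
  pos : ∀ p, ∀ x ∈ delOne N F p, x ≠ 0 → 0 < sgn p * (P.herm x x).re

variable {P : PolData ι} {N : Matrix ι ι ℝ} {F : Filt ι}

lemma pairing_matC_mulVec (hN : N ∈ P.lieG) (x y : ι → ℂ) :
    P.pairing (matC N *ᵥ x) y = -P.pairing x (matC N *ᵥ y) :=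
  P.mem_spC.1 (P.matC_mem_spC.2 hN) x y

lemma pairing_rangeC_kerC (hN : N ∈ P.lieG) {x y : ι → ℂ} (hx : x ∈ rangeC N)
    (hy : y ∈ kerC N) : P.pairing x y = 0 := by
  obtain ⟨z, rfl⟩ := mem_rangeC.1 hx
  rw [pairing_matC_mulVec hN, mem_kerC.1 hy, pairing_zero_right, neg_zero]

lemma pairing_kerC_rangeC (hN : N ∈ P.lieG) {x y : ι → ℂ} (hx : x ∈ kerC N)
    (hy : y ∈ rangeC N) : P.pairing x y = 0 := by
  rw [pairing_swap, pairing_rangeC_kerC hN hy hx, neg_zero]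

lemma orth_rangeC (hN : N ∈ P.lieG) : P.orth (rangeC N) = kerC N := by
  ext y
  rw [mem_orth]
  constructor
  · intro h
    rw [mem_kerC]
    apply P.eq_zero_of_pairing
    intro z
    rw [pairing_matC_mulVec hN, pairing_swap, h _ (mulVec_mem_rangeC N z), neg_zero, neg_zero]
  · intro h x hx
    exact pairing_rangeC_kerC hN hx h

lemma orth_kerC (hN : N ∈ P.lieG) : P.orth (kerC N) = rangeC N := by
  rw [← orth_rangeC hN, orth_orth]

namespace LMHS

variable (h : P.LMHS N F)
include h

lemma mulVec_mulVec (x : ι → ℂ) : matC N *ᵥ (matC N *ᵥ x) = 0 := by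
  rw [Matrix.mulVec_mulVec, ← matC_mul, h.sq, matC_zero, Matrix.zero_mulVec]

lemma range_le_ker : rangeC N ≤ kerC N := by
  intro x hx
  obtain ⟨y, rfl⟩ := mem_rangeC.1 hx
  rw [mem_kerC, h.mulVec_mulVec]

/-- The image of `N` is isotropic, so it contains no vector of a polarized Hodge component. -/
lemma eq_zero_of_mem_range {a b : ℤ} (hab : -1 ≤ a + b) {x : ι → ℂ} (hx : x ∈ F a)
    (hx' : star x ∈ F b) (hr : x ∈ rangeC N) : x = 0 := by
  by_contra h0
  have := h.pos a x ⟨⟨hx, h.dual.1 (by omega) hx'⟩, h.range_le_ker hr⟩ h0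
  rw [herm, pairing_rangeC_kerC h.lie hr (h.range_le_ker (star_mem_rangeC hr))] at this
  simp at this

/-- Dimension count: `(F^p ∩ Im N)^⊥ = F^{-p} + Ker N`, hence
`dim (F^p ∩ Im N) + dim N F^{-p} = dim Im N`. -/
lemma finrank_range_aux (p : ℤ) :
    Module.finrank ℂ (F p ⊓ rangeC N : Submodule _ _) +
      Module.finrank ℂ (actV (matC N) (F (-p))) = Module.finrank ℂ (rangeC N) := by
  have h1 := finrank_actV_add (matC N) (F (-p))
  have h2 := Submodule.finrank_sup_add_finrank_inf_eq (F (-p)) (kerC N)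
  have h3 := P.finrank_orth (F (-p) ⊔ kerC N)
  rw [orth_sup, orth_eq h.dual, neg_neg, orth_kerC h.lie] at h3
  have h4 := finrank_rangeC_add_finrank_kerC N
  unfold kerC at *
  omega

lemma actV_le_range (p : ℤ) : actV (matC N) (F p) ≤ F (p - 1) ⊓ rangeC N :=
  actV_le.2 fun x hx => ⟨h.hor p x hx, mulVec_mem_rangeC N x⟩

lemma range_disjoint {a b : ℤ} (hab : -1 ≤ a + b) :
    F a ⊓ rangeC N ⊓ conjSub (F b ⊓ rangeC N) = ⊥ := by
  rw [Submodule.eq_bot_iff]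
  rintro x ⟨h1, h2⟩
  exact h.eq_zero_of_mem_range hab h1.1 h2.1 h1.2

lemma finrank_range_le {a b : ℤ} (hab : -1 ≤ a + b) :
    Module.finrank ℂ (F a ⊓ rangeC N : Submodule _ _) +
      Module.finrank ℂ (F b ⊓ rangeC N : Submodule _ _) ≤ Module.finrank ℂ (rangeC N) := by
  have h1 := Submodule.finrank_sup_add_finrank_inf_eq (F a ⊓ rangeC N) (conjSub (F b ⊓ rangeC N))
  rw [h.range_disjoint hab, finrank_bot, finrank_conjSub, add_zero] at h1
  rw [← h1]
  apply Submodule.finrank_mono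
  refine sup_le inf_le_right ?_
  rw [← conjSub_rangeC N]
  exact conjSub_mono (inf_le_right.trans (conjSub_rangeC N).le)

/-- `N : Gr_0^W → Gr_{-2}^W` is strictly compatible with the Hodge filtrations. -/
lemma actV_eq (p : ℤ) : actV (matC N) (F p) = F (p - 1) ⊓ rangeC N := by
  apply Submodule.eq_of_le_of_finrank_eq (h.actV_le_range p)
  have h1 := h.finrank_range_aux (-p)
  rw [neg_neg] at h1
  have h2 := Submodule.finrank_mono (h.actV_le_range p)
  have h3 := h.finrank_range_le (a := -p) (b := p - 1) (by omega)
  omega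

lemma exists_mulVec_eq {p : ℤ} {x : ι → ℂ} (hx : x ∈ F (p - 1)) (hr : x ∈ rangeC N) :
    ∃ y ∈ F p, matC N *ᵥ y = x :=
  mem_actV.1 (by rw [h.actV_eq]; exact ⟨hx, hr⟩)

/-- `F` induces a Hodge structure of weight `-2` on the image of `N`. -/
lemma exists_range_decomp (p : ℤ) {x : ι → ℂ} (hx : x ∈ rangeC N) :
    ∃ a b, a ∈ F p ∧ a ∈ rangeC N ∧ star b ∈ F (-1 - p) ∧ b ∈ rangeC N ∧ x = a + b := by
  have h1 := Submodule.finrank_sup_add_finrank_inf_eq (F p ⊓ rangeC N)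
    (conjSub (F (-1 - p) ⊓ rangeC N))
  rw [h.range_disjoint (by omega), finrank_bot, finrank_conjSub, add_zero] at h1
  have h2 := h.finrank_range_aux p
  rw [h.actV_eq] at h2
  have h3 : -p - 1 = -1 - p := by ring
  rw [h3] at h2
  have h4 : (F p ⊓ rangeC N) ⊔ conjSub (F (-1 - p) ⊓ rangeC N) = rangeC N := by
    apply Submodule.eq_of_le_of_finrank_eq
    · refine sup_le inf_le_right ?_
      rw [← conjSub_rangeC N]
      exact conjSub_mono (inf_le_right.trans (conjSub_rangeC N).le)
    · omega
  rw [← h4] at hx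
  obtain ⟨a, ha, b, hb, rfl⟩ := Submodule.mem_sup.1 hx
  exact ⟨a, b, ha.1, ha.2, hb.1, by simpa using star_mem_rangeC hb.2, rfl⟩

/-- The induced filtrations on `Gr_{-1}^W` satisfy `F^p ∩ conj F^{-p} = 0`. -/
lemma mem_range_of_ker {p : ℤ} {x x' : ι → ℂ} (hx : x ∈ F p) (hk : x ∈ kerC N)
    (hx' : x' ∈ F (-p)) (hr : star x - x' ∈ rangeC N) : x ∈ rangeC N := by
  obtain ⟨u, v, hu, hu', hv, hv', huv⟩ := h.exists_range_decomp (-1 - p) hr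
  have hp : -1 - (-1 - p) = p := by ring
  rw [hp] at hv
  have hvr := star_mem_rangeC hv'
  have hys : star (x - star v) = x' + u := by
    rw [star_sub, star_star, ← sub_eq_zero]
    have : star x - v - (x' + u) = (star x - x') - (u + v) := by abel
    rw [this, huv, sub_self]
  have hy : x - star v ∈ delOne N F p := by
    refine ⟨⟨(F p).sub_mem hx hv, ?_⟩, (kerC N).sub_mem hk (h.range_le_ker hvr)⟩
    change star (x - star v) ∈ F (-1 - p)
    rw [hys]
    exact (F _).add_mem (h.dual.1 (by omega) hx') hu
  have h0 : x - star v = 0 := by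
    by_contra h0
    have := h.pos p _ hy h0
    rw [herm, hys, pairing_add_right, pairing_eq_zero h.dual (by omega) hy.1.1 hx',
      pairing_kerC_rangeC h.lie hy.2 hu'] at this
    simp at this
  rw [sub_eq_zero.1 h0]
  exact hvr

lemma orth_ker_inf (p : ℤ) : P.orth (F p ⊓ kerC N) = F (-p) ⊔ rangeC N := by
  rw [← orth_orth (F (-p) ⊔ rangeC N), orth_sup, orth_eq h.dual, neg_neg, orth_rangeC h.lie]

/-- `F` induces a Hodge structure of weight `-1` on `Ker N / Im N`. -/
lemma exists_ker_decomp (p : ℤ) {x : ι → ℂ} (hx : x ∈ kerC N) :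
    ∃ a b u, a ∈ F p ∧ a ∈ kerC N ∧ star b ∈ F (-p) ∧ b ∈ kerC N ∧ u ∈ rangeC N ∧
      x = a + b + u := by
  set A := (F p ⊓ kerC N) ⊔ rangeC N with hA
  set A' := (F (-p) ⊓ kerC N) ⊔ rangeC N with hA'
  have hdim : Module.finrank ℂ A + Module.finrank ℂ A' = Fintype.card ι := by
    have hmod : (F (-p) ⊔ rangeC N) ⊓ kerC N = A' := by
      rw [hA', sup_comm, sup_inf_assoc_of_le _ h.range_le_ker, sup_comm]
    rw [← P.finrank_orth A, add_comm, ← hmod, hA, orth_sup, h.orth_ker_inf, orth_rangeC h.lie]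
  have hinf : A ⊓ conjSub A' = rangeC N := by
    apply le_antisymm
    · rintro x ⟨h1, h2⟩
      obtain ⟨a, ha, u, hu, rfl⟩ := Submodule.mem_sup.1 h1
      obtain ⟨b, hb, v, hv, hbv⟩ := Submodule.mem_sup.1 (show star (a + u) ∈ A' from h2)
      refine Submodule.add_mem _ (h.mem_range_of_ker ha.1 ha.2 hb.1 ?_) hu
      have : star a - b = v - star u := by
        rw [star_add] at hbv
        rw [sub_eq_sub_iff_add_eq_add, ← hbv, add_comm]
      rw [this]
      exact Submodule.sub_mem _ hv (star_mem_rangeC hu)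
    · refine le_inf le_sup_right ?_
      conv_lhs => rw [← conjSub_rangeC N]
      exact conjSub_mono le_sup_right
  have h1 := Submodule.finrank_sup_add_finrank_inf_eq A (conjSub A')
  rw [hinf, finrank_conjSub] at h1
  have h2 := finrank_rangeC_add_finrank_kerC N
  have h3 : A ⊔ conjSub A' = kerC N := by
    apply Submodule.eq_of_le_of_finrank_eq
    · refine sup_le (sup_le inf_le_right h.range_le_ker) ?_
      conv_rhs => rw [← conjSub_kerC N]
      exact conjSub_mono (sup_le inf_le_right h.range_le_ker)
    · omega
  rw [← h3] at hx
  obtain ⟨y, hy, z, hz, rfl⟩ := Submodule.mem_sup.1 hx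
  obtain ⟨a, ha, u, hu, rfl⟩ := Submodule.mem_sup.1 hy
  obtain ⟨b, hb, v, hv, hbv⟩ := Submodule.mem_sup.1 (show star z ∈ A' from hz)
  refine ⟨a, star b, u + star v, ha.1, ha.2, by simpa using hb.1, star_mem_kerC hb.2,
    Submodule.add_mem _ hu (star_mem_rangeC hv), ?_⟩
  have : z = star b + star v := by rw [← star_add, hbv, star_star]
  rw [this]; abel

/-! ### Deligne's splitting -/

lemma range_step {p : ℤ} {x : ι → ℂ} (hx : x ∈ F p) (hr : x ∈ rangeC N) :
    ∃ a b, a ∈ F (p + 1) ∧ a ∈ rangeC N ∧ b ∈ F p ∧ star b ∈ F (-2 - p) ∧ b ∈ rangeC N ∧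
      x = a + b := by
  obtain ⟨a, b, ha, ha', hb, hb', rfl⟩ := h.exists_range_decomp (p + 1) hr
  have h2 : -1 - (p + 1) = -2 - p := by ring
  rw [h2] at hb
  refine ⟨a, b, ha, ha', ?_, hb, hb', rfl⟩
  simpa using (F p).sub_mem hx (h.dual.1 (by omega) ha)

lemma ker_step {p : ℤ} {x : ι → ℂ} (hx : x ∈ F p) (hk : x ∈ kerC N) :
    ∃ a b u, a ∈ F (p + 1) ∧ a ∈ kerC N ∧ b ∈ delOne N F p ∧ u ∈ F p ∧ u ∈ rangeC N ∧
      x = a + b + u := by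
  obtain ⟨a, c, u, ha, ha', hc, hc', hu, rfl⟩ := h.exists_ker_decomp (p + 1) hk
  obtain ⟨u₁, u₂, hu₁, hu₁', hu₂, hu₂', rfl⟩ := h.exists_range_decomp p hu
  refine ⟨a, c + u₂, u₁, ha, ha', ⟨⟨?_, ?_⟩, ?_⟩, hu₁, hu₁', by abel⟩
  · have : c + u₂ = a + c + (u₁ + u₂) - a - u₁ := by abel
    rw [this]
    exact (F p).sub_mem ((F p).sub_mem hx (h.dual.1 (by omega) ha)) hu₁
  · change star (c + u₂) ∈ F (-1 - p)
    rw [star_add]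
    have h2 : -(p + 1) = -1 - p := by ring
    rw [h2] at hc
    exact Submodule.add_mem _ hc hu₂
  · exact Submodule.add_mem _ hc' (h.range_le_ker hu₂')

lemma step {p : ℤ} {x : ι → ℂ} (hx : x ∈ F p) :
    ∃ a b k, a ∈ F (p + 1) ∧ b ∈ delZero N F p ∧ k ∈ F p ∧ k ∈ kerC N ∧ x = a + b + k := by
  obtain ⟨n₁, n₂, h1, h1', h2, h2s, h2', hn⟩ :=
    h.range_step (h.hor p x hx) (mulVec_mem_rangeC N x)
  have e1 : p - 1 + 1 = p + 1 - 1 := by ring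
  have e2 : -2 - (p - 1) = -p - 1 := by ring
  rw [e1] at h1
  rw [e2] at h2s
  obtain ⟨a, ha, rfl⟩ := h.exists_mulVec_eq h1 h1'
  obtain ⟨b, hb, hbn⟩ := h.exists_mulVec_eq h2s (star_mem_rangeC h2')
  have hk : x - a - star b ∈ kerC N := by
    rw [mem_kerC, Matrix.mulVec_sub, Matrix.mulVec_sub, hn, ← star_matC_mulVec, hbn, star_star]
    abel
  obtain ⟨k, c, u, hk1, hk1', hc, hc', hu, hkk⟩ := h.exists_ker_decomp p hk
  obtain ⟨u₁, u₂, hu₁, hu₁', hu₂, hu₂', rfl⟩ := h.exists_range_decomp p hu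
  have e3 : -1 - p = -p - 1 := by ring
  rw [e3] at hu₂
  have hv : x - a - k - u₁ = star b + c + u₂ := by
    have : x = a + star b + (k + c + (u₁ + u₂)) := by rw [← hkk]; abel
    rw [this]; abel
  refine ⟨a, star b + c + u₂, k + u₁, ha, mem_delZero.2 ⟨?_, b + star c,
    Submodule.add_mem _ hb hc, star u₂, hu₂, star_mem_rangeC hu₂', by simp⟩,
    Submodule.add_mem _ hk1 hu₁, Submodule.add_mem _ hk1' (h.range_le_ker hu₁'), ?_⟩
  · rw [← hv]
    exact (F p).sub_mem ((F p).sub_mem ((F p).sub_mem hx (h.dual.1 (by omega) ha)) hk1) hu₁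
  · rw [← hv]; abel

lemma eq_zero_of_mem_ker {p : ℤ} {x a u : ι → ℂ} (hx : x ∈ F p) (hk : x ∈ kerC N)
    (ha : a ∈ F (-p)) (hu : u ∈ F (-p - 1)) (hu' : u ∈ rangeC N) (hxa : x = star a + star u) :
    x = 0 := by
  have hs : star x = a + u := by rw [hxa]; simp
  have hr : x ∈ rangeC N := by
    refine h.mem_range_of_ker hx hk ha ?_
    have : star x - a = u := by rw [hs]; abel
    rw [this]; exact hu'
  refine h.eq_zero_of_mem_range (a := p) (b := -p - 1) (by omega) hx ?_ hr
  rw [hs]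
  exact Submodule.add_mem _ (h.dual.1 (by omega) ha) hu

lemma eq_zero_of_mem_delZero {p : ℤ} {x : ι → ℂ} (hx : x ∈ delZero N F p)
    (hk : x ∈ kerC N) : x = 0 := by
  obtain ⟨h1, a, ha, u, hu, hu', hxa⟩ := mem_delZero.1 hx
  exact h.eq_zero_of_mem_ker h1 hk ha hu hu' hxa

lemma mulVec_mem_of_mem_delZero {p : ℤ} {x : ι → ℂ} (hx : x ∈ delZero N F p) :
    matC N *ᵥ x ∈ F (p - 1) ∧ star (matC N *ᵥ x) ∈ F (-p - 1) := by
  obtain ⟨h1, a, ha, u, hu, hu', rfl⟩ := mem_delZero.1 hx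
  refine ⟨h.hor p _ h1, ?_⟩
  rw [star_matC_mulVec, star_add, star_star, star_star, Matrix.mulVec_add,
    mem_kerC.1 (h.range_le_ker hu'), add_zero]
  exact h.hor _ a ha

lemma deligne_eq_bot {p q : ℤ} (hpq : 1 ≤ p + q) : deligne N F p q = ⊥ := by
  rw [Submodule.eq_bot_iff]
  intro x hx
  obtain ⟨h1, a, ha, b, hb, hbk, u, hu, hu', hxa⟩ := exists_of_mem_deligne_pos h.dual.1 hpq hx
  have hn : matC N *ᵥ x = 0 := by
    refine h.eq_zero_of_mem_range (a := p - 1) (b := -p) (by omega) (h.hor p x h1) ?_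
      (mulVec_mem_rangeC N x)
    have : star x = a + b + u := by rw [hxa]; simp
    rw [star_matC_mulVec, this, Matrix.mulVec_add, Matrix.mulVec_add,
      mem_kerC.1 (h.range_le_ker hu'), mem_kerC.1 hbk, add_zero, add_zero]
    have e : -p = 1 - p - 1 := by ring
    rw [e]
    exact h.hor _ a ha
  exact h.eq_zero_of_mem_ker (a := a + b) h1 (mem_kerC.2 hn)
    (Submodule.add_mem _ (h.dual.1 (by omega) ha) hb) hu hu' (by rw [hxa, star_add])

/-- Complex conjugation exchanges `I^{p,-p}` and `I^{-p,p}` modulo `I^{-p-1,p-1}`. -/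
lemma star_delZero {p : ℤ} {x : ι → ℂ} (hx : x ∈ delZero N F p) :
    ∃ w b, w ∈ delZero N F (-p) ∧ b ∈ F (-p - 1) ∧ star b ∈ F (p - 1) ∧ b ∈ rangeC N ∧
      star x = w + b := by
  obtain ⟨h1, a, ha, u, hu, hu', hxa⟩ := mem_delZero.1 hx
  obtain ⟨c, b, hc, hc', hb, hb', hb'', rfl⟩ := h.range_step hu hu'
  have e1 : -p - 1 + 1 = -p := by ring
  have e2 : -2 - (-p - 1) = p - 1 := by ring
  rw [e1] at hc
  rw [e2] at hb'
  have hs : star x = a + (c + b) := by rw [hxa]; simp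
  refine ⟨a + c, b, mem_delZero.2 ⟨Submodule.add_mem _ ha hc, x, by rwa [neg_neg], -star b, ?_,
    Submodule.neg_mem _ (star_mem_rangeC hb''), ?_⟩, hb, hb', hb'', ?_⟩
  · rw [neg_neg]; exact Submodule.neg_mem _ hb'
  · rw [hs, star_neg, star_star]; abel
  · rw [hs]; abel

lemma iSup_delZero_sup_ker : (⨆ p, delZero N F p) ⊔ kerC N = ⊤ := by
  obtain ⟨b, hb⟩ := exists_bot h.dual
  obtain ⟨a, ha⟩ := exists_top h.dual
  rw [eq_top_iff, ← ha a le_rfl]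
  refine filt_le_of_step (G := fun _ => (⨆ p, delZero N F p) ⊔ kerC N) antitone_const hb
    (fun p x hx => ?_) a
  obtain ⟨c, d, k, hc, hd, -, hk, rfl⟩ := h.step hx
  rw [add_assoc]
  exact Submodule.add_mem_sup hc
    (Submodule.add_mem_sup (Submodule.mem_iSup_of_mem p hd) hk)

lemma iSup_delOne_sup_range : (⨆ p, delOne N F p) ⊔ rangeC N = kerC N := by
  apply le_antisymm
  · exact sup_le (iSup_le fun p => inf_le_right) h.range_le_ker
  obtain ⟨b, hb⟩ := exists_bot h.dual
  obtain ⟨a, ha⟩ := exists_top h.dual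
  have := filt_le_of_step (F := fun p => F p ⊓ kerC N)
    (G := fun _ => (⨆ p, delOne N F p) ⊔ rangeC N) antitone_const (b := b)
    (fun p hp => by simp [hb p hp])
    (fun p x hx => ?_) a
  · simpa [ha a le_rfl] using this
  · obtain ⟨c, d, u, hc, hc', hd, -, hu, rfl⟩ := h.ker_step hx.1 hx.2
    rw [add_assoc]
    exact Submodule.add_mem_sup ⟨hc, hc'⟩
      (Submodule.add_mem_sup (Submodule.mem_iSup_of_mem p hd) hu)

lemma iSup_deligne_neg_two : (⨆ p, deligne N F p (-2 - p)) = rangeC N := by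
  apply le_antisymm
  · refine iSup_le fun p => ?_
    rw [deligne_neg_two N F (by omega)]
    exact inf_le_right
  obtain ⟨b, hb⟩ := exists_bot h.dual
  obtain ⟨a, ha⟩ := exists_top h.dual
  have := filt_le_of_step (F := fun p => F p ⊓ rangeC N)
    (G := fun _ => ⨆ p, deligne N F p (-2 - p)) antitone_const (b := b)
    (fun p hp => by simp [hb p hp])
    (fun p x hx => ?_) a
  · simpa [ha a le_rfl] using this
  · obtain ⟨c, d, hc, hc', hd, hd', hd'', rfl⟩ := h.range_step hx.1 hx.2
    refine Submodule.add_mem_sup ⟨hc, hc'⟩ (Submodule.mem_iSup_of_mem p ?_)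
    rw [deligne_neg_two N F (by omega)]
    exact ⟨⟨hd, hd'⟩, hd''⟩

/-! ### Orthogonality of the components -/

lemma pairing_mulVec_delZero {p q : ℤ} (hpq : p ≠ q) {x y : ι → ℂ} (hx : x ∈ delZero N F p)
    (hy : y ∈ delZero N F q) : P.pairing x (matC N *ᵥ star y) = 0 := by
  have key : ∀ {p q : ℤ}, q < p → ∀ {x y : ι → ℂ}, x ∈ delZero N F p → y ∈ delZero N F q →
      P.pairing x (matC N *ᵥ star y) = 0 := by
    intro p q hpq x y hx hy
    rw [← star_matC_mulVec]
    exact pairing_eq_zero h.dual (by omega) (mem_delZero.1 hx).1 (h.mulVec_mem_of_mem_delZero hy).2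
  rcases lt_or_gt_of_ne hpq with hlt | hgt
  · rw [← star_eq_zero, star_pairing, star_matC_mulVec, star_star, pairing_swap,
      pairing_matC_mulVec h.lie, key hlt hy hx, neg_zero, neg_zero]
  · exact key hgt hx hy

lemma pairing_delZero_delZero {p q : ℤ} {x y : ι → ℂ} (hx : x ∈ delZero N F p)
    (hy : y ∈ delZero N F q) : P.pairing x y = 0 := by
  obtain ⟨h1, a, ha, u, hu, hu', hxa⟩ := mem_delZero.1 hx
  obtain ⟨h2, b, hb, v, hv, hv', hyb⟩ := mem_delZero.1 hy
  rcases le_or_gt 0 (p + q) with hpq | hpq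
  · exact pairing_eq_zero h.dual hpq h1 h2
  · rw [hxa, hyb, ← star_add, ← star_add, ← star_pairing, star_eq_zero, pairing_add_left,
      pairing_add_right, pairing_add_right, pairing_eq_zero h.dual (by omega) ha hb,
      pairing_eq_zero h.dual (by omega) ha hv, pairing_eq_zero h.dual (by omega) hu hb,
      pairing_rangeC_kerC h.lie hu' (h.range_le_ker hv')]
    simp

lemma pairing_delZero_delOne {p q : ℤ} {x y : ι → ℂ} (hx : x ∈ delZero N F p)
    (hy : y ∈ delOne N F q) : P.pairing x y = 0 := by
  obtain ⟨h1, a, ha, u, hu, hu', hxa⟩ := mem_delZero.1 hx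
  rcases le_or_gt 0 (p + q) with hpq | hpq
  · exact pairing_eq_zero h.dual hpq h1 hy.1.1
  · rw [← star_eq_zero, star_pairing]
    have : star x = a + u := by rw [hxa]; simp
    rw [this, pairing_add_left, pairing_eq_zero h.dual (by omega) ha hy.1.2,
      pairing_rangeC_kerC h.lie hu' (star_mem_kerC hy.2), add_zero]

/-! ### Twists that are trivial on the graded pieces -/

/-- The conditions on `(N, F)` only involve `Ker N`, `Im N` and the filtrations induced on the
graded pieces, so they do not change under `1 + M` with `M : Gr_0^W → Gr_{-2}^W`. -/
lemma twist {M : Matrix ι ι ℂ} (hM : M ∈ P.spC) (hMk : ∀ x ∈ kerC N, M *ᵥ x = 0)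
    (hMr : ∀ x, M *ᵥ x ∈ rangeC N) :
    P.LMHS N (actF (1 + M) F) ∧ ∀ p, ∀ x ∈ kerC N, x ∈ actF (1 + M) F p ↔ x ∈ F p := by
  have hfix : ∀ p, ∀ x ∈ kerC N, x ∈ actF (1 + M) F p ↔ x ∈ F p := by
    intro p x hx
    constructor
    · intro hxF
      obtain ⟨y, hy, rfl⟩ := mem_actV.1 hxF
      rw [Matrix.add_mulVec, Matrix.one_mulVec] at hx ⊢
      have hyk : y ∈ kerC N := by
        have := Submodule.sub_mem _ hx (h.range_le_ker (hMr y))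
        rwa [add_sub_cancel_right] at this
      rwa [hMk y hyk, add_zero]
    · intro hxF
      refine mem_actV.2 ⟨x, hxF, ?_⟩
      rw [Matrix.add_mulVec, Matrix.one_mulVec, hMk x hx, add_zero]
  have hsq : M * M = 0 := by
    apply ext_mulVec
    intro x
    rw [← Matrix.mulVec_mulVec, hMk _ (h.range_le_ker (hMr x)), Matrix.zero_mulVec]
  refine ⟨⟨h.lie, h.sq, actF_mem_compactDual h.dual (P.one_add_mem_GC hM hsq), ?_, ?_⟩, hfix⟩
  · intro p x hx
    obtain ⟨y, hy, rfl⟩ := mem_actV.1 hx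
    rw [hfix _ _ (h.range_le_ker (mulVec_mem_rangeC N _)), Matrix.add_mulVec, Matrix.one_mulVec,
      Matrix.mulVec_add, mem_kerC.1 (h.range_le_ker (hMr y)), add_zero]
    exact h.hor p y hy
  · intro p x hx h0
    refine h.pos p x ⟨⟨(hfix p x hx.2).1 hx.1.1, ?_⟩, hx.2⟩ h0
    exact (hfix _ _ (star_mem_kerC hx.2)).1 hx.1.2

end LMHS

end PolData

namespace PolData

/-! ### Pairs of even and of odd type -/

/-- A limiting mixed Hodge structure whose weight `0` part only has types `(p,-p)` with `p ≡ e`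
modulo `2`. Then the forms `(-1)^p ⟨x, N conj y⟩` that polarize these types have a common sign, so
that `⟨x, N conj y⟩` is semidefinite. -/
structure TypedLMHS (P : PolData ι) (e : ℤ) (N : Matrix ι ι ℝ) (F : Filt ι) : Prop
    extends P.LMHS N F where
  semidef : ∀ x, 0 ≤ sgn e * (P.pairing x (matC N *ᵥ star x)).re
  parity : ∀ p, ¬ Even (p + e) → ∀ u ∈ F (p - 1), star u ∈ F (-p - 1) → u ∈ rangeC N → u = 0

variable {P : PolData ι} {N : Matrix ι ι ℝ} {F : Filt ι}

lemma exp_smul_matC (hsq : N * N = 0) (z : ℂ) :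
    NormedSpace.exp (z • matC N) = 1 + z • matC N := by
  apply exp_eq_one_add
  rw [smul_mul_smul_comm, ← matC_mul, hsq, matC_zero, smul_zero]

lemma mulVec_mem_actF_of_mem_ker {z : ℂ} {p : ℤ} {x : ι → ℂ} (hx : x ∈ F p) (hk : x ∈ kerC N) :
    x ∈ actF (1 + z • matC N) F p := by
  refine mem_actV.2 ⟨x, hx, ?_⟩
  rw [Matrix.add_mulVec, Matrix.one_mulVec, Matrix.smul_mulVec, mem_kerC.1 hk, smul_zero, add_zero]

/-- A Hodge component in the kernel of `N` is a Hodge component of every point of the orbit. -/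
lemma LMHS.of_mem_periodDomain (lie : N ∈ P.lieG) (sq : N * N = 0) (dual : F ∈ P.compactDual)
    (hor : ∀ p, ∀ x ∈ F p, matC N *ᵥ x ∈ F (p - 1)) {z : ℂ}
    (hz : actF (1 + z • matC N) F ∈ P.periodDomain) : P.LMHS N F := by
  refine ⟨lie, sq, dual, hor, fun p x hx h0 => hodge_pos hz (p := p) ⟨?_, ?_⟩ h0⟩
  · exact mulVec_mem_actF_of_mem_ker hx.1.1 hx.2
  · exact mulVec_mem_actF_of_mem_ker hx.1.2 (star_mem_kerC hx.2)

/-- For `x ∈ I^{p,-p}` the vector `exp(iyN) x` is in the Hodge component of type `(p,-p-1)` of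
`exp(iyN) F`, and `h(exp(iyN) x) = h(x) + 2y ⟨x, N conj x⟩`; the sign follows as `y → ∞`. -/
lemma LMHS.delZero_nonneg (h : P.LMHS N F) {c : ℝ}
    (hc : ∀ z : ℂ, c < z.im → actF (1 + z • matC N) F ∈ P.periodDomain) {p : ℤ} {x : ι → ℂ}
    (hx : x ∈ delZero N F p) : 0 ≤ sgn p * (P.pairing x (matC N *ᵥ star x)).re := by
  obtain ⟨h1, a, ha, u, hu, hu', hxa⟩ := mem_delZero.1 hx
  have hsx : star x = a + u := by rw [hxa]; simp
  have hnu : matC N *ᵥ u = 0 := mem_kerC.1 (h.range_le_ker hu')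
  have hkey : ∀ y : ℝ, c < y → 0 ≤ sgn p * ((P.herm x x).re +
      2 * y * (P.pairing x (matC N *ᵥ star x)).re) := by
    intro y hy
    have hD := hc (Complex.I * y) (by simpa using hy)
    set z : ℂ := Complex.I * y with hz
    have hzs : star z = -z := by
      rw [hz, star_mul]
      have h1 : star Complex.I = -Complex.I := Complex.conj_I
      have h2 : star (y : ℂ) = y := Complex.conj_ofReal y
      rw [h1, h2]; ring
    set v : ι → ℂ := x + z • (matC N *ᵥ x) with hv
    have hvF : v ∈ actF (1 + z • matC N) F p :=
      mem_actV.2 ⟨x, h1, by rw [Matrix.add_mulVec, Matrix.one_mulVec, Matrix.smul_mulVec]⟩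
    have hvs : star v = star x - z • (matC N *ᵥ star x) := by
      rw [hv, star_add, star_smul, hzs, star_matC_mulVec, neg_smul, sub_eq_add_neg]
    have hvF' : star v ∈ actF (1 + z • matC N) F (-1 - p) := by
      have e1 : -1 - p = -p - 1 := by ring
      have hna : matC N *ᵥ a ∈ F (-p - 1) := h.hor _ a ha
      have : star v = (a + z • (matC N *ᵥ a)) + (u - (2 * z) • (matC N *ᵥ a)) := by
        rw [hvs, hsx, Matrix.mulVec_add, hnu, add_zero]
        module
      rw [this, e1]
      refine Submodule.add_mem _ (mem_actV.2 ⟨a, h.dual.1 (by omega) ha, ?_⟩)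
        (mulVec_mem_actF_of_mem_ker ((F _).sub_mem hu ((F _).smul_mem _ hna))
          (h.range_le_ker ((rangeC N).sub_mem hu'
            ((rangeC N).smul_mem _ (mulVec_mem_rangeC N a)))))
      rw [Matrix.add_mulVec, Matrix.one_mulVec, Matrix.smul_mulVec]
    have hh : P.herm v v = P.herm x x + (2 * y : ℝ) * P.pairing x (matC N *ᵥ star x) := by
      have hI := Complex.I_sq
      rw [herm, hvs, hv, herm, pairing_add_left, pairing_sub_right, pairing_sub_right,
        pairing_smul_left, pairing_smul_left, pairing_smul_right, pairing_smul_right,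
        pairing_matC_mulVec h.lie, pairing_matC_mulVec h.lie, h.mulVec_mulVec, pairing_zero_right,
        hz]
      push_cast
      linear_combination (-2 * y * P.pairing x (matC N *ᵥ star x)) * hI
    have h2 : 0 ≤ sgn p * (P.herm v v).re := by
      by_cases hv0 : v = 0
      · rw [hv0, herm_zero_left]; simp
      · exact (hodge_pos hD (p := p) ⟨hvF, hvF'⟩ hv0).le
    rwa [hh, Complex.add_re, Complex.re_ofReal_mul] at h2
  by_contra hneg
  push Not at hneg
  set s := sgn p * (P.pairing x (matC N *ᵥ star x)).re with hs
  set d := sgn p * (P.herm x x).re with hd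
  have h3 : |c| + |d| / (-s) + 1 > c := by
    have := le_abs_self c
    have : 0 ≤ |d| / (-s) := div_nonneg (abs_nonneg _) (by linarith)
    linarith
  have h4 := hkey _ h3
  have h5 : |d| / (-s) * (-s) = |d| := div_mul_cancel₀ _ (by linarith)
  have h6 : 0 ≤ d + 2 * (|c| + |d| / (-s) + 1) * s := by
    rw [hs, hd]; rw [hs, hd] at h4; linarith
  have := le_abs_self d
  have := abs_nonneg d
  nlinarith [abs_nonneg c]

lemma TypedLMHS.of_orbit (h : P.LMHS N F) {e : ℤ} {c : ℝ}
    (hc : ∀ z : ℂ, c < z.im → actF (1 + z • matC N) F ∈ P.periodDomain)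
    (hpar : ∀ p, ¬ Even (p + e) → delZero N F p = ⊥) : P.TypedLMHS e N F := by
  refine { toLMHS := h, semidef := fun x => ?_, parity := fun p hp u hu hus hur => ?_ }
  · have hx : x ∈ (⨆ p, delZero N F p) ⊔ kerC N := by rw [h.iSup_delZero_sup_ker]; trivial
    obtain ⟨i, hi, k, hk, rfl⟩ := Submodule.mem_sup.1 hx
    have hk' := mem_kerC.1 (star_mem_kerC hk)
    have hA : ∀ x y, (sgn e : ℂ) * P.pairing x (matC N *ᵥ star y) =
        P.pairing x (((sgn e : ℂ) • matC N) *ᵥ star y) := by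
      intro x y
      rw [Matrix.smul_mulVec, pairing_smul_right]
    rw [star_add, Matrix.mulVec_add, hk', add_zero, pairing_add_left,
      pairing_kerC_rangeC h.lie hk (mulVec_mem_rangeC N _), add_zero, ← Complex.re_ofReal_mul, hA]
    refine P.nonneg_of_mem_iSup _ (fun p q hpq x hx y hy => ?_) (fun p x hx => ?_) hi
    · rw [← hA, h.pairing_mulVec_delZero hpq hx hy, mul_zero]
    · rw [← hA, Complex.re_ofReal_mul]
      by_cases hp : Even (p + e)
      · rw [← sgn_eq_of_even hp]
        exact h.delZero_nonneg hc hx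
      · rw [hpar p hp, Submodule.mem_bot] at hx
        simp [hx, pairing_zero_left]
  · obtain ⟨v, hv, rfl⟩ := h.exists_mulVec_eq hu hur
    obtain ⟨a, b, k, ha, hb, -, hk, rfl⟩ := h.step hv
    rw [hpar p hp, Submodule.mem_bot] at hb
    subst hb
    rw [add_zero, Matrix.mulVec_add, mem_kerC.1 hk, add_zero] at hus ⊢
    refine h.eq_zero_of_mem_range (a := p) (b := -p - 1) (by omega) ?_ hus (mulVec_mem_rangeC N a)
    have := h.hor _ a ha
    rwa [add_sub_cancel_right] at this

namespace TypedLMHS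

variable {e : ℤ} (h : P.TypedLMHS e N F)
include h

/-- The radical of the semidefinite form `⟨x, N conj y⟩` is the kernel of `N`. -/
lemma mem_kerC_of_pairing {x : ι → ℂ} (hx : (P.pairing x (matC N *ᵥ star x)).re = 0) :
    x ∈ kerC N := by
  have hherm : ∀ x y, star (P.pairing x (matC N *ᵥ star y)) = P.pairing y (matC N *ᵥ star x) := by
    intro x y
    rw [star_pairing, star_matC_mulVec, star_star, pairing_swap, pairing_matC_mulVec h.lie, neg_neg]
  have hre : ∀ y, (P.pairing x (matC N *ᵥ star y)).re = 0 := by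
    intro y
    have hq : ∀ t : ℝ, 0 ≤ (sgn e * (P.pairing y (matC N *ᵥ star y)).re) * (t * t) +
        (sgn e * (2 * (P.pairing x (matC N *ᵥ star y)).re)) * t + 0 := by
      intro t
      have h1 := h.semidef (x + (t : ℂ) • y)
      have h2 : star (t : ℂ) = (t : ℂ) := Complex.conj_ofReal _
      have h3 : (P.pairing y (matC N *ᵥ star x)).re = (P.pairing x (matC N *ᵥ star y)).re := by
        rw [← hherm]; simp
      rw [star_add, star_smul, h2, Matrix.mulVec_add, Matrix.mulVec_smul, pairing_add_left,
        pairing_add_right, pairing_add_right, pairing_smul_left, pairing_smul_left,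
        pairing_smul_right, pairing_smul_right] at h1
      simp only [Complex.add_re, Complex.re_ofReal_mul, hx, h3] at h1
      linarith
    have hd := discrim_le_zero hq
    rw [discrim] at hd
    have h4 : (sgn e * (2 * (P.pairing x (matC N *ᵥ star y)).re)) = 0 := by
      have : (sgn e * (2 * (P.pairing x (matC N *ᵥ star y)).re)) ^ 2 ≤ 0 := by linarith
      exact pow_eq_zero_iff (two_ne_zero) |>.1 (le_antisymm this (sq_nonneg _))
    have h5 := sgn_mul_self e
    have : sgn e * (sgn e * (2 * (P.pairing x (matC N *ᵥ star y)).re)) = 0 := by rw [h4, mul_zero]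
    rw [← mul_assoc, h5] at this
    linarith
  rw [mem_kerC]
  apply P.eq_zero_of_pairing
  intro y
  rw [pairing_matC_mulVec h.lie, neg_eq_zero]
  apply Complex.ext
  · have := hre (star y)
    rwa [star_star] at this
  · have := hre (star (Complex.I • y))
    rw [star_star, Matrix.mulVec_smul, pairing_smul_right, Complex.I_mul_re] at this
    simpa using this

lemma delZero_eq_bot {p : ℤ} (hp : ¬ Even (p + e)) : delZero N F p = ⊥ := by
  rw [Submodule.eq_bot_iff]
  intro x hx
  apply h.eq_zero_of_mem_delZero hx
  have := h.mulVec_mem_of_mem_delZero hx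
  exact mem_kerC.2 (h.parity p hp _ this.1 this.2 (mulVec_mem_rangeC N x))

lemma delZero_disjoint_ker {x : ι → ℂ} (hx : x ∈ ⨆ p, delZero N F p) (hk : x ∈ kerC N) :
    x = 0 := by
  by_contra h0
  have hA : ∀ x y, (sgn e : ℂ) * P.pairing x (matC N *ᵥ star y) =
      P.pairing x (((sgn e : ℂ) • matC N) *ᵥ star y) := by
    intro x y
    rw [Matrix.smul_mulVec, pairing_smul_right]
  have := P.pos_of_mem_iSup ((sgn e : ℂ) • matC N) (V := delZero N F)
    (fun p q hpq x hx y hy => by rw [← hA, h.pairing_mulVec_delZero hpq hx hy, mul_zero])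
    (fun p x hx h0 => by
      rw [← hA, Complex.re_ofReal_mul]
      refine lt_of_le_of_ne (h.semidef x) fun heq => h0 ?_
      have hs : sgn e ≠ 0 := fun hs => by have := sgn_mul_self e; simp [hs] at this
      exact h.eq_zero_of_mem_delZero hx (h.mem_kerC_of_pairing
        ((mul_eq_zero.1 heq.symm).resolve_left hs))) hx h0
  rw [← hA, mem_kerC.1 (star_mem_kerC hk), pairing_zero_right] at this
  simp at this

end TypedLMHS

/-- The sum of the `I^{p,-p-1}` with `p ≡ e` modulo `2`. -/
def delPart (e : ℤ) (N : Matrix ι ι ℝ) (F : Filt ι) : Submodule ℂ (ι → ℂ) :=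
  ⨆ p : ℤ, ⨆ _ : Even (p + e), delOne N F p

lemma delPart_le_ker (e : ℤ) (N : Matrix ι ι ℝ) (F : Filt ι) : delPart e N F ≤ kerC N :=
  iSup₂_le fun _ _ => inf_le_right

lemma conjSub_delOne (N : Matrix ι ι ℝ) (F : Filt ι) (p : ℤ) :
    conjSub (delOne N F p) = delOne N F (-1 - p) := by
  have : conjSub (delOne N F p) = conjSub (hodge F p) ⊓ conjSub (kerC N) := rfl
  rw [this, conjSub_hodge, conjSub_kerC]; rfl

lemma conjSub_delPart (e : ℤ) (N : Matrix ι ι ℝ) (F : Filt ι) :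
    conjSub (delPart e N F) = delPart (e + 1) N F :=
  conjSub_iSup_parity (conjSub_delOne N F) e

lemma delPart_congr {e e' : ℤ} (h : Even (e + e')) (N : Matrix ι ι ℝ) (F : Filt ι) :
    delPart e N F = delPart e' N F := by
  unfold delPart
  congr 1
  funext p
  have : Even (p + e) ↔ Even (p + e') := by
    rw [Int.even_add] at *
    rw [Int.even_add]; tauto
  simp only [this]

lemma iSup_delOne_eq (e : ℤ) (N : Matrix ι ι ℝ) (F : Filt ι) :
    ⨆ p, delOne N F p = delPart e N F ⊔ delPart (e + 1) N F := by
  apply le_antisymm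
  · refine iSup_le fun p => ?_
    rcases even_or p e with hp | hp
    · exact le_sup_of_le_left (le_iSup₂_of_le p hp le_rfl)
    · exact le_sup_of_le_right (le_iSup₂_of_le p hp le_rfl)
  · exact sup_le (iSup₂_le fun p _ => le_iSup _ p) (iSup₂_le fun p _ => le_iSup _ p)

namespace LMHS

variable (h : P.LMHS N F)
include h

lemma delPart_pos {e : ℤ} {x : ι → ℂ} (hx : x ∈ delPart e N F) (h0 : x ≠ 0) :
    0 < sgn e * (P.herm x x).re :=
  herm_pos_of_parity (V := delOne N F)
    (fun _ _ hpq _ hx _ hy => herm_hodge_eq_zero h.dual hpq hx.1 hy.1)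
    (fun p x hx h0 => h.pos p x hx h0) hx h0

lemma delPart_isotropic {e : ℤ} {x y : ι → ℂ} (hx : x ∈ delPart e N F)
    (hy : y ∈ delPart e N F) : P.pairing x y = 0 :=
  isotropic_of_parity (V := delOne N F)
    (fun _ _ hpq _ hx _ hy => pairing_hodge_eq_zero h.dual hpq hx.1 hy.1) hx hy

/-- Components of different parity are orthogonal for the hermitian form. -/
lemma herm_delPart {e : ℤ} {x y : ι → ℂ} (hx : x ∈ delPart e N F)
    (hy : y ∈ delPart (e + 1) N F) : P.herm x y = 0 := by
  have hy' : star y ∈ delPart e N F := by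
    have : y ∈ conjSub (delPart e N F) := by rw [conjSub_delPart]; exact hy
    exact this
  rw [herm, h.delPart_isotropic hx hy', mul_zero]

lemma eq_zero_of_delPart_add_mem_range {e : ℤ} {a b : ι → ℂ} (ha : a ∈ delPart e N F)
    (hb : b ∈ delPart (e + 1) N F) (hr : a + b ∈ rangeC N) : a = 0 := by
  by_contra h0
  have h1 := h.delPart_pos ha h0
  have h2 : P.herm (a + b) a = 0 := by
    rw [herm, pairing_rangeC_kerC h.lie hr (star_mem_kerC (delPart_le_ker _ _ _ ha)), mul_zero]
  rw [herm_add_left, P.herm_eq_zero_comm.1 (h.herm_delPart ha hb), add_zero] at h2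
  rw [h2] at h1
  simp at h1

lemma delOne_disjoint_range {x : ι → ℂ} (hx : x ∈ ⨆ p, delOne N F p) (hr : x ∈ rangeC N) :
    x = 0 := by
  rw [iSup_delOne_eq 0] at hx
  obtain ⟨a, ha, b, hb, rfl⟩ := Submodule.mem_sup.1 hx
  have ha0 := h.eq_zero_of_delPart_add_mem_range ha hb hr
  have hb0 : b = 0 := by
    refine h.eq_zero_of_delPart_add_mem_range (e := 0 + 1) (a := b) (b := a) hb ?_ ?_
    · rw [delPart_congr (e' := 0) (by decide)]; exact ha
    · rwa [add_comm]
  rw [ha0, hb0, add_zero]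

end LMHS

lemma TypedLMHS.twist {e : ℤ} (h : P.TypedLMHS e N F) {M : Matrix ι ι ℂ} (hM : M ∈ P.spC)
    (hMk : ∀ x ∈ kerC N, M *ᵥ x = 0) (hMr : ∀ x, M *ᵥ x ∈ rangeC N) :
    P.TypedLMHS e N (actF (1 + M) F) := by
  obtain ⟨h1, h2⟩ := h.toLMHS.twist hM hMk hMr
  refine { toLMHS := h1, semidef := h.semidef, parity := fun p hp u hu hus hur => ?_ }
  have hk := h.range_le_ker hur
  exact h.parity p hp u ((h2 _ u hk).1 hu) ((h2 _ _ (star_mem_kerC hk)).1 hus) hur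

lemma LMHS.delOne_twist (h : P.LMHS N F) {M : Matrix ι ι ℂ} (hM : M ∈ P.spC)
    (hMk : ∀ x ∈ kerC N, M *ᵥ x = 0) (hMr : ∀ x, M *ᵥ x ∈ rangeC N) (p : ℤ) :
    delOne N (actF (1 + M) F) p = delOne N F p := by
  obtain ⟨-, h4⟩ := h.twist hM hMk hMr
  ext x
  constructor
  · rintro ⟨⟨ha, hb⟩, hk⟩
    exact ⟨⟨(h4 p x hk).1 ha, (h4 _ _ (star_mem_kerC hk)).1 hb⟩, hk⟩
  · rintro ⟨⟨ha, hb⟩, hk⟩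
    exact ⟨⟨(h4 p x hk).2 ha, (h4 _ _ (star_mem_kerC hk)).2 hb⟩, hk⟩

/-! ### Nilpotent cones -/

lemma mem_lieG_of_mem_cone {σ : PointedCone ℝ (Matrix ι ι ℝ)} (hσ : P.IsNilpotentCone σ)
    {M : Matrix ι ι ℝ} (hM : M ∈ σ) : M ∈ P.lieG := by
  obtain ⟨s, hs, -, rfl⟩ := hσ
  rw [← matC_mem_spC]
  refine Submodule.span_induction (p := fun M _ => matC M ∈ P.spC) ?_ ?_ ?_ ?_ hM
  · rintro _ ⟨A, hA, rfl⟩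
    exact P.matC_mem_spC.2 (hs A hA).1
  · rw [matC_zero, mem_spC]
    intro x y
    simp [pairing_zero_left, pairing_zero_right]
  · intro A B _ _ hA hB
    rw [matC_add]; exact P.spC_add hA hB
  · intro c A _ hA
    have : matC (c • A) = ((c : ℝ) : ℂ) • matC A := matC_smul (c : ℝ) A
    rw [this]; exact P.spC_smul _ hA

lemma relInt_subset {σ : PointedCone ℝ (Matrix ι ι ℝ)} : relInt σ ⊆ (σ : Set (Matrix ι ι ℝ)) :=
  intrinsicInterior_subset

lemma relInt_nonempty (σ : PointedCone ℝ (Matrix ι ι ℝ)) : (relInt σ).Nonempty := by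
  let : NormedAddCommGroup (Matrix ι ι ℝ) := Matrix.normedAddCommGroup
  let : NormedSpace ℝ (Matrix ι ι ℝ) := Matrix.normedSpace
  exact Set.Nonempty.intrinsicInterior σ.convex ⟨0, σ.zero_mem⟩

/-- A point of the relative interior can be moved in both directions along the cone. -/
lemma exists_add_sub_mem_relInt {σ : PointedCone ℝ (Matrix ι ι ℝ)} {N M : Matrix ι ι ℝ}
    (hN : N ∈ relInt σ) (hM : M ∈ σ) :
    ∃ t : ℝ, 0 < t ∧ N + t • M ∈ relInt σ ∧ N - t • M ∈ relInt σ := by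
  obtain ⟨⟨N', hN'⟩, hint, rfl⟩ := hN
  have h0 : (0 : Matrix ι ι ℝ) ∈ affineSpan ℝ (σ : Set (Matrix ι ι ℝ)) :=
    subset_affineSpan ℝ _ σ.zero_mem
  have hdir : M ∈ (affineSpan ℝ (σ : Set (Matrix ι ι ℝ))).direction := by
    have := AffineSubspace.vsub_mem_direction (subset_affineSpan ℝ _ hM) h0
    simpa using this
  have hline : ∀ t : ℝ, N' + t • M ∈ affineSpan ℝ (σ : Set (Matrix ι ι ℝ)) := by
    intro t
    rw [add_comm]
    exact AffineSubspace.vadd_mem_of_mem_direction (Submodule.smul_mem _ t hdir) hN'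
  have hcont : Continuous (fun t : ℝ => (⟨N' + t • M, hline t⟩ :
      affineSpan ℝ (σ : Set (Matrix ι ι ℝ)))) := by
    apply Continuous.subtype_mk
    fun_prop
  have hopen := (isOpen_interior (s := ((↑) : affineSpan ℝ (σ : Set (Matrix ι ι ℝ)) →
    Matrix ι ι ℝ) ⁻¹' (σ : Set (Matrix ι ι ℝ)))).preimage hcont
  have hmem : (0 : ℝ) ∈ (fun t : ℝ => (⟨N' + t • M, hline t⟩ :
      affineSpan ℝ (σ : Set (Matrix ι ι ℝ)))) ⁻¹' interior (((↑) :
      affineSpan ℝ (σ : Set (Matrix ι ι ℝ)) → Matrix ι ι ℝ) ⁻¹' (σ : Set (Matrix ι ι ℝ))) := by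
    simpa using hint
  obtain ⟨ε, hε, hball⟩ := Metric.isOpen_iff.1 hopen 0 hmem
  refine ⟨ε / 2, by positivity, ⟨⟨N' + (ε / 2) • M, hline _⟩, hball ?_, rfl⟩,
    ⟨⟨N' + (-(ε / 2)) • M, hline _⟩, hball ?_, ?_⟩⟩
  · simp only [Metric.mem_ball, dist_zero_right, Real.norm_eq_abs]
    rw [abs_of_pos (by positivity)]; linarith
  · simp only [Metric.mem_ball, dist_zero_right, Real.norm_eq_abs]
    rw [abs_neg, abs_of_pos (by positivity)]; linarith
  · simp [sub_eq_add_neg]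

/-- The condition shared by even-type (`e = 0`) and odd-type (`e = 1`) cones. -/
def IsTypedCone (P : PolData ι) (e : ℤ) (σ : PointedCone ℝ (Matrix ι ι ℝ)) : Prop :=
  P.IsNilpotentCone σ ∧ ∀ F, P.GeneratesOrbit σ F → ∀ N ∈ relInt σ,
    N * N = 0 ∧ ∀ p : ℤ, ¬ Even (p + e) → deligne N F p (-p) = ⊥

lemma isEvenCone_iff {σ : PointedCone ℝ (Matrix ι ι ℝ)} : P.IsEvenCone σ ↔ P.IsTypedCone 0 σ := by
  simp only [IsEvenCone, IsTypedCone, add_zero, Int.not_even_iff_odd]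

lemma isOddCone_iff {σ : PointedCone ℝ (Matrix ι ι ℝ)} : P.IsOddCone σ ↔ P.IsTypedCone 1 σ := by
  simp only [IsOddCone, IsTypedCone, Int.even_add_one, not_not]

variable {σ : PointedCone ℝ (Matrix ι ι ℝ)} {e : ℤ}

lemma IsTypedCone.typedLMHS (hσ : P.IsTypedCone e σ) (hF : P.GeneratesOrbit σ F)
    (hN : N ∈ relInt σ) : P.TypedLMHS e N F := by
  obtain ⟨hsq, hpar⟩ := hσ.2 F hF N hN
  obtain ⟨c, hc⟩ := hF.2.1 N hN
  have hc' : ∀ z : ℂ, c < z.im → actF (1 + z • matC N) F ∈ P.periodDomain := by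
    intro z hz
    rw [← exp_smul_matC hsq]
    exact hc z hz
  have hz : c < (Complex.I * ((c + 1 : ℝ) : ℂ)).im := by simp
  exact TypedLMHS.of_orbit (LMHS.of_mem_periodDomain (mem_lieG_of_mem_cone hσ.1 (relInt_subset hN))
    hsq hF.1 (fun p x hx => hF.2.2 N (relInt_subset hN) p (mulVec_mem_actV hx)) (hc' _ hz)) hc' hpar

/-- Write `N = t N' + (N - t N')` inside the relative interior. The three forms `⟨x, N conj y⟩` are
semidefinite of the same sign, so the kernel of the sum is the intersection of the kernels. -/
lemma IsTypedCone.kerC_le (hσ : P.IsTypedCone e σ) (hF : P.GeneratesOrbit σ F)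
    {N' : Matrix ι ι ℝ} (hN : N ∈ relInt σ) (hN' : N' ∈ relInt σ) : kerC N ≤ kerC N' := by
  obtain ⟨t, ht, -, h⟩ := exists_add_sub_mem_relInt hN (relInt_subset hN')
  have h1 := hσ.typedLMHS hF hN'
  have h2 := hσ.typedLMHS hF h
  intro x hx
  apply h1.mem_kerC_of_pairing
  have hs1 := h1.semidef x
  have hs2 := h2.semidef x
  rw [matC_sub, matC_smul, Matrix.sub_mulVec, Matrix.smul_mulVec,
    mem_kerC.1 (star_mem_kerC hx), zero_sub, pairing_neg_right, pairing_smul_right, Complex.neg_re,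
    Complex.re_ofReal_mul] at hs2
  have h3 : sgn e * (P.pairing x (matC N' *ᵥ star x)).re = 0 := by nlinarith
  have hs : sgn e ≠ 0 := fun hs => by have := sgn_mul_self e; simp [hs] at this
  exact (mul_eq_zero.1 h3).resolve_left hs

lemma IsTypedCone.kerC_eq (hσ : P.IsTypedCone e σ) (hF : P.GeneratesOrbit σ F)
    {N' : Matrix ι ι ℝ} (hN : N ∈ relInt σ) (hN' : N' ∈ relInt σ) : kerC N = kerC N' :=
  le_antisymm (hσ.kerC_le hF hN hN') (hσ.kerC_le hF hN' hN)

lemma IsTypedCone.rangeC_eq (hσ : P.IsTypedCone e σ) (hF : P.GeneratesOrbit σ F)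
    {N' : Matrix ι ι ℝ} (hN : N ∈ relInt σ) (hN' : N' ∈ relInt σ) : rangeC N = rangeC N' := by
  rw [← orth_kerC (hσ.typedLMHS hF hN).lie, ← orth_kerC (hσ.typedLMHS hF hN').lie,
    hσ.kerC_eq hF hN hN']

lemma IsTypedCone.weight_eq (hσ : P.IsTypedCone e σ) (hF : P.GeneratesOrbit σ F)
    {N' : Matrix ι ι ℝ} (hN : N ∈ relInt σ) (hN' : N' ∈ relInt σ) (k : ℤ) :
    weight N k = weight N' k := by
  have h1 : LinearMap.range N.mulVecLin = LinearMap.range N'.mulVecLin := by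
    ext x
    rw [← vecC_mem_rangeC, ← vecC_mem_rangeC, hσ.rangeC_eq hF hN hN']
  have h2 : LinearMap.ker N.mulVecLin = LinearMap.ker N'.mulVecLin := by
    have key : ∀ (A : Matrix ι ι ℝ) (x : ι → ℝ),
        x ∈ LinearMap.ker A.mulVecLin ↔ vecC x ∈ kerC A := by
      intro A x
      rw [mem_kerC, matC_mulVec_vecC, LinearMap.mem_ker, Matrix.mulVecLin_apply]
      constructor
      · intro h; rw [h, vecC_zero]
      · intro h
        ext i
        simpa [vecC] using congrFun h i
    ext x
    rw [key, key, hσ.kerC_eq hF hN hN']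
  simp only [weight, h1, h2]

lemma IsTypedCone.weight_eq_coneWeight (hσ : P.IsTypedCone e σ) (hF : P.GeneratesOrbit σ F)
    (hN : N ∈ relInt σ) (k : ℤ) : weight N k = coneWeight σ k :=
  le_antisymm (le_iSup₂_of_le N hN le_rfl)
    (iSup₂_le fun _ hN' => (hσ.weight_eq hF hN' hN k).le)

/-- The complex span of the cone maps `W_0` to `W_{-2}` and kills `W_{-1}`. -/
lemma IsTypedCone.span_mulVec (hσ : P.IsTypedCone e σ) (hF : P.GeneratesOrbit σ F)
    (hN : N ∈ relInt σ) {M : Matrix ι ι ℂ}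
    (hM : M ∈ Submodule.span ℂ (matC '' (σ : Set (Matrix ι ι ℝ)))) :
    M ∈ P.spC ∧ (∀ x ∈ kerC N, M *ᵥ x = 0) ∧ ∀ x, M *ᵥ x ∈ rangeC N := by
  induction hM using Submodule.span_induction with
  | mem M hM =>
    obtain ⟨A, hA, rfl⟩ := hM
    obtain ⟨t, ht, h, -⟩ := exists_add_sub_mem_relInt hN hA
    have ht' : (t : ℂ) ≠ 0 := by exact_mod_cast ht.ne'
    have hy : ∀ y, matC A *ᵥ y = (t : ℂ)⁻¹ • (matC (N + t • A) *ᵥ y - matC N *ᵥ y) := by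
      intro y
      rw [matC_add, matC_smul, Matrix.add_mulVec, Matrix.smul_mulVec, add_sub_cancel_left,
        smul_smul, inv_mul_cancel₀ ht', one_smul]
    refine ⟨P.matC_mem_spC.2 (mem_lieG_of_mem_cone hσ.1 hA), fun x hx => ?_, fun x => ?_⟩
    · have hx' := hσ.kerC_le hF hN h hx
      rw [hy, mem_kerC.1 hx, mem_kerC.1 hx', sub_zero, smul_zero]
    · rw [hy]
      refine Submodule.smul_mem _ _ (Submodule.sub_mem _ ?_ (mulVec_mem_rangeC N x))
      rw [hσ.rangeC_eq hF hN h]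
      exact mulVec_mem_rangeC _ x
  | zero =>
    refine ⟨?_, fun x _ => Matrix.zero_mulVec x, fun x => ?_⟩
    · rw [mem_spC]; intro x y; simp [pairing_zero_left, pairing_zero_right]
    · rw [Matrix.zero_mulVec]; exact Submodule.zero_mem _
  | add A B _ _ hA hB =>
    refine ⟨P.spC_add hA.1 hB.1, fun x hx => ?_, fun x => ?_⟩
    · rw [Matrix.add_mulVec, hA.2.1 x hx, hB.2.1 x hx, add_zero]
    · rw [Matrix.add_mulVec]; exact Submodule.add_mem _ (hA.2.2 x) (hB.2.2 x)
  | smul c A _ hA =>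
    refine ⟨P.spC_smul c hA.1, fun x hx => ?_, fun x => ?_⟩
    · rw [Matrix.smul_mulVec, hA.2.1 x hx, smul_zero]
    · rw [Matrix.smul_mulVec]; exact Submodule.smul_mem _ _ (hA.2.2 x)

/-- Every member of a nilpotent orbit satisfies the conditions of a typed limiting mixed Hodge
structure, with the same filtrations on the graded pieces. -/
lemma IsTypedCone.typedLMHS_of_mem (hσ : P.IsTypedCone e σ) {F₀ : Filt ι}
    (hF₀ : P.GeneratesOrbit σ F₀) (hF : F ∈ expOrbit σ F₀) (hN : N ∈ relInt σ) :
    P.TypedLMHS e N F ∧ ∀ p, delOne N F p = delOne N F₀ p := by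
  obtain ⟨M, hM, rfl⟩ := hF
  obtain ⟨h1, h2, h3⟩ := hσ.span_mulVec hF₀ hN hM
  have h := hσ.typedLMHS hF₀ hN
  have hsq : M * M = 0 := by
    apply ext_mulVec
    intro x
    rw [← Matrix.mulVec_mulVec, h2 _ (h.range_le_ker (h3 x)), Matrix.zero_mulVec]
  rw [exp_eq_one_add hsq]
  exact ⟨h.twist h1 h2 h3, fun p => h.toLMHS.delOne_twist h1 h2 h3 p⟩

end PolData

namespace PolData

variable {P : PolData ι} {N : Matrix ι ι ℝ} {F : Filt ι} {e : ℤ}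

/-! ### The grading operator of Deligne's splitting -/

/-- `Y` acts on `I^{p,q}` as multiplication by `p + q + 1`. -/
structure IsGrading (N : Matrix ι ι ℝ) (F : Filt ι) (Y : Matrix ι ι ℂ) : Prop where
  zero : ∀ p, ∀ x ∈ delZero N F p, Y *ᵥ x = x
  one : ∀ p, ∀ x ∈ delOne N F p, Y *ᵥ x = 0
  two : ∀ x ∈ rangeC N, Y *ᵥ x = -x

/-- Two linear maps that agree on each member of a family of subspaces agree on its sum. -/
lemma mulVec_eq_of_mem_iSup {κ : Type*} {V : κ → Submodule ℂ (ι → ℂ)} {A B : Matrix ι ι ℂ}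
    (h : ∀ p, ∀ x ∈ V p, A *ᵥ x = B *ᵥ x) {x : ι → ℂ} (hx : x ∈ ⨆ p, V p) :
    A *ᵥ x = B *ᵥ x := by
  have : (⨆ p, V p) ≤ LinearMap.eqLocus A.mulVecLin B.mulVecLin :=
    iSup_le fun p x hx => h p x hx
  exact this hx

namespace LMHS

variable (h : P.LMHS N F)
include h

lemma exists_add_add (x : ι → ℂ) : ∃ i a u, i ∈ ⨆ p, delZero N F p ∧ a ∈ ⨆ p, delOne N F p ∧
    u ∈ rangeC N ∧ x = i + a + u := by
  have hx : x ∈ (⨆ p, delZero N F p) ⊔ kerC N := by rw [h.iSup_delZero_sup_ker]; trivial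
  obtain ⟨i, hi, k, hk, rfl⟩ := Submodule.mem_sup.1 hx
  rw [← h.iSup_delOne_sup_range] at hk
  obtain ⟨a, ha, u, hu, rfl⟩ := Submodule.mem_sup.1 hk
  exact ⟨i, a, u, hi, ha, hu, by abel⟩

/-- A matrix is determined by its values on Deligne's subspaces. -/
lemma matrix_ext {A B : Matrix ι ι ℂ} (h0 : ∀ p, ∀ x ∈ delZero N F p, A *ᵥ x = B *ᵥ x)
    (h1 : ∀ p, ∀ x ∈ delOne N F p, A *ᵥ x = B *ᵥ x) (h2 : ∀ x ∈ rangeC N, A *ᵥ x = B *ᵥ x) :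
    A = B := by
  apply ext_mulVec
  intro x
  obtain ⟨i, a, u, hi, ha, hu, rfl⟩ := h.exists_add_add x
  simp only [Matrix.mulVec_add, mulVec_eq_of_mem_iSup h0 hi, mulVec_eq_of_mem_iSup h1 ha, h2 u hu]

lemma grading_unique {Y Y' : Matrix ι ι ℂ} (hY : IsGrading N F Y) (hY' : IsGrading N F Y') :
    Y = Y' :=
  h.matrix_ext (fun p x hx => by rw [hY.zero p x hx, hY'.zero p x hx])
    (fun p x hx => by rw [hY.one p x hx, hY'.one p x hx])
    (fun x hx => by rw [hY.two x hx, hY'.two x hx])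

lemma pairing_iSup_delZero {x y : ι → ℂ} (hx : x ∈ ⨆ p, delZero N F p)
    (hy : y ∈ ⨆ p, delZero N F p) : P.pairing x y = 0 := by
  suffices h' : (⨆ p, delZero N F p) ≤ P.orth (⨆ p, delZero N F p) from
    P.mem_orth.1 (h' hy) x hx
  refine iSup_le fun q y hy => ?_
  suffices h' : (⨆ p, delZero N F p) ≤ P.orth (delZero N F q) by
    rw [mem_orth]
    intro x hx
    rw [pairing_swap, P.mem_orth.1 (h' hx) y hy, neg_zero]
  refine iSup_le fun p x hx => ?_
  rw [mem_orth]
  exact fun y hy => h.pairing_delZero_delZero hy hx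

lemma pairing_iSup_delOne {x y : ι → ℂ} (hx : x ∈ ⨆ p, delZero N F p)
    (hy : y ∈ ⨆ p, delOne N F p) : P.pairing x y = 0 := by
  suffices h' : (⨆ p, delOne N F p) ≤ P.orth (⨆ p, delZero N F p) from
    P.mem_orth.1 (h' hy) x hx
  refine iSup_le fun q y hy => ?_
  suffices h' : (⨆ p, delZero N F p) ≤ P.orth (delOne N F q) by
    rw [mem_orth]
    intro x hx
    rw [pairing_swap, P.mem_orth.1 (h' hx) y hy, neg_zero]
  refine iSup_le fun p x hx => ?_
  rw [mem_orth]
  intro y hy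
  rw [pairing_swap, h.pairing_delZero_delOne hx hy, neg_zero]

lemma iSup_delOne_le_ker : (⨆ p, delOne N F p) ≤ kerC N := iSup_le fun _ => inf_le_right

end LMHS

namespace IsGrading

variable {Y : Matrix ι ι ℂ} (hY : IsGrading N F Y)
include hY

lemma iSup_zero {x : ι → ℂ} (hx : x ∈ ⨆ p, delZero N F p) : Y *ᵥ x = x := by
  have := mulVec_eq_of_mem_iSup (A := Y) (B := 1)
    (fun p x hx => by rw [hY.zero p x hx, Matrix.one_mulVec]) hx
  rwa [Matrix.one_mulVec] at this

lemma iSup_one {x : ι → ℂ} (hx : x ∈ ⨆ p, delOne N F p) : Y *ᵥ x = 0 := by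
  have := mulVec_eq_of_mem_iSup (A := Y) (B := 0)
    (fun p x hx => by rw [hY.one p x hx, Matrix.zero_mulVec]) hx
  rwa [Matrix.zero_mulVec] at this

/-- The orthogonality relations between Deligne's subspaces put the grading operator in the
symplectic Lie algebra. -/
lemma mem_spC (h : P.LMHS N F) : Y ∈ P.spC := by
  rw [PolData.mem_spC]
  intro x y
  obtain ⟨i, a, u, hi, ha, hu, rfl⟩ := h.exists_add_add x
  obtain ⟨j, b, v, hj, hb, hv, rfl⟩ := h.exists_add_add y
  have hak := h.iSup_delOne_le_ker ha
  have hbk := h.iSup_delOne_le_ker hb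
  simp only [Matrix.mulVec_add, hY.iSup_zero hi, hY.iSup_one ha, hY.two u hu, hY.iSup_zero hj,
    hY.iSup_one hb, hY.two v hv, pairing_add_left, pairing_add_right, pairing_neg_left,
    pairing_neg_right, pairing_zero_left, pairing_zero_right, h.pairing_iSup_delZero hi hj,
    h.pairing_iSup_delOne hi hb, pairing_rangeC_kerC h.lie hu hbk,
    pairing_rangeC_kerC h.lie hu (h.range_le_ker hv), pairing_kerC_rangeC h.lie hak hv,
    P.pairing_swap j a, h.pairing_iSup_delOne hj ha]
  ring

end IsGrading

lemma star_iSup_delOne {x : ι → ℂ} (hx : x ∈ ⨆ p, delOne N F p) :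
    star x ∈ ⨆ p, delOne N F p := by
  have h1 : conjSub (⨆ p, delOne N F p) = ⨆ p, delOne N F p := by
    rw [conjSub_iSup]
    simp only [conjSub_delOne]
    exact (Equiv.subLeft (-1 : ℤ)).iSup_congr fun p => rfl
  have : x ∈ conjSub (⨆ p, delOne N F p) := by rw [h1]; exact hx
  exact this

lemma TypedLMHS.exists_grading (h : P.TypedLMHS e N F) : ∃ Y, IsGrading N F Y := by
  have hc1 : IsCompl (⨆ p, delZero N F p) (kerC N) :=
    ⟨Submodule.disjoint_def.2 fun _ => h.delZero_disjoint_ker,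
      codisjoint_iff.2 h.iSup_delZero_sup_ker⟩
  have hc2 : IsCompl (rangeC N) ((⨆ p, delZero N F p) ⊔ ⨆ p, delOne N F p) := by
    constructor
    · rw [Submodule.disjoint_def]
      intro x hx hx'
      obtain ⟨i, hi, a, ha, rfl⟩ := Submodule.mem_sup.1 hx'
      have hi0 : i = 0 := by
        refine h.delZero_disjoint_ker hi ?_
        have := Submodule.sub_mem _ (h.range_le_ker hx) (h.iSup_delOne_le_ker ha)
        rwa [add_sub_cancel_right] at this
      rw [hi0, zero_add] at hx ⊢
      exact h.delOne_disjoint_range ha hx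
    · rw [codisjoint_iff, eq_top_iff]
      intro x _
      obtain ⟨i, a, u, hi, ha, hu, rfl⟩ := h.exists_add_add x
      rw [add_comm]
      exact Submodule.add_mem_sup hu (Submodule.add_mem_sup hi ha)
  refine ⟨LinearMap.toMatrix' (Submodule.projection _ _ hc1 - Submodule.projection _ _ hc2),
    fun p x hx => ?_, fun p x hx => ?_, fun x hx => ?_⟩
  · have hx' := Submodule.mem_iSup_of_mem p hx
    rw [LinearMap.toMatrix'_mulVec, LinearMap.sub_apply,
      Submodule.projection_apply_of_mem_left hc1 hx',
      Submodule.projection_apply_of_mem_right hc2 (Submodule.mem_sup_left hx'), sub_zero]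
  · have hx' := Submodule.mem_iSup_of_mem p hx
    rw [LinearMap.toMatrix'_mulVec, LinearMap.sub_apply,
      Submodule.projection_apply_of_mem_right hc1 hx.2,
      Submodule.projection_apply_of_mem_right hc2 (Submodule.mem_sup_right hx'), sub_zero]
  · rw [LinearMap.toMatrix'_mulVec, LinearMap.sub_apply,
      Submodule.projection_apply_of_mem_right hc1 (h.range_le_ker hx),
      Submodule.projection_apply_of_mem_left hc2 hx, zero_sub]

/-! ### The twist to an `ℝ`-split structure -/

/-- The real elements of type `(-1,-1)` in `𝔤`. As there are only three weights, they map
`W_0` to `W_{-2}` and kill `W_{-1}`. -/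
structure IsTypeDelta (P : PolData ι) (N : Matrix ι ι ℝ) (F : Filt ι) (δ : Matrix ι ι ℝ) :
    Prop where
  lie : δ ∈ P.lieG
  ker : ∀ x ∈ kerC N, matC δ *ᵥ x = 0
  type : ∀ p, ∀ x ∈ delZero N F p, matC δ *ᵥ x ∈ deligne N F (p - 1) (-p - 1)

lemma mem_deligne_neg_two {p : ℤ} {x : ι → ℂ} :
    x ∈ deligne N F (p - 1) (-p - 1) ↔ x ∈ F (p - 1) ∧ star x ∈ F (-p - 1) ∧ x ∈ rangeC N := by
  rw [deligne_neg_two N F (by ring), Submodule.mem_inf, Submodule.mem_inf, mem_conjSub, and_assoc]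

lemma LMHS.isTypeDelta_of_isDelta (h : P.LMHS N F) {δ : Matrix ι ι ℝ} (hδ : P.IsDelta N F δ) :
    P.IsTypeDelta N F δ := by
  have hlow : ∀ p q, p + q ≤ -1 → ∀ x ∈ deligne N F p q, matC δ *ᵥ x = 0 := by
    intro p q hpq x hx
    have h1 := hδ.2.1 p q (mulVec_mem_actV hx)
    rw [← Submodule.mem_bot ℂ]
    refine (iSup_le fun r => iSup_le fun s => iSup_le fun hrs => ?_ :
      (⨆ r : ℤ, ⨆ s : ℤ, ⨆ _ : r < p ∧ s < q, deligne N F r s) ≤ ⊥) h1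
    rw [deligne_of_le N F (by omega)]
  refine ⟨hδ.1, fun x hx => ?_, fun p x hx => ?_⟩
  · rw [← h.iSup_delOne_sup_range, ← h.iSup_deligne_neg_two] at hx
    obtain ⟨a, ha, u, hu, rfl⟩ := Submodule.mem_sup.1 hx
    have h1 := mulVec_eq_of_mem_iSup (A := matC δ) (B := 0) (fun p x hx => by
      rw [Matrix.zero_mulVec]
      refine hlow p (-1 - p) (by omega) x ?_
      rw [deligne_neg_one N F (by omega)]; exact hx) ha
    have h2 := mulVec_eq_of_mem_iSup (A := matC δ) (B := 0) (fun p x hx => by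
      rw [Matrix.zero_mulVec]
      exact hlow p (-2 - p) (by omega) x hx) hu
    rw [Matrix.mulVec_add, h1, h2, Matrix.zero_mulVec, Matrix.zero_mulVec, add_zero]
  · have h1 := hδ.2.1 p (-p) (mulVec_mem_actV hx)
    refine (iSup_le fun r => iSup_le fun s => iSup_le fun hrs => ?_ :
      (⨆ r : ℤ, ⨆ s : ℤ, ⨆ _ : r < p ∧ s < -p, deligne N F r s) ≤ _) h1
    by_cases hr : r + s = -2
    · have hr' : r = p - 1 := by omega
      have hs' : s = -p - 1 := by omega
      rw [hr', hs']
    · rw [deligne_of_le N F (by omega)]; exact bot_le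

namespace IsTypeDelta

variable {δ : Matrix ι ι ℝ} (hδ : P.IsTypeDelta N F δ)
include hδ

lemma mulVec_mem_range (h : P.LMHS N F) (x : ι → ℂ) : matC δ *ᵥ x ∈ rangeC N := by
  have hx : x ∈ (⨆ p, delZero N F p) ⊔ kerC N := by rw [h.iSup_delZero_sup_ker]; trivial
  obtain ⟨i, hi, k, hk, rfl⟩ := Submodule.mem_sup.1 hx
  rw [Matrix.mulVec_add, hδ.ker k hk, add_zero]
  have : (⨆ p, delZero N F p) ≤ (rangeC N).comap (matC δ).mulVecLin :=
    iSup_le fun p x hx => (mem_deligne_neg_two.1 (hδ.type p x hx)).2.2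
  exact this hi

lemma mulVec_mem (h : P.LMHS N F) {p : ℤ} {x : ι → ℂ} (hx : x ∈ F p) :
    matC δ *ᵥ x ∈ F (p - 1) := by
  obtain ⟨b, hb⟩ := exists_bot h.dual
  refine filt_le_of_step (F := F) (G := fun p => (F (p - 1)).comap (matC δ).mulVecLin)
    (fun p q hpq => Submodule.comap_mono (h.dual.1 (by omega))) hb (fun p x hx => ?_) p hx
  obtain ⟨a, c, k, ha, hc, -, hk, rfl⟩ := h.step hx
  rw [add_assoc]
  refine Submodule.add_mem_sup ha ?_
  change matC δ *ᵥ (c + k) ∈ F (p - 1)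
  rw [Matrix.mulVec_add, hδ.ker k hk, add_zero]
  exact (mem_deligne_neg_two.1 (hδ.type p c hc)).1

/-- The matrix `-iδ` that is exponentiated. -/
lemma exponent_props (h : P.LMHS N F) :
    -(Complex.I • matC δ) ∈ P.spC ∧ (∀ x ∈ kerC N, (-(Complex.I • matC δ)) *ᵥ x = 0) ∧
      (∀ x, (-(Complex.I • matC δ)) *ᵥ x ∈ rangeC N) ∧
      NormedSpace.exp (-(Complex.I • matC δ)) = 1 + -(Complex.I • matC δ) := by
  have h1 : ∀ x ∈ kerC N, (-(Complex.I • matC δ)) *ᵥ x = 0 := by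
    intro x hx
    rw [Matrix.neg_mulVec, Matrix.smul_mulVec, hδ.ker x hx, smul_zero, neg_zero]
  have h2 : ∀ x, (-(Complex.I • matC δ)) *ᵥ x ∈ rangeC N := by
    intro x
    rw [Matrix.neg_mulVec, Matrix.smul_mulVec]
    exact Submodule.neg_mem _ (Submodule.smul_mem _ _ (hδ.mulVec_mem_range h x))
  refine ⟨?_, h1, h2, ?_⟩
  · rw [← neg_smul]
    exact P.spC_smul _ (P.matC_mem_spC.2 hδ.lie)
  · apply exp_eq_one_add
    apply ext_mulVec
    intro x
    rw [← Matrix.mulVec_mulVec, h1 _ (h.range_le_ker (h2 x)), Matrix.zero_mulVec]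

lemma mem_delZero_twist (h : P.LMHS N F) {p : ℤ} {x : ι → ℂ} (hx : x ∈ delZero N F p) :
    x - Complex.I • (matC δ *ᵥ x) ∈ delZero N (actF (1 + -(Complex.I • matC δ)) F) p := by
  obtain ⟨hM, hMk, hMr, -⟩ := hδ.exponent_props h
  have hfix := (h.twist hM hMk hMr).2
  obtain ⟨h1, a, ha, u, hu, hu', hxa⟩ := mem_delZero.1 hx
  have hg : ∀ y, (1 + -(Complex.I • matC δ)) *ᵥ y = y - Complex.I • (matC δ *ᵥ y) := by
    intro y
    rw [Matrix.add_mulVec, Matrix.one_mulVec, Matrix.neg_mulVec, Matrix.smul_mulVec,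
      sub_eq_add_neg]
  have hda := hδ.mulVec_mem h ha
  have hdr := hδ.mulVec_mem_range h a
  have hur : u + (2 * Complex.I) • (matC δ *ᵥ a) ∈ rangeC N :=
    Submodule.add_mem _ hu' (Submodule.smul_mem _ _ hdr)
  refine mem_delZero.2 ⟨mem_actV.2 ⟨x, h1, hg x⟩, a - Complex.I • (matC δ *ᵥ a),
    mem_actV.2 ⟨a, ha, hg a⟩, u + (2 * Complex.I) • (matC δ *ᵥ a),
    (hfix _ _ (h.range_le_ker hur)).2 (Submodule.add_mem _ hu (Submodule.smul_mem _ _ hda)),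
    hur, ?_⟩
  have hI : star Complex.I = -Complex.I := Complex.conj_I
  have hdx : matC δ *ᵥ x = matC δ *ᵥ star a := by
    rw [hxa, Matrix.mulVec_add, hδ.ker _ (star_mem_kerC (h.range_le_ker hu')), add_zero]
  have h2 : star (2 : ℂ) = 2 := Complex.conj_ofNat 2
  rw [hdx, hxa, star_sub, star_add, star_smul, star_smul, star_mul, hI, h2, star_matC_mulVec]
  module

/-- The grading operator of `exp(-iδ) F` is `exp(-iδ) Y exp(iδ) = Y - 2iδ`. -/
lemma grading_twist (h : P.LMHS N F) {Y Y' : Matrix ι ι ℂ} (hY : IsGrading N F Y)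
    (hY' : IsGrading N (actF (1 + -(Complex.I • matC δ)) F) Y') :
    Y' = Y - (2 * Complex.I) • matC δ := by
  obtain ⟨hM, hMk, hMr, -⟩ := hδ.exponent_props h
  have hfix := (h.twist hM hMk hMr).2
  refine h.matrix_ext (fun p x hx => ?_) (fun p x hx => ?_) (fun x hx => ?_)
  · have h1 := hY'.zero p _ (hδ.mem_delZero_twist h hx)
    rw [Matrix.mulVec_sub, Matrix.mulVec_smul, hY'.two _ (hδ.mulVec_mem_range h x)] at h1
    rw [Matrix.sub_mulVec, hY.zero p x hx, Matrix.smul_mulVec]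
    have h2 : Y' *ᵥ x = (Y' *ᵥ x - Complex.I • -(matC δ *ᵥ x)) - Complex.I • (matC δ *ᵥ x) := by
      module
    rw [h2, h1]
    module
  · rw [Matrix.sub_mulVec, hY.one p x hx, Matrix.smul_mulVec, hδ.ker x hx.2, smul_zero, sub_zero]
    exact hY'.one p x ⟨⟨(hfix _ _ hx.2).2 hx.1.1, (hfix _ _ (star_mem_kerC hx.2)).2 hx.1.2⟩, hx.2⟩
  · rw [Matrix.sub_mulVec, hY.two x hx, Matrix.smul_mulVec, hδ.ker x (h.range_le_ker hx),
      smul_zero, sub_zero]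
    exact hY'.two x hx

end IsTypeDelta

/-- All `I^{p,-p}` and `I^{-p,p}` are conjugate. -/
def IsSplit (N : Matrix ι ι ℝ) (F : Filt ι) : Prop :=
  ∀ p, ∀ x ∈ delZero N F p, star x ∈ delZero N F (-p)

lemma isSplit_of_conjSub_eq (hs : ∀ p q, conjSub (deligne N F p q) = deligne N F q p) :
    IsSplit N F := by
  intro p x hx
  have h1 : star x ∈ conjSub (deligne N F p (-p)) := by
    rw [mem_conjSub, star_star]; exact hx
  rw [hs] at h1
  have : delZero N F (-p) = deligne N F (-p) p := by rw [delZero, neg_neg]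
  rwa [this]

lemma LMHS.conjSub_deligne (h : P.LMHS N F) (hs : IsSplit N F) (p q : ℤ) :
    conjSub (deligne N F p q) = deligne N F q p := by
  have key : ∀ p q, deligne N F p q ≤ conjSub (deligne N F q p) := by
    intro p q x hx
    rw [mem_conjSub]
    rcases le_or_gt 1 (p + q) with h1 | h1
    · rw [h.deligne_eq_bot h1, Submodule.mem_bot] at hx
      rw [hx, star_zero]; exact Submodule.zero_mem _
    rcases eq_or_lt_of_le (show p + q ≤ 0 by omega) with h2 | h2
    · have hq : q = -p := by omega
      subst hq
      have := hs p x hx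
      rwa [delZero, neg_neg] at this
    rcases eq_or_lt_of_le (show p + q ≤ -1 by omega) with h3 | h3
    · have hq : q = -1 - p := by omega
      rw [deligne_neg_one N F h3] at hx
      rw [deligne_neg_one N F (by omega), hq]
      exact ⟨star_mem_hodge hx.1, star_mem_kerC hx.2⟩
    rcases eq_or_lt_of_le (show p + q ≤ -2 by omega) with h4 | h4
    · rw [deligne_neg_two N F h4] at hx
      rw [deligne_neg_two N F (by omega)]
      exact ⟨⟨hx.1.2, by simpa [mem_conjSub] using hx.1.1⟩, star_mem_rangeC hx.2⟩
    · rw [deligne_of_le N F (by omega), Submodule.mem_bot] at hx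
      rw [hx, star_zero]; exact Submodule.zero_mem _
  refine le_antisymm ?_ (key q p)
  have := conjSub_mono (key p q)
  rwa [conjSub_conjSub] at this

/-- If the splitting is defined over `ℝ`, so is the grading operator. -/
lemma LMHS.grading_map_star (h : P.LMHS N F) (hs : IsSplit N F) {Y : Matrix ι ι ℂ}
    (hY : IsGrading N F Y) : Y.map star = Y := by
  have hm : ∀ x, Y.map star *ᵥ x = star (Y *ᵥ star x) := by
    intro x; rw [star_mulVec', star_star]
  refine h.grading_unique ⟨fun p x hx => ?_, fun p x hx => ?_, fun x hx => ?_⟩ hY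
  · rw [hm, hY.zero _ _ (hs p x hx), star_star]
  · have : star x ∈ delOne N F (-1 - p) := by
      rw [← conjSub_delOne, mem_conjSub, star_star]; exact hx
    rw [hm, hY.one _ _ this, star_zero]
  · rw [hm, hY.two _ (star_mem_rangeC hx), star_neg, star_star]

/-- Conversely, `star x = w + b` with `b ∈ I^{-p-1,p-1}`, and a real `Y` forces `b = 0`. -/
lemma LMHS.isSplit_of_map_star (h : P.LMHS N F) {Y : Matrix ι ι ℂ} (hY : IsGrading N F Y)
    (hr : Y.map star = Y) : IsSplit N F := by
  intro p x hx
  obtain ⟨w, b, hw, -, -, hb, hs⟩ := h.star_delZero hx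
  have h1 : Y *ᵥ star x = star x := by
    have h2 := star_mulVec' Y x
    rw [hr, hY.zero p x hx] at h2
    exact h2.symm
  rw [hs, Matrix.mulVec_add, hY.zero _ w hw, hY.two b hb, add_right_inj] at h1
  have hb0 : b = 0 := by
    have := neg_eq_iff_add_eq_zero.1 h1
    rw [← two_smul ℂ b] at this
    exact (smul_eq_zero.1 this).resolve_left two_ne_zero
  rw [hs, hb0, add_zero]
  exact hw

/-- `δ` is half the imaginary part of the grading operator. -/
lemma TypedLMHS.exists_typeDelta (h : P.TypedLMHS e N F) {Y : Matrix ι ι ℂ}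
    (hY : IsGrading N F Y) : ∃ δ, P.IsTypeDelta N F δ ∧
      (4 * Complex.I) • matC δ = Y - Y.map star := by
  have hI : star Complex.I = -Complex.I := Complex.conj_I
  have hI0 := Complex.I_ne_zero
  set c : ℂ := (4 * Complex.I)⁻¹ with hc
  have hcs : star c = -c := by
    have h4 : star (4 : ℂ) = 4 := Complex.conj_ofNat 4
    rw [hc, star_inv₀, star_mul, hI, h4, neg_mul, inv_neg, mul_comm]
  obtain ⟨δ, hδ⟩ := exists_matC_of_map_star (A := c • (Y - Y.map star)) (by
    ext i j
    have h1 : star (star (Y i j)) = Y i j := star_star _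
    simp only [Matrix.map_apply, Matrix.smul_apply, Matrix.sub_apply, smul_eq_mul, star_mul',
      star_sub, hcs, h1]
    ring)
  have hm : ∀ x, Y.map star *ᵥ x = star (Y *ᵥ star x) := by
    intro x; rw [star_mulVec', star_star]
  have hx : ∀ x, matC δ *ᵥ x = c • (Y *ᵥ x - star (Y *ᵥ star x)) := by
    intro x
    rw [hδ, Matrix.smul_mulVec, Matrix.sub_mulVec, hm]
  refine ⟨δ, ⟨?_, fun x hxk => ?_, fun p x hxp => ?_⟩, ?_⟩
  · rw [← matC_mem_spC, hδ]
    have hYs := hY.mem_spC h.toLMHS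
    have hYn := P.spC_smul (-1) (P.spC_map_star hYs)
    have := P.spC_smul c (P.spC_add hYs hYn)
    rwa [neg_one_smul, ← sub_eq_add_neg] at this
  · rw [← h.iSup_delOne_sup_range] at hxk
    obtain ⟨a, ha, u, hu, rfl⟩ := Submodule.mem_sup.1 hxk
    rw [hx, star_add, Matrix.mulVec_add, Matrix.mulVec_add, hY.iSup_one ha,
      hY.iSup_one (star_iSup_delOne ha), hY.two u hu, hY.two _ (star_mem_rangeC hu), zero_add,
      zero_add, star_neg, star_star, sub_self, smul_zero]
  · obtain ⟨w, b, hw, hb1, hb2, hb, hs⟩ := h.star_delZero hxp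
    have hxs : x = star w + star b := by rw [← star_add, ← hs, star_star]
    have h2 : matC δ *ᵥ x = (2 * c) • star b := by
      rw [hx, hY.zero p x hxp, hs, Matrix.mulVec_add, hY.zero _ w hw, hY.two b hb, star_add,
        star_neg, hxs]
      module
    rw [h2]
    refine Submodule.smul_mem _ _ (mem_deligne_neg_two.2 ⟨hb2, ?_, star_mem_rangeC hb⟩)
    rw [star_star]; exact hb1
  · rw [hδ, smul_smul, hc, mul_inv_cancel₀ (mul_ne_zero (by norm_num) hI0), one_smul]

/-- Existence and uniqueness of `δ`. -/
lemma TypedLMHS.existsUnique_isDelta (h : P.TypedLMHS e N F) : ∃! δ, P.IsDelta N F δ := by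
  obtain ⟨Y, hY⟩ := h.exists_grading
  obtain ⟨δ, hδ, hδY⟩ := h.exists_typeDelta hY
  obtain ⟨hM, hMk, hMr, hexp⟩ := hδ.exponent_props h.toLMHS
  have hI : star Complex.I = -Complex.I := Complex.conj_I
  have h2s : star (2 : ℂ) = 2 := Complex.conj_ofNat 2
  have hms : ∀ (A : Matrix ι ι ℂ) (d : Matrix ι ι ℝ), (A - (2 * Complex.I) • matC d).map star =
      A.map star + (2 * Complex.I) • matC d := by
    intro A d
    ext i j
    have h1 : star (matC d i j) = matC d i j := congrFun (congrFun (matC_map_star d) i) j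
    simp only [Matrix.map_apply, Matrix.sub_apply, Matrix.smul_apply, smul_eq_mul, star_sub,
      star_mul', hI, h2s, Matrix.add_apply, h1]
    ring
  refine ⟨δ, ⟨hδ.lie, fun p q => ?_, ?_⟩, ?_⟩
  · rw [actV_le]
    intro x hx
    have hzero : matC δ *ᵥ x = 0 → matC δ *ᵥ x ∈ ⨆ r : ℤ, ⨆ s : ℤ, ⨆ _ : r < p ∧ s < q,
        deligne N F r s := fun h0 => by rw [h0]; exact Submodule.zero_mem _
    rcases le_or_gt 1 (p + q) with h1 | h1
    · rw [h.deligne_eq_bot h1, Submodule.mem_bot] at hx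
      exact hzero (by rw [hx, Matrix.mulVec_zero])
    rcases eq_or_lt_of_le (show p + q ≤ 0 by omega) with h2 | h2
    · have hq : q = -p := by omega
      subst hq
      have h3 := hδ.type p x hx
      refine Submodule.mem_iSup_of_mem (p - 1) (Submodule.mem_iSup_of_mem (-p - 1) ?_)
      rw [iSup_pos (by omega)]
      exact h3
    refine hzero (hδ.ker x ?_)
    rcases eq_or_lt_of_le (show p + q ≤ -1 by omega) with h3 | h3
    · rw [deligne_neg_one N F h3] at hx; exact hx.2
    rcases eq_or_lt_of_le (show p + q ≤ -2 by omega) with h4 | h4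
    · rw [deligne_neg_two N F h4] at hx; exact h.range_le_ker hx.2
    · rw [deligne_of_le N F (by omega), Submodule.mem_bot] at hx
      rw [hx]; exact Submodule.zero_mem _
  · rw [hexp]
    have h' := h.twist hM hMk hMr
    obtain ⟨Y', hY'⟩ := h'.exists_grading
    have h1 := hδ.grading_twist h.toLMHS hY hY'
    refine h'.toLMHS.conjSub_deligne (h'.toLMHS.isSplit_of_map_star hY' ?_)
    have h4 : (2 * Complex.I) • matC δ + (2 * Complex.I) • matC δ = Y - Y.map star := by
      rw [← hδY, ← add_smul]; congr 1; ring
    rw [h1, hms, eq_sub_iff_add_eq, add_assoc, h4]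
    abel
  · intro d hd
    have hdt := h.toLMHS.isTypeDelta_of_isDelta hd
    obtain ⟨hM, hMk, hMr, hexp⟩ := hdt.exponent_props h.toLMHS
    have h' := h.twist hM hMk hMr
    obtain ⟨Y', hY'⟩ := h'.exists_grading
    have hs := hd.2.2
    rw [hexp] at hs
    have hreal := h'.toLMHS.grading_map_star (isSplit_of_conjSub_eq hs) hY'
    rw [hdt.grading_twist h.toLMHS hY hY', hms] at hreal
    have h4 : (4 * Complex.I) • matC d = Y - Y.map star := by
      rw [eq_sub_iff_add_eq] at hreal ⊢
      refine Eq.trans ?_ hreal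
      module
    rw [← hδY] at h4
    apply matC_injective
    exact smul_right_injective _ (mul_ne_zero (by norm_num) Complex.I_ne_zero) h4

end PolData

namespace PolData

variable {P : PolData ι} {N : Matrix ι ι ℝ} {F : Filt ι} {e : ℤ}

/-! ### The `sl₂`-triple of an `ℝ`-split structure -/

lemma star_iSup_delZero (hs : IsSplit N F) {x : ι → ℂ} (hx : x ∈ ⨆ p, delZero N F p) :
    star x ∈ ⨆ p, delZero N F p := by
  have h : (⨆ p, delZero N F p) ≤ conjSub (⨆ p, delZero N F p) :=
    iSup_le fun p x hx => Submodule.mem_iSup_of_mem (-p) (hs p x hx)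
  exact h hx

lemma conjSub_iSup_delZero (hs : IsSplit N F) :
    conjSub (⨆ p, delZero N F p) = ⨆ p, delZero N F p := by
  ext x
  rw [mem_conjSub]
  exact ⟨fun h => by simpa using star_iSup_delZero hs h, star_iSup_delZero hs⟩

lemma LMHS.exists_mem_iSup_mulVec_eq (h : P.LMHS N F) {u : ι → ℂ} (hu : u ∈ rangeC N) :
    ∃ v ∈ ⨆ p, delZero N F p, matC N *ᵥ v = u := by
  obtain ⟨x, rfl⟩ := mem_rangeC.1 hu
  have hx : x ∈ (⨆ p, delZero N F p) ⊔ kerC N := by rw [h.iSup_delZero_sup_ker]; trivial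
  obtain ⟨i, hi, k, hk, rfl⟩ := Submodule.mem_sup.1 hx
  exact ⟨i, hi, by rw [Matrix.mulVec_add, mem_kerC.1 hk, add_zero]⟩

lemma IsSl2.isGrading {H Np : Matrix ι ι ℝ} (hsl : P.IsSl2 N F H Np) (h : P.LMHS N F) :
    IsGrading N F (matC H) := by
  refine ⟨fun p x hx => ?_, fun p x hx => ?_, fun x hx => ?_⟩
  · have := hsl.2.2.1 p (-p) x hx
    rwa [show ((p : ℂ) + ((-p : ℤ) : ℂ) + 1) = 1 by push_cast; ring, one_smul] at this
  · have := hsl.2.2.1 p (-1 - p) x (by rw [deligne_neg_one N F (by omega)]; exact hx)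
    rwa [show ((p : ℂ) + ((-1 - p : ℤ) : ℂ) + 1) = 0 by push_cast; ring, zero_smul] at this
  · rw [← h.iSup_deligne_neg_two] at hx
    have := mulVec_eq_of_mem_iSup (A := matC H) (B := -1) (fun p x hx => by
      have := hsl.2.2.1 p (-2 - p) x hx
      rwa [show ((p : ℂ) + ((-2 - p : ℤ) : ℂ) + 1) = -1 by push_cast; ring, neg_one_smul,
        ← Matrix.one_mulVec x, ← Matrix.neg_mulVec, Matrix.one_mulVec] at this) hx
    rwa [Matrix.neg_mulVec, Matrix.one_mulVec] at this

/-- The weights of `H` are `1, 0, -1`. -/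
lemma IsGrading.cube (h : P.LMHS N F) {Y : Matrix ι ι ℂ} (hY : IsGrading N F Y) (x : ι → ℂ) :
    Y *ᵥ (Y *ᵥ (Y *ᵥ x)) = Y *ᵥ x := by
  obtain ⟨i, a, u, hi, ha, hu, rfl⟩ := h.exists_add_add x
  simp only [Matrix.mulVec_add, hY.iSup_zero hi, hY.iSup_one ha, hY.two u hu, Matrix.mulVec_neg,
    neg_neg, Matrix.mulVec_zero]

lemma IsGrading.eq_zero (h : P.LMHS N F) {Y : Matrix ι ι ℂ} (hY : IsGrading N F Y) {c : ℂ}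
    (hc : c ^ 3 ≠ c) {x : ι → ℂ} (hx : Y *ᵥ x = c • x) : x = 0 := by
  have h1 := hY.cube h x
  simp only [hx, Matrix.mulVec_smul, smul_smul] at h1
  rw [← sub_eq_zero, ← sub_smul] at h1
  refine (smul_eq_zero.1 h1).resolve_left (sub_ne_zero.2 ?_)
  rwa [show c * c * c = c ^ 3 by ring]

namespace IsSl2

variable {H Np : Matrix ι ι ℝ} (hsl : P.IsSl2 N F H Np) (h : P.LMHS N F)
include hsl

lemma mulVec_H_Np (x : ι → ℂ) :
    matC H *ᵥ (matC Np *ᵥ x) = matC Np *ᵥ (matC H *ᵥ x) + (2 : ℂ) • (matC Np *ᵥ x) := by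
  have h1 : H * Np = Np * H + (2 : ℝ) • Np := by
    rw [two_smul, ← two_nsmul, ← hsl.2.2.2.2.1]; abel
  rw [Matrix.mulVec_mulVec, ← matC_mul, h1, matC_add, matC_smul, matC_mul, Matrix.add_mulVec,
    Matrix.smul_mulVec, Matrix.mulVec_mulVec]
  norm_cast

include h

lemma mulVec_iSup_delZero {x : ι → ℂ} (hx : x ∈ ⨆ p, delZero N F p) : matC Np *ᵥ x = 0 := by
  have hY := hsl.isGrading h
  refine hY.eq_zero h (c := 3) (by norm_num) ?_
  rw [hsl.mulVec_H_Np, hY.iSup_zero hx]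
  module

lemma mulVec_iSup_delOne {x : ι → ℂ} (hx : x ∈ ⨆ p, delOne N F p) : matC Np *ᵥ x = 0 := by
  have hY := hsl.isGrading h
  refine hY.eq_zero h (c := 2) (by norm_num) ?_
  rw [hsl.mulVec_H_Np, hY.iSup_one hx, Matrix.mulVec_zero, zero_add]

lemma mulVec_mulVec {x : ι → ℂ} (hx : x ∈ ⨆ p, delZero N F p) :
    matC Np *ᵥ (matC N *ᵥ x) = x := by
  have h1 : Np * N = H + N * Np := by rw [← hsl.2.2.2.2.2]; abel
  rw [Matrix.mulVec_mulVec, ← matC_mul, h1, matC_add, matC_mul, Matrix.add_mulVec,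
    ← Matrix.mulVec_mulVec, hsl.mulVec_iSup_delZero h hx, Matrix.mulVec_zero, add_zero,
    (hsl.isGrading h).iSup_zero hx]

end IsSl2

lemma LMHS.isSl2_unique (h : P.LMHS N F) {H Np H' Np' : Matrix ι ι ℝ}
    (h1 : P.IsSl2 N F H Np) (h2 : P.IsSl2 N F H' Np') : H = H' ∧ Np = Np' := by
  refine ⟨matC_injective (h.grading_unique (h1.isGrading h) (h2.isGrading h)),
    matC_injective (h.matrix_ext (fun p x hx => ?_) (fun p x hx => ?_) (fun x hx => ?_))⟩
  · have hx' := Submodule.mem_iSup_of_mem p hx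
    rw [h1.mulVec_iSup_delZero h hx', h2.mulVec_iSup_delZero h hx']
  · have hx' := Submodule.mem_iSup_of_mem p hx
    rw [h1.mulVec_iSup_delOne h hx', h2.mulVec_iSup_delOne h hx']
  · obtain ⟨v, hv, rfl⟩ := h.exists_mem_iSup_mulVec_eq hx
    rw [h1.mulVec_mulVec h hv, h2.mulVec_mulVec h hv]

lemma exists_mul_mul_eq (N : Matrix ι ι ℝ) : ∃ M : Matrix ι ι ℝ, N * M * N = N := by
  obtain ⟨s, hs⟩ := N.mulVecLin.rangeRestrict.exists_rightInverse_of_surjective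
    (LinearMap.range_rangeRestrict _)
  obtain ⟨g, hg⟩ := LinearMap.exists_extend s
  refine ⟨LinearMap.toMatrix' g, Matrix.mulVec_injective (funext fun x => ?_)⟩
  have h1 : g (N *ᵥ x) = s (N.mulVecLin.rangeRestrict x) :=
    LinearMap.congr_fun hg (N.mulVecLin.rangeRestrict x)
  have h2 := congrArg Subtype.val (LinearMap.congr_fun hs (N.mulVecLin.rangeRestrict x))
  change N *ᵥ s (N.mulVecLin.rangeRestrict x) = N *ᵥ x at h2
  rw [← Matrix.mulVec_mulVec, ← Matrix.mulVec_mulVec, LinearMap.toMatrix'_mulVec, h1, h2]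

/-- With `M` a real pseudo-inverse of `N`, the raising operator is `π₁ M π₋₁`, where
`π_{±1} = (H^2 ± H)/2` are the projections to the weight spaces of `H`. -/
lemma TypedLMHS.exists_isSl2 (h : P.TypedLMHS e N F) (hs : IsSplit N F) :
    ∃ H Np, P.IsSl2 N F H Np := by
  obtain ⟨Y, hY⟩ := h.exists_grading
  obtain ⟨H, rfl⟩ := exists_matC_of_map_star (h.toLMHS.grading_map_star hs hY)
  obtain ⟨M, hM⟩ := exists_mul_mul_eq N
  set A : Matrix ι ι ℝ := (1 / 2 : ℝ) • (H * H + H) with hA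
  set B : Matrix ι ι ℝ := (1 / 2 : ℝ) • (H * H - H) with hB
  have hAx : ∀ i a u, i ∈ ⨆ p, delZero N F p → a ∈ ⨆ p, delOne N F p → u ∈ rangeC N →
      matC A *ᵥ (i + a + u) = i := by
    intro i a u hi ha hu
    simp only [hA, matC_smul, matC_add, matC_mul, Matrix.smul_mulVec, Matrix.add_mulVec,
      ← Matrix.mulVec_mulVec, Matrix.mulVec_add, hY.iSup_zero hi, hY.iSup_one ha, hY.two u hu,
      Matrix.mulVec_neg, Matrix.mulVec_zero]
    push_cast
    module
  have hBx : ∀ i a u, i ∈ ⨆ p, delZero N F p → a ∈ ⨆ p, delOne N F p → u ∈ rangeC N →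
      matC B *ᵥ (i + a + u) = u := by
    intro i a u hi ha hu
    simp only [hB, matC_smul, matC_sub, matC_mul, Matrix.smul_mulVec, Matrix.sub_mulVec,
      ← Matrix.mulVec_mulVec, Matrix.mulVec_add, hY.iSup_zero hi, hY.iSup_one ha, hY.two u hu,
      Matrix.mulVec_neg, Matrix.mulVec_zero]
    push_cast
    module
  have hAI : ∀ x, matC A *ᵥ x ∈ ⨆ p, delZero N F p := by
    intro x
    obtain ⟨i, a, u, hi, ha, hu, rfl⟩ := h.exists_add_add x
    rwa [hAx i a u hi ha hu]
  have hBU : ∀ x, matC B *ᵥ x ∈ rangeC N := by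
    intro x
    obtain ⟨i, a, u, hi, ha, hu, rfl⟩ := h.exists_add_add x
    rwa [hBx i a u hi ha hu]
  have hAk : ∀ x ∈ kerC N, matC A *ᵥ x = 0 := by
    intro x hx
    rw [← h.iSup_delOne_sup_range] at hx
    obtain ⟨a, ha, u, hu, rfl⟩ := Submodule.mem_sup.1 hx
    have := hAx 0 a u (Submodule.zero_mem _) ha hu
    rwa [zero_add] at this
  have hBu : ∀ x ∈ rangeC N, matC B *ᵥ x = x := by
    intro x hx
    have := hBx 0 0 x (Submodule.zero_mem _) (Submodule.zero_mem _) hx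
    rwa [zero_add, zero_add] at this
  have hNMN : ∀ x, matC N *ᵥ (matC M *ᵥ (matC N *ᵥ x)) = matC N *ᵥ x := by
    intro x
    rw [Matrix.mulVec_mulVec, Matrix.mulVec_mulVec, ← matC_mul, ← matC_mul, hM]
  have hNA : ∀ x, matC N *ᵥ (matC A *ᵥ x) = matC N *ᵥ x := by
    intro x
    obtain ⟨i, a, u, hi, ha, hu, rfl⟩ := h.exists_add_add x
    rw [hAx i a u hi ha hu, Matrix.mulVec_add, Matrix.mulVec_add, mem_kerC.1 (h.range_le_ker hu),
      mem_kerC.1 (h.iSup_delOne_le_ker ha), add_zero, add_zero]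
  have hp : ∀ x, matC (A * M * B) *ᵥ x = matC A *ᵥ (matC M *ᵥ (matC B *ᵥ x)) := by
    intro x
    rw [matC_mul, matC_mul, Matrix.mulVec_mulVec, Matrix.mulVec_mulVec, mul_assoc]
  -- `N⁺ N = π₁` and `N N⁺ = π₋₁`
  have hpN : ∀ x, matC (A * M * B) *ᵥ (matC N *ᵥ x) = matC A *ᵥ x := by
    intro x
    rw [hp, hBu _ (mulVec_mem_rangeC N x), ← sub_eq_zero, ← Matrix.mulVec_sub]
    apply hAk
    rw [mem_kerC, Matrix.mulVec_sub, hNMN, sub_self]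
  have hNp : ∀ x, matC N *ᵥ (matC (A * M * B) *ᵥ x) = matC B *ᵥ x := by
    intro x
    rw [hp, hNA]
    obtain ⟨y, hy⟩ := mem_rangeC.1 (hBU x)
    rw [← hy, hNMN]
  have hpair : ∀ i ∈ ⨆ p, delZero N F p, ∀ y, P.pairing i (matC B *ᵥ y) = P.pairing i y := by
    intro i hi y
    obtain ⟨j, b, v, hj, hb, hv, rfl⟩ := h.exists_add_add y
    rw [hBx j b v hj hb hv, pairing_add_right, pairing_add_right,
      h.pairing_iSup_delZero hi hj, h.pairing_iSup_delOne hi hb, zero_add, zero_add]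
  refine ⟨H, A * M * B, P.matC_mem_spC.1 (hY.mem_spC h.toLMHS), ?_, ?_, ?_, ?_, ?_⟩
  · rw [← matC_mem_spC, mem_spC]
    intro x y
    have hI : ∀ z, matC (A * M * B) *ᵥ z ∈ ⨆ p, delZero N F p := fun z => by
      rw [hp]; exact hAI _
    rw [← hpair _ (hI x) y, ← hNp y, ← neg_neg (P.pairing (matC (A * M * B) *ᵥ x) _),
      ← pairing_matC_mulVec h.lie, hNp x, pairing_swap, neg_neg, hpair _ (hI y) x, pairing_swap]
  · intro p q v hv
    rcases le_or_gt 1 (p + q) with h1 | h1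
    · rw [h.deligne_eq_bot h1, Submodule.mem_bot] at hv
      rw [hv, Matrix.mulVec_zero, smul_zero]
    rcases eq_or_lt_of_le (show p + q ≤ 0 by omega) with h2 | h2
    · have hq : q = -p := by omega
      subst hq
      rw [hY.zero p v hv, show ((p : ℂ) + ((-p : ℤ) : ℂ) + 1) = 1 by push_cast; ring, one_smul]
    rcases eq_or_lt_of_le (show p + q ≤ -1 by omega) with h3 | h3
    · rw [deligne_neg_one N F h3] at hv
      rw [hY.one p v hv]
      have : ((p : ℂ) + (q : ℂ) + 1) = 0 := by
        have : ((p + q + 1 : ℤ) : ℂ) = 0 := by rw [show p + q + 1 = 0 by omega]; simp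
        exact_mod_cast this
      rw [this, zero_smul]
    rcases eq_or_lt_of_le (show p + q ≤ -2 by omega) with h4 | h4
    · rw [deligne_neg_two N F h4] at hv
      rw [hY.two v hv.2]
      have : ((p : ℂ) + (q : ℂ) + 1) = -1 := by
        have : ((p + q + 1 : ℤ) : ℂ) = -1 := by rw [show p + q + 1 = -1 by omega]; simp
        exact_mod_cast this
      rw [this, neg_one_smul]
    · rw [deligne_of_le N F (by omega), Submodule.mem_bot] at hv
      rw [hv, Matrix.mulVec_zero, smul_zero]
  · apply matC_injective
    rw [two_nsmul, ← two_smul ℝ N]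
    refine ext_mulVec fun x => ?_
    obtain ⟨i, a, u, hi, ha, hu, rfl⟩ := h.exists_add_add x
    rw [matC_sub, matC_mul, matC_mul, matC_neg, matC_smul, Matrix.sub_mulVec,
      ← Matrix.mulVec_mulVec, ← Matrix.mulVec_mulVec, hY.two _ (mulVec_mem_rangeC N _)]
    simp only [Matrix.neg_mulVec, Matrix.smul_mulVec, Matrix.mulVec_add, hY.iSup_zero hi,
      hY.iSup_one ha, hY.two u hu, Matrix.mulVec_neg, mem_kerC.1 (h.range_le_ker hu),
      mem_kerC.1 (h.iSup_delOne_le_ker ha), Matrix.mulVec_zero]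
    push_cast
    module
  · have h1 : H * (A * M * B) = A * M * B := by
      apply matC_injective
      refine ext_mulVec fun x => ?_
      rw [matC_mul, ← Matrix.mulVec_mulVec, hp, hY.iSup_zero (hAI _)]
    have h2 : A * M * B * H = -(A * M * B) := by
      apply matC_injective
      refine ext_mulVec fun x => ?_
      have h3 : matC B *ᵥ (matC H *ᵥ x) = -(matC B *ᵥ x) := by
        obtain ⟨i, a, u, hi, ha, hu, rfl⟩ := h.exists_add_add x
        rw [hBx i a u hi ha hu, Matrix.mulVec_add (matC H), Matrix.mulVec_add (matC H),
          hY.iSup_zero hi, hY.iSup_one ha, hY.two u hu, hBx i 0 (-u) hi (Submodule.zero_mem _)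
          (Submodule.neg_mem _ hu)]
      rw [matC_mul (A * M * B) H, ← Matrix.mulVec_mulVec, hp, h3, matC_neg, Matrix.neg_mulVec, hp,
        Matrix.mulVec_neg, Matrix.mulVec_neg]
    rw [h1, h2, two_nsmul, sub_neg_eq_add]
  · apply matC_injective
    refine ext_mulVec fun x => ?_
    rw [matC_sub, matC_mul (A * M * B) N, matC_mul N (A * M * B), Matrix.sub_mulVec,
      ← Matrix.mulVec_mulVec, ← Matrix.mulVec_mulVec, hpN, hNp]
    obtain ⟨i, a, u, hi, ha, hu, rfl⟩ := h.exists_add_add x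
    rw [hAx i a u hi ha hu, hBx i a u hi ha hu, Matrix.mulVec_add, Matrix.mulVec_add,
      hY.iSup_zero hi, hY.iSup_one ha, hY.two u hu, add_zero, sub_eq_add_neg]

/-! ### The Cayley element -/

section Cayley

variable {H Np : Matrix ι ι ℝ} (hsl : P.IsSl2 N F H Np) (h : P.LMHS N F)

lemma cayleyX_mulVec (x : ι → ℂ) : cayleyX N H Np *ᵥ x = (1 / 2 : ℂ) •
    (Complex.I • (matC N *ᵥ x) - matC H *ᵥ x + Complex.I • (matC Np *ᵥ x)) := by
  simp only [cayleyX, Matrix.smul_mulVec, Matrix.add_mulVec, Matrix.sub_mulVec]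

include hsl

lemma cayleyX_mem_spC (h : P.LMHS N F) : cayleyX N H Np ∈ P.spC := by
  have h1 := P.spC_smul Complex.I (P.matC_mem_spC.2 h.lie)
  have h2 := P.spC_smul (-1) (P.matC_mem_spC.2 hsl.1)
  have h3 := P.spC_smul Complex.I (P.matC_mem_spC.2 hsl.2.1)
  have := P.spC_smul (1 / 2) (P.spC_add (P.spC_add h1 h2) h3)
  rwa [neg_one_smul, ← sub_eq_add_neg] at this

include h

lemma cayleyX_delZero {x : ι → ℂ} (hx : x ∈ ⨆ p, delZero N F p) :
    cayleyX N H Np *ᵥ x = (1 / 2 : ℂ) • (Complex.I • (matC N *ᵥ x) - x) := by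
  rw [cayleyX_mulVec, hsl.mulVec_iSup_delZero h hx, (hsl.isGrading h).iSup_zero hx, smul_zero,
    add_zero]

lemma cayleyX_delOne {x : ι → ℂ} (hx : x ∈ ⨆ p, delOne N F p) :
    cayleyX N H Np *ᵥ x = 0 := by
  rw [cayleyX_mulVec, hsl.mulVec_iSup_delOne h hx, (hsl.isGrading h).iSup_one hx,
    mem_kerC.1 (h.iSup_delOne_le_ker hx)]
  simp

lemma cayleyX_range {x : ι → ℂ} (hx : x ∈ ⨆ p, delZero N F p) :
    cayleyX N H Np *ᵥ (matC N *ᵥ x) = (1 / 2 : ℂ) • (matC N *ᵥ x + Complex.I • x) := by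
  rw [cayleyX_mulVec, h.mulVec_mulVec, hsl.mulVec_mulVec h hx,
    (hsl.isGrading h).two _ (mulVec_mem_rangeC N x), smul_zero, zero_sub, neg_neg]

/-- `X` has rank at most one on each copy of the standard representation. -/
lemma cayleyX_sq : cayleyX N H Np * cayleyX N H Np = 0 := by
  have hI := Complex.I_mul_I
  have key : ∀ x ∈ ⨆ p, delZero N F p, Complex.I • (cayleyX N H Np *ᵥ (matC N *ᵥ x)) =
      cayleyX N H Np *ᵥ x := by
    intro x hx
    rw [cayleyX_range hsl h hx, cayleyX_delZero hsl h hx, smul_comm, smul_add, smul_smul, hI,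
      neg_one_smul, ← sub_eq_add_neg]
  refine h.matrix_ext (fun p x hx => ?_) (fun p x hx => ?_) (fun x hx => ?_)
  · have hx' := Submodule.mem_iSup_of_mem p hx
    rw [← Matrix.mulVec_mulVec, cayleyX_delZero hsl h hx', Matrix.mulVec_smul, Matrix.mulVec_sub,
      Matrix.mulVec_smul, key x hx', sub_self, smul_zero, Matrix.zero_mulVec]
  · rw [← Matrix.mulVec_mulVec, cayleyX_delOne hsl h (Submodule.mem_iSup_of_mem p hx),
      Matrix.mulVec_zero, Matrix.zero_mulVec]
  · obtain ⟨v, hv, rfl⟩ := h.exists_mem_iSup_mulVec_eq hx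
    rw [← Matrix.mulVec_mulVec, cayleyX_range hsl h hv, Matrix.mulVec_smul, Matrix.mulVec_add,
      Matrix.mulVec_smul, ← key v hv, smul_smul, hI, neg_one_smul, add_neg_cancel, smul_zero,
      Matrix.zero_mulVec]

end Cayley

end PolData

namespace PolData

variable {P : PolData ι} {N : Matrix ι ι ℝ} {F : Filt ι} {e : ℤ}

/-! ### The pair of subspaces of the boundary cycle and of its neighbours -/

/-- The subspace spanned by the `I^{p,-p-1}` with `p ≡ e` modulo `2` and the vectors
`s v + i t N v`, for `v` in the sum of the `I^{p,-p}`. -/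
def tilt (e : ℤ) (N : Matrix ι ι ℝ) (F : Filt ι) (s t : ℝ) : Submodule ℂ (ι → ℂ) :=
  delPart e N F ⊔ actV ((s : ℂ) • 1 + (Complex.I * t) • matC N) (⨆ p, delZero N F p)

lemma tilt_mulVec (s t : ℝ) (v : ι → ℂ) : ((s : ℂ) • 1 + (Complex.I * t) • matC N) *ᵥ v =
    (s : ℂ) • v + (Complex.I * t) • (matC N *ᵥ v) := by
  rw [Matrix.add_mulVec, Matrix.smul_mulVec, Matrix.smul_mulVec, Matrix.one_mulVec]

lemma mem_tilt {s t : ℝ} {x : ι → ℂ} : x ∈ tilt e N F s t ↔ ∃ a ∈ delPart e N F,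
    ∃ v ∈ ⨆ p, delZero N F p, x = a + ((s : ℂ) • v + (Complex.I * t) • (matC N *ᵥ v)) := by
  rw [tilt, Submodule.mem_sup]
  constructor
  · rintro ⟨a, ha, w, hw, rfl⟩
    obtain ⟨v, hv, rfl⟩ := mem_actV.1 hw
    exact ⟨a, ha, v, hv, by rw [tilt_mulVec]⟩
  · rintro ⟨a, ha, v, hv, rfl⟩
    exact ⟨a, ha, _, mulVec_mem_actV hv, by rw [tilt_mulVec]⟩

lemma delPart_le_iSup : delPart e N F ≤ ⨆ p, delOne N F p := iSup₂_le fun p _ => le_iSup _ p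

lemma conjSub_tilt (hs : IsSplit N F) (s t : ℝ) :
    conjSub (tilt e N F s t) = tilt (e + 1) N F s (-t) := by
  have hI : star Complex.I = -Complex.I := Complex.conj_I
  have hr : ∀ r : ℝ, star (r : ℂ) = r := Complex.conj_ofReal
  have : ((s : ℂ) • (1 : Matrix ι ι ℂ) + (Complex.I * t) • matC N).map star =
      (s : ℂ) • 1 + (Complex.I * (-t : ℝ)) • matC N := by
    apply ext_mulVec
    intro x
    rw [← star_star x, ← star_mulVec', tilt_mulVec, tilt_mulVec, star_add, star_smul, star_smul,
      star_mul, hI, hr, hr, star_matC_mulVec]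
    push_cast
    module
  rw [tilt, conjSub_sup, conjSub_delPart, conjSub_actV, conjSub_iSup_delZero hs, this, tilt]

/-- In the limit `s = 0` the tilted subspace contains the image of `N`. -/
lemma LMHS.tilt_zero (h : P.LMHS N F) {t : ℝ} (ht : t ≠ 0) :
    tilt e N F 0 t = delPart e N F ⊔ rangeC N := by
  rw [tilt]
  congr 1
  have hc : Complex.I * (t : ℂ) ≠ 0 := mul_ne_zero Complex.I_ne_zero (by exact_mod_cast ht)
  ext x
  rw [mem_actV]
  constructor
  · rintro ⟨v, -, rfl⟩
    rw [tilt_mulVec, Complex.ofReal_zero, zero_smul, zero_add]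
    exact Submodule.smul_mem _ _ (mulVec_mem_rangeC N v)
  · intro hx
    obtain ⟨v, hv, rfl⟩ := h.exists_mem_iSup_mulVec_eq hx
    refine ⟨(Complex.I * (t : ℂ))⁻¹ • v, Submodule.smul_mem _ _ hv, ?_⟩
    rw [tilt_mulVec, Complex.ofReal_zero, zero_smul, zero_add, Matrix.mulVec_smul, smul_smul,
      mul_inv_cancel₀ hc, one_smul]

lemma TypedLMHS.pairing_pos (h : P.TypedLMHS e N F) {v : ι → ℂ} (hv : v ∈ ⨆ p, delZero N F p)
    (h0 : v ≠ 0) : 0 < sgn e * (P.pairing v (matC N *ᵥ star v)).re := by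
  have hsgn : sgn e ≠ 0 := fun hs => by have := sgn_mul_self e; simp [hs] at this
  refine lt_of_le_of_ne (h.semidef v) fun heq => h0 ?_
  exact h.delZero_disjoint_ker hv (h.mem_kerC_of_pairing
    ((mul_eq_zero.1 heq.symm).resolve_left hsgn))

/-- The hermitian form takes the value `2st ⟨v, N conj v⟩` at `s v + i t N v`. -/
lemma TypedLMHS.tilt_pos (h : P.TypedLMHS e N F) (hs : IsSplit N F) {e' : ℤ} {s t : ℝ}
    (hst : 0 < sgn e' * sgn e * (s * t)) {x : ι → ℂ} (hx : x ∈ tilt e' N F s t) (h0 : x ≠ 0) :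
    0 < sgn e' * (P.herm x x).re := by
  obtain ⟨a, ha, v, hv, rfl⟩ := mem_tilt.1 hx
  have hI : star Complex.I = -Complex.I := Complex.conj_I
  have hI2 := Complex.I_mul_I
  have hr : ∀ r : ℝ, star (r : ℂ) = r := Complex.conj_ofReal
  have ha' := delPart_le_iSup ha
  have hsv := star_iSup_delZero hs hv
  have hcross : P.herm a ((s : ℂ) • v + (Complex.I * t) • (matC N *ᵥ v)) = 0 := by
    rw [herm, star_add, star_smul, star_smul, star_matC_mulVec, pairing_add_right,
      pairing_smul_right, pairing_smul_right, P.pairing_swap (star v) a,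
      h.pairing_iSup_delOne hsv ha',
      pairing_kerC_rangeC h.lie (h.iSup_delOne_le_ker ha') (mulVec_mem_rangeC N _)]
    ring
  have hself : P.herm ((s : ℂ) • v + (Complex.I * t) • (matC N *ᵥ v))
      ((s : ℂ) • v + (Complex.I * t) • (matC N *ᵥ v)) =
      ((2 * (s * t) : ℝ) : ℂ) * P.pairing v (matC N *ᵥ star v) := by
    rw [herm, star_add, star_smul, star_smul, star_mul, star_matC_mulVec, hI, hr, hr,
      pairing_add_left, pairing_add_right, pairing_add_right, pairing_smul_left, pairing_smul_left,
      pairing_smul_left, pairing_smul_left, pairing_smul_right, pairing_smul_right,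
      pairing_smul_right, pairing_smul_right, h.pairing_iSup_delZero hv hsv,
      pairing_matC_mulVec h.lie, pairing_matC_mulVec h.lie, h.mulVec_mulVec, pairing_zero_right]
    push_cast
    linear_combination (-2 * s * t * P.pairing v (matC N *ᵥ star v)) * hI2
  rw [herm_add_left, P.herm_add_right a a, hcross, P.herm_add_right _ a,
    P.herm_eq_zero_comm.1 hcross, add_zero, zero_add, hself, Complex.add_re, Complex.re_ofReal_mul]
  have hA : 0 ≤ sgn e' * (P.herm a a).re := by
    by_cases ha0 : a = 0
    · simp [ha0, herm_zero_left]
    · exact (h.delPart_pos ha ha0).le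
  have hee := sgn_mul_self e
  have hV : sgn e' * (2 * (s * t) * (P.pairing v (matC N *ᵥ star v)).re) =
      2 * (sgn e' * sgn e * (s * t)) * (sgn e * (P.pairing v (matC N *ᵥ star v)).re) := by
    linear_combination (-2 * sgn e' * s * t * (P.pairing v (matC N *ᵥ star v)).re) * hee
  rw [mul_add, hV]
  by_cases hv0 : v = 0
  · have ha0 : a ≠ 0 := by rintro rfl; simp [hv0] at h0
    have := h.delPart_pos ha ha0
    rw [hv0, pairing_zero_left]
    simpa using this
  · have := mul_pos (mul_pos two_pos hst) (h.pairing_pos hv hv0)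
    linarith

/-! ### The point `F₀ = exp(iN) F̂` -/

lemma I_smul_matC_mem_GC (h : P.LMHS N F) : 1 + Complex.I • matC N ∈ P.GC := by
  refine P.one_add_mem_GC (P.spC_smul _ (P.matC_mem_spC.2 h.lie)) ?_
  rw [smul_mul_smul_comm, ← matC_mul, h.sq, matC_zero, smul_zero]

/-- A vector `N v`, `v ∈ I^{p+1,-p-1}`, is congruent to a multiple of `v - iNv` modulo
`v + iNv ∈ F_0^{p+1}`. -/
lemma TypedLMHS.gradedBy_tilt (h : P.TypedLMHS e N F) :
    GradedBy e (actF (1 + Complex.I • matC N) F) (tilt e N F 1 1) (tilt (e + 1) N F 1 (-1)) := by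
  have hg : ∀ x, (1 + Complex.I • matC N) *ᵥ x = x + Complex.I • (matC N *ᵥ x) := by
    intro x
    rw [Matrix.add_mulVec, Matrix.one_mulVec, Matrix.smul_mulVec]
  have hgk : ∀ x ∈ kerC N, (1 + Complex.I • matC N) *ᵥ x = x := by
    intro x hx
    rw [hg, mem_kerC.1 hx, smul_zero, add_zero]
  have hmem : ∀ {p x}, x ∈ F p → (1 + Complex.I • matC N) *ᵥ x ∈
      actF (1 + Complex.I • matC N) F p := fun hx => mulVec_mem_actV hx
  have hnot : ∀ {p : ℤ}, Even (p + e) → ¬ Even (p + 1 + e) := by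
    rintro p ⟨r, hr⟩ ⟨s, hs⟩; omega
  intro p
  constructor
  · intro hp x hx
    obtain ⟨y, hy, rfl⟩ := mem_actV.1 hx
    obtain ⟨a, b, k, ha, hb, hk, hk', rfl⟩ := h.step hy
    obtain ⟨a', b', u, ha', -, hb', hu, hu', rfl⟩ := h.ker_step hk hk'
    obtain ⟨a'', b'', ha'', -, hb'', hs'', hr'', rfl⟩ := h.range_step hu hu'
    have h0 : b'' = 0 := by
      refine h.parity (p + 1) (hnot hp) b'' (by rwa [add_sub_cancel_right]) ?_ hr''
      rwa [show -(p + 1) - 1 = -2 - p by ring]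
    subst h0
    rw [show a + b + (a' + b' + (a'' + 0)) = (a + a' + a'') + (b + b') by abel, Matrix.mulVec_add]
    refine Submodule.add_mem_sup
      (hmem (Submodule.add_mem _ (Submodule.add_mem _ ha ha') ha''))
      ⟨hmem (Submodule.add_mem _ (mem_delZero.1 hb).1 hb'.1.1), ?_⟩
    refine mem_tilt.2 ⟨b', Submodule.mem_iSup_of_mem p (Submodule.mem_iSup_of_mem hp hb'), b,
      Submodule.mem_iSup_of_mem p hb, ?_⟩
    rw [Matrix.mulVec_add, hgk _ hb'.2, hg]
    simp only [Complex.ofReal_one, one_smul, mul_one]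
    abel
  · intro hp x hx
    have hp' : ¬ Even (p + e) := by
      rintro ⟨r, hr⟩; obtain ⟨s, hs⟩ := hp; omega
    obtain ⟨y, hy, rfl⟩ := mem_actV.1 hx
    obtain ⟨a, b, k, ha, hb, hk, hk', rfl⟩ := h.step hy
    obtain ⟨a', b', u, ha', -, hb', hu, hu', rfl⟩ := h.ker_step hk hk'
    rw [h.delZero_eq_bot hp', Submodule.mem_bot] at hb
    subst hb
    have hu2 : u ∈ F (p + 1 - 1) := by rwa [add_sub_cancel_right]
    obtain ⟨v, hv, rfl⟩ := h.exists_mulVec_eq hu2 hu'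
    obtain ⟨c, d, m, hc, hd, -, hm, rfl⟩ := h.step hv
    have hcN : matC N *ᵥ c ∈ F (p + 1) := by
      have := h.hor _ c hc
      rwa [add_sub_cancel_right] at this
    have hd1 := (mem_delZero.1 hd).1
    have hdN : matC N *ᵥ d ∈ F p := by
      have := h.hor _ d hd1
      rwa [add_sub_cancel_right] at this
    have hdF : d ∈ F p := h.dual.1 (by omega) hd1
    have hI := Complex.I_mul_I
    have hsplit : a + 0 + (a' + b' + matC N *ᵥ (c + d + m)) =
        (a + a' + matC N *ᵥ c + (-(Complex.I / 2)) • d) +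
          (b' + (Complex.I / 2) • (d - (2 * Complex.I) • (matC N *ᵥ d))) := by
      rw [Matrix.mulVec_add, Matrix.mulVec_add, mem_kerC.1 hm, smul_sub, smul_smul,
        show Complex.I / 2 * (2 * Complex.I) = -1 by linear_combination hI]
      module
    rw [hsplit, Matrix.mulVec_add]
    refine Submodule.add_mem_sup (hmem ?_) ⟨hmem ?_, ?_⟩
    · exact Submodule.add_mem _ (Submodule.add_mem _ (Submodule.add_mem _ ha ha') hcN)
        (Submodule.smul_mem _ _ hd1)
    · exact Submodule.add_mem _ hb'.1.1 (Submodule.smul_mem _ _ (Submodule.sub_mem _ hdF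
        (Submodule.smul_mem _ _ hdN)))
    · refine mem_tilt.2 ⟨b', Submodule.mem_iSup_of_mem p (Submodule.mem_iSup_of_mem hp hb'),
        (Complex.I / 2) • d, Submodule.smul_mem _ _ (Submodule.mem_iSup_of_mem (p + 1) hd), ?_⟩
      rw [Matrix.mulVec_add, hgk _ hb'.2, hg]
      simp only [Matrix.mulVec_smul, Matrix.mulVec_sub, h.mulVec_mulVec]
      push_cast
      module

lemma TypedLMHS.mem_periodDomain (h : P.TypedLMHS e N F) (hs : IsSplit N F) :
    actF (1 + Complex.I • matC N) F ∈ P.periodDomain ∧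
      part e (actF (1 + Complex.I • matC N) F) = tilt e N F 1 1 ∧
      part (e + 1) (actF (1 + Complex.I • matC N) F) = tilt (e + 1) N F 1 (-1) := by
  have hV : ∀ x ∈ tilt e N F 1 1, x ≠ 0 → 0 < sgn e * (P.herm x x).re := fun x hx h0 =>
    h.tilt_pos hs (by rw [sgn_mul_self]; norm_num) hx h0
  have hW : ∀ x ∈ tilt (e + 1) N F 1 (-1), x ≠ 0 → 0 < sgn (e + 1) * (P.herm x x).re :=
    fun x hx h0 => h.tilt_pos hs (by
      rw [sgn_add_one, neg_mul, sgn_mul_self]; norm_num) hx h0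
  have hD := h.gradedBy_tilt.mem_periodDomain
    (actF_mem_compactDual h.dual (I_smul_matC_mem_GC h.toLMHS)) hV hW
  exact ⟨hD, h.gradedBy_tilt.part_eq hD (fun x => eq_zero_of_pos_of_neg hV hW)
    (conjSub_tilt hs 1 1)⟩

/-- Without Hodge numbers `h^{p,-p-1}`, `p ≥ 0`, `p ≡ e`, there is no weight `0` part. -/
lemma TypedLMHS.iSup_delZero_eq_bot (h : P.TypedLMHS e N F) (hs : IsSplit N F)
    (hno : ¬ ∃ p : ℤ, 0 ≤ p ∧ Even (p + e) ∧ P.h p ≠ 0) : (⨆ p, delZero N F p) = ⊥ := by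
  have hpos : ∀ p : ℤ, 0 ≤ p → ∀ x ∈ delZero N F p, x = 0 := by
    intro p hp0 x hx
    by_cases hp : Even (p + e)
    · have hhp : P.h p = 0 := by
        by_contra hh; exact hno ⟨p, hp0, hp, hh⟩
      have h1 : x ∈ F (p + 1) := by
        rw [← eq_succ_of_h_eq_zero h.dual hhp]; exact (mem_delZero.1 hx).1
      refine h.eq_zero_of_mem_delZero hx (mem_kerC.2 ?_)
      have h2 := h.hor _ x h1
      exact h.eq_zero_of_mem_range (b := -p - 1) (by omega) h2
        (h.mulVec_mem_of_mem_delZero hx).2 (mulVec_mem_rangeC N x)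
    · rwa [h.delZero_eq_bot hp, Submodule.mem_bot] at hx
  refine le_bot_iff.1 (iSup_le fun p x hx => ?_)
  rw [Submodule.mem_bot]
  rcases le_total 0 p with hp | hp
  · exact hpos p hp x hx
  · exact star_eq_zero.1 (hpos (-p) (by omega) _ (hs p x hx))

/-- If `a + u` is real, with `a` of parity `e` and `u` in the image of `N`, then `a - conj a` is in
the image of `N`, although `a` and `conj a` have different parities; so `a = 0`. -/
lemma TypedLMHS.vecC_mem_delPart_sup_range (h : P.TypedLMHS e N F) {x : ι → ℝ} :
    vecC x ∈ delPart e N F ⊔ rangeC N ↔ x ∈ LinearMap.range N.mulVecLin := by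
  rw [← vecC_mem_rangeC]
  refine ⟨fun hx => ?_, fun hx => Submodule.mem_sup_right hx⟩
  obtain ⟨a, ha, u, hu, hau⟩ := Submodule.mem_sup.1 hx
  have hsa : -star a ∈ delPart (e + 1) N F := by
    rw [← conjSub_delPart]
    refine Submodule.neg_mem _ ?_
    rw [mem_conjSub, star_star]; exact ha
  have hr : a + -star a ∈ rangeC N := by
    have h1 : star (a + u) = a + u := by rw [hau, star_vecC]
    have h2 : a + -star a = star u - u := by
      rw [star_add] at h1
      have : a = star a + star u - u := by rw [h1]; abel
      nth_rw 1 [this]; abel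
    rw [h2]
    exact Submodule.sub_mem _ (star_mem_rangeC hu) hu
  have ha0 := h.eq_zero_of_delPart_add_mem_range ha hsa hr
  rw [← hau, ha0, zero_add]
  exact hu

/-! ### The translates of the cycle through `F₀` -/

lemma actV_congr {g g' : Matrix ι ι ℂ} {V : Submodule ℂ (ι → ℂ)}
    (h : ∀ x ∈ V, g *ᵥ x = g' *ᵥ x) : actV g V = actV g' V := by
  apply le_antisymm
  · exact actV_le.2 fun x hx => by rw [h x hx]; exact mulVec_mem_actV hx
  · exact actV_le.2 fun x hx => by rw [← h x hx]; exact mulVec_mem_actV hx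

lemma actV_eq_self {g : Matrix ι ι ℂ} {V : Submodule ℂ (ι → ℂ)}
    (h : ∀ x ∈ V, g *ᵥ x = x) : actV g V = V := by
  rw [actV_congr (g' := 1) (fun x hx => by rw [h x hx, Matrix.one_mulVec]), actV_one]

/-- Any positive bound on `t` would do; for `0 < t < 2` the elements `(1 - tX) exp(X)` map the cycle
through `F₀` into the period domain. -/
lemma one_mem_closure_of_forall {S : Set (Matrix ι ι ℂ)} (X : Matrix ι ι ℂ)
    (h : ∀ t : ℝ, 0 < t → t < 2 → 1 - (t : ℂ) • X ∈ S) : (1 : Matrix ι ι ℂ) ∈ closure S := by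
  have hc : Continuous fun t : ℝ => 1 - (t : ℂ) • X := by fun_prop
  have ht : Filter.Tendsto (fun t : ℝ => 1 - (t : ℂ) • X) (nhdsWithin 0 (Set.Ioi 0))
      (nhds 1) := by
    have := (hc.tendsto 0).mono_left (nhdsWithin_le_nhds (s := Set.Ioi 0))
    simpa using this
  refine mem_closure_of_tendsto ht ?_
  filter_upwards [Ioo_mem_nhdsGT (show (0 : ℝ) < 2 by norm_num)] with t ht
  exact h t ht.1 ht.2

section Boundary

variable {H Np : Matrix ι ι ℝ} (hsl : P.IsSl2 N F H Np) (h : P.TypedLMHS e N F)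
include hsl h

lemma one_add_smul_cayleyX_mem_GC (c : ℂ) : 1 + c • cayleyX N H Np ∈ P.GC :=
  P.one_add_mem_GC (P.spC_smul c (cayleyX_mem_spC hsl h.toLMHS))
    (by rw [smul_mul_smul_comm, cayleyX_sq hsl h.toLMHS, smul_zero])

lemma actV_cayleyX_delPart {e' : ℤ} (c : ℂ) :
    actV (1 + c • cayleyX N H Np) (delPart e' N F) = delPart e' N F := by
  refine actV_eq_self fun x hx => ?_
  rw [Matrix.add_mulVec, Matrix.one_mulVec, Matrix.smul_mulVec,
    cayleyX_delOne hsl h.toLMHS (delPart_le_iSup hx), smul_zero, add_zero]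

lemma actV_cayleyX_tilt {e' : ℤ} (c : ℝ) :
    actV (1 + (c : ℂ) • cayleyX N H Np) (tilt e' N F 1 1) = tilt e' N F (1 - c) (1 + c) := by
  rw [tilt, actV_sup, actV_cayleyX_delPart hsl h, tilt, ← actV_mul]
  congr 1
  refine actV_congr fun v hv => ?_
  have hI := Complex.I_mul_I
  rw [← Matrix.mulVec_mulVec, tilt_mulVec, tilt_mulVec, Matrix.add_mulVec, Matrix.one_mulVec,
    Matrix.smul_mulVec, Matrix.mulVec_add, Matrix.mulVec_smul, Matrix.mulVec_smul,
    cayleyX_delZero hsl h.toLMHS hv, cayleyX_range hsl h.toLMHS hv]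
  have : (Complex.I * ((1 : ℝ) : ℂ)) • (1 / 2 : ℂ) • (matC N *ᵥ v + Complex.I • v) =
      (1 / 2 : ℂ) • (Complex.I • (matC N *ᵥ v) - v) := by
    rw [Complex.ofReal_one, mul_one, smul_comm, smul_add, smul_smul Complex.I, hI, neg_one_smul,
      ← sub_eq_add_neg]
  rw [this]
  push_cast
  module

lemma actV_cayleyX_tilt_neg {e' : ℤ} (c : ℂ) :
    actV (1 + c • cayleyX N H Np) (tilt e' N F 1 (-1)) = tilt e' N F 1 (-1) := by
  refine actV_eq_self fun x hx => ?_
  obtain ⟨a, ha, v, hv, rfl⟩ := mem_tilt.1 hx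
  have hI := Complex.I_mul_I
  have h1 : cayleyX N H Np *ᵥ (a + (((1 : ℝ) : ℂ) • v +
      (Complex.I * ((-1 : ℝ) : ℂ)) • (matC N *ᵥ v))) = 0 := by
    rw [Matrix.mulVec_add, Matrix.mulVec_add, Matrix.mulVec_smul, Matrix.mulVec_smul,
      cayleyX_delOne hsl h.toLMHS (delPart_le_iSup ha), cayleyX_delZero hsl h.toLMHS hv,
      cayleyX_range hsl h.toLMHS hv, Complex.ofReal_one, one_smul, Complex.ofReal_neg,
      Complex.ofReal_one, mul_neg, mul_one, neg_smul, smul_comm Complex.I, smul_add Complex.I,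
      smul_smul Complex.I, hI, zero_add]
    module
  rw [Matrix.add_mulVec, Matrix.one_mulVec, Matrix.smul_mulVec, h1, smul_zero, add_zero]

lemma one_sub_smul_mul (t : ℂ) : (1 - t • cayleyX N H Np) * (1 + cayleyX N H Np) =
    1 + (1 - t) • cayleyX N H Np := by
  have h1 : (t • cayleyX N H Np) * cayleyX N H Np = 0 := by
    rw [smul_mul_assoc, cayleyX_sq hsl h.toLMHS, smul_zero]
  rw [sub_mul, mul_add, mul_add, h1, one_mul, one_mul, mul_one, add_zero, sub_smul, one_smul]
  abel

/-- The cycle through `F₀`, translated by `exp(X)`. -/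
lemma actS_exp_cayleyX : actS (NormedSpace.exp (cayleyX N H Np))
      (P.cycle (actF (NormedSpace.exp (Complex.I • matC N)) F)) =
    actS (1 + cayleyX N H Np) (P.cycle (actF (1 + Complex.I • matC N) F)) := by
  rw [exp_eq_one_add (cayleyX_sq hsl h.toLMHS), exp_smul_matC h.sq]

variable (hs : IsSplit N F)
include hs

/-- The translates by `(1 - tX) exp(X) = exp((1-t)X)` with `0 < t < 2` lie in the period domain. -/
lemma actS_cayleyX_mem_cycleSpaceClosure :
    actS (1 + cayleyX N H Np) (P.cycle (actF (1 + Complex.I • matC N) F)) ∈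
      P.cycleSpaceClosure := by
  obtain ⟨hD, hV, hW⟩ := h.mem_periodDomain hs
  have hG : 1 + cayleyX N H Np ∈ P.GC := by
    have := one_add_smul_cayleyX_mem_GC hsl h 1
    rwa [one_smul] at this
  refine ⟨⟨_, hG, _, hD, rfl⟩, one_mem_closure_of_forall (cayleyX N H Np) fun t ht0 ht2 => ?_⟩
  have hGt : 1 - (t : ℂ) • cayleyX N H Np ∈ P.GC := by
    have := one_add_smul_cayleyX_mem_GC hsl h (-t)
    rwa [neg_smul, ← sub_eq_add_neg] at this
  refine ⟨hGt, ?_⟩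
  rw [← actS_mul, one_sub_smul_mul hsl h]
  have hGt' := one_add_smul_cayleyX_mem_GC hsl h (1 - t)
  refine ⟨⟨_, hGt', _, hD, rfl⟩, actS_cycle_subset hD hGt' (e := e) ?_ ?_⟩
  · have h1 := actV_cayleyX_tilt hsl h (e' := e) (1 - t)
    push_cast at h1
    rw [hV, h1]
    intro x hx h0
    refine h.tilt_pos hs ?_ hx h0
    rw [sgn_mul_self]
    nlinarith
  · rw [hW, actV_cayleyX_tilt_neg hsl h]
    intro x hx h0
    refine h.tilt_pos hs ?_ hx h0
    rw [sgn_add_one, neg_mul, sgn_mul_self]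
    norm_num

/-- In the exceptional case the weight `0` part vanishes, and the value is the conjugate of a
subspace which the Cayley element fixes. -/
lemma parityProj_cayleyX_iff {V : Submodule ℂ (ι → ℂ)} :
    P.ParityProj e (actS (1 + cayleyX N H Np) (P.cycle (actF (1 + Complex.I • matC N) F))) V ↔
      V = delPart e N F ⊔ rangeC N := by
  obtain ⟨hD, hV, hW⟩ := h.mem_periodDomain hs
  have hG : 1 + cayleyX N H Np ∈ P.GC := by
    have := one_add_smul_cayleyX_mem_GC hsl h 1
    rwa [one_smul] at this
  by_cases hex : ∃ p : ℤ, 0 ≤ p ∧ Even (p + e) ∧ P.h p ≠ 0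
  · rw [parityProj_iff_of_exists hD hG hex, hV]
    have h1 := actV_cayleyX_tilt hsl h (e' := e) 1
    rw [Complex.ofReal_one, one_smul, sub_self, h.tilt_zero (by norm_num)] at h1
    rw [h1]
  · rw [parityProj_iff_of_not_exists hD hG hex, hW]
    have h1 := actV_cayleyX_tilt_neg hsl h (e' := e + 1) 1
    rw [one_smul] at h1
    have hbot := h.iSup_delZero_eq_bot hs hex
    have hr : rangeC N = ⊥ := by
      rw [eq_bot_iff]
      intro x hx
      obtain ⟨v, hv, rfl⟩ := h.exists_mem_iSup_mulVec_eq hx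
      rw [hbot, Submodule.mem_bot] at hv
      rw [hv, Matrix.mulVec_zero]; exact Submodule.zero_mem _
    rw [h1, conjSub_tilt hs, hr, tilt, hbot, delPart_congr (e := e + 1 + 1) (e' := e)
      (by use e + 1; ring)]
    simp [actV]

/-! ### The value in the boundary component -/

lemma delPart_sup_range_mem_lagrangians : delPart e N F ⊔ rangeC N ∈ P.lagrangians := by
  obtain ⟨hD, hV, -⟩ := h.mem_periodDomain hs
  have h1 := actV_cayleyX_tilt hsl h (e' := e) 1
  rw [sub_self, h.tilt_zero (by norm_num), ← hV] at h1
  rw [← h1]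
  exact actV_mem_lagrangians (part_mem_lagrangians hD e) (one_add_smul_cayleyX_mem_GC hsl h _)

lemma actV_sub_smul_cayleyX (t : ℝ) : 1 - (t : ℂ) • cayleyX N H Np ∈ P.GC ∧
    actV (1 - (t : ℂ) • cayleyX N H Np) (delPart e N F ⊔ rangeC N) = tilt e N F t (2 - t) := by
  constructor
  · have := one_add_smul_cayleyX_mem_GC hsl h (-t)
    rwa [neg_smul, ← sub_eq_add_neg] at this
  have h1 := actV_cayleyX_tilt hsl h (e' := e) 1
  rw [Complex.ofReal_one, one_smul, sub_self, h.tilt_zero (by norm_num)] at h1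
  have h2 := actV_cayleyX_tilt hsl h (e' := e) (1 - t)
  push_cast at h2
  rw [← h1, ← actV_mul, one_sub_smul_mul hsl h, h2]
  congr 1 <;> ring

end Boundary

/-- The translates of `S = delPart 0 N F ⊔ W_{-2}` by `1 - tX` are positive, so `S` is in the
closure of the Siegel space. -/
lemma TypedLMHS.mem_satake (h : P.TypedLMHS 0 N F) (hs : IsSplit N F) :
    delPart 0 N F ⊔ rangeC N ∈ P.satake (LinearMap.range N.mulVecLin) := by
  obtain ⟨H, Np, hsl⟩ := h.exists_isSl2 hs
  refine ⟨⟨delPart_sup_range_mem_lagrangians hsl h hs,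
    one_mem_closure_of_forall (cayleyX N H Np) fun t ht0 ht2 => ?_⟩,
    fun x => h.vecC_mem_delPart_sup_range⟩
  obtain ⟨hG, hV⟩ := actV_sub_smul_cayleyX hsl h hs t
  refine ⟨hG, actV_mem_lagrangians (delPart_sup_range_mem_lagrangians hsl h hs) hG, ?_⟩
  rw [hV]
  intro x hx h0
  have := h.tilt_pos hs (by rw [sgn_mul_self]; nlinarith) hx h0
  rwa [sgn, zpow_zero, one_mul] at this

lemma conjSub_mem_lagrangians {V : Submodule ℂ (ι → ℂ)} (hV : V ∈ P.lagrangians) :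
    conjSub V ∈ P.lagrangians := by
  refine ⟨by rw [finrank_conjSub, hV.1], fun x hx y hy => ?_⟩
  rw [← star_eq_zero, star_pairing]
  exact hV.2 _ hx _ hy

lemma TypedLMHS.mem_satakeConj (h : P.TypedLMHS 1 N F) (hs : IsSplit N F) :
    delPart 1 N F ⊔ rangeC N ∈ P.satakeConj (LinearMap.range N.mulVecLin) := by
  obtain ⟨H, Np, hsl⟩ := h.exists_isSl2 hs
  have hL := conjSub_mem_lagrangians (delPart_sup_range_mem_lagrangians hsl h hs)
  have hr : ∀ r : ℝ, star (r : ℂ) = r := Complex.conj_ofReal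
  refine ⟨⟨hL, one_mem_closure_of_forall ((cayleyX N H Np).map star) fun t ht0 ht2 => ?_⟩,
    fun x => ?_⟩
  · obtain ⟨hG, hV⟩ := actV_sub_smul_cayleyX hsl h hs t
    have hmap : 1 - (t : ℂ) • (cayleyX N H Np).map star =
        (1 - (t : ℂ) • cayleyX N H Np).map star := by
      apply ext_mulVec
      intro x
      rw [← star_star x, ← star_mulVec', Matrix.sub_mulVec, Matrix.sub_mulVec, Matrix.smul_mulVec,
        Matrix.smul_mulVec, ← star_mulVec', star_sub, star_smul, hr, Matrix.one_mulVec,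
        Matrix.one_mulVec]
    rw [hmap]
    refine ⟨P.GC_map_star hG, actV_mem_lagrangians hL (P.GC_map_star hG), ?_⟩
    rw [← conjSub_actV, hV, conjSub_tilt hs]
    intro x hx h0
    have h2 : sgn (1 + 1) = 1 := by norm_num [sgn]
    have h1 : sgn 1 = -1 := by norm_num [sgn]
    have := h.tilt_pos hs (by rw [h1, h2]; nlinarith) hx h0
    rwa [h2, one_mul] at this
  · rw [mem_conjSub, star_vecC]
    exact h.vecC_mem_delPart_sup_range

end PolData

namespace PolData

variable {P : PolData ι} {N : Matrix ι ι ℝ} {F : Filt ι} {e : ℤ}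

/-! ### The map on nilpotent orbits -/

lemma delPart_eq_of_delOne_eq {N' : Matrix ι ι ℝ} {F' : Filt ι}
    (h : ∀ p, delOne N F p = delOne N' F' p) : delPart e N F = delPart e N' F' := by
  simp only [delPart, h]

lemma TypedLMHS.of_isDelta (h : P.TypedLMHS e N F) {δ : Matrix ι ι ℝ} (hδ : P.IsDelta N F δ) :
    P.TypedLMHS e N (actF (NormedSpace.exp (-(Complex.I • matC δ))) F) ∧
      IsSplit N (actF (NormedSpace.exp (-(Complex.I • matC δ))) F) ∧
      delPart e N (actF (NormedSpace.exp (-(Complex.I • matC δ))) F) = delPart e N F := by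
  obtain ⟨hM, hMk, hMr, hexp⟩ := (h.toLMHS.isTypeDelta_of_isDelta hδ).exponent_props h.toLMHS
  refine ⟨?_, isSplit_of_conjSub_eq hδ.2.2, ?_⟩
  · rw [hexp]; exact h.twist hM hMk hMr
  · rw [hexp]; exact delPart_eq_of_delOne_eq (h.toLMHS.delOne_twist hM hMk hMr)

/-- The boundary cycle of `(N, F)` exists and is unique, is a limit of cycles in the period domain,
and is sent to the sum of `W_{-2}` and the `I^{p,-p-1}` with `p ≡ e`. -/
lemma TypedLMHS.existsUnique_isBoundaryCycle (h : P.TypedLMHS e N F) :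
    (∃! C, P.IsBoundaryCycle N F C) ∧ ∀ C, P.IsBoundaryCycle N F C → C ∈ P.cycleSpaceClosure ∧
      ∀ V, P.ParityProj e C V ↔ V = delPart e N F ⊔ rangeC N := by
  constructor
  · obtain ⟨δ, hδ, huniq⟩ := h.existsUnique_isDelta
    obtain ⟨h', hs, -⟩ := h.of_isDelta hδ
    obtain ⟨H, Np, hsl⟩ := h'.exists_isSl2 hs
    refine ⟨_, ⟨δ, H, Np, _, hδ, rfl, hsl, rfl⟩, ?_⟩
    rintro _ ⟨δ', H', Np', _, hδ', rfl, hsl', rfl⟩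
    obtain rfl := huniq δ' hδ'
    obtain ⟨rfl, rfl⟩ := h'.toLMHS.isSl2_unique hsl hsl'
    rfl
  · rintro _ ⟨δ, H, Np, _, hδ, rfl, hsl, rfl⟩
    obtain ⟨h', hs, hpart⟩ := h.of_isDelta hδ
    rw [actS_exp_cayleyX hsl h']
    refine ⟨actS_cayleyX_mem_cycleSpaceClosure hsl h' hs, fun V => ?_⟩
    rw [parityProj_cayleyX_iff hsl h' hs, hpart]

variable {σ : PointedCone ℝ (Matrix ι ι ℝ)}

lemma self_mem_expOrbit (F : Filt ι) : F ∈ expOrbit σ F :=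
  ⟨0, Submodule.zero_mem _, by rw [NormedSpace.exp_zero, actF_one]⟩

/-- The sum of `W_{-2}` and the `I^{p,-p-1}` with `p ≡ e` is the same for all `N` in the relative
interior and all members of the orbit. -/
lemma IsTypedCone.delPart_sup_range_eq (hσ : P.IsTypedCone e σ) {F₀ : Filt ι}
    (hF₀ : P.GeneratesOrbit σ F₀) (hF : F ∈ expOrbit σ F₀) {N' : Matrix ι ι ℝ}
    (hN : N ∈ relInt σ) (hN' : N' ∈ relInt σ) :
    delPart e N F ⊔ rangeC N = delPart e N' F₀ ⊔ rangeC N' := by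
  rw [hσ.rangeC_eq hF₀ hN hN', delPart_eq_of_delOne_eq (fun p => ?_)]
  rw [(hσ.typedLMHS_of_mem hF₀ hF hN).2 p, delOne, delOne, hσ.kerC_eq hF₀ hN hN']

/-- A map into the subspaces in `S` that takes the value of the projection on all boundary cycles
exists and is unique, provided that the values lie in `S`. -/
lemma IsTypedCone.existsUnique_map (hσ : P.IsTypedCone e σ) {S : Set (Submodule ℂ (ι → ℂ))}
    (hS : ∀ N ∈ relInt σ, ∀ F, P.GeneratesOrbit σ F → delPart e N F ⊔ rangeC N ∈ S) :
    ∃! f : P.nilpotentOrbits σ → S,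
      ∀ Z : P.nilpotentOrbits σ, ∀ N ∈ relInt σ, ∀ F ∈ (Z : Set (Filt ι)),
        (∃! C, P.IsBoundaryCycle N F C) ∧
        ∀ C, P.IsBoundaryCycle N F C → C ∈ P.cycleSpaceClosure ∧
          ∀ V, P.ParityProj e C V ↔ V = (f Z : Submodule ℂ (ι → ℂ)) := by
  obtain ⟨N₀, hN₀⟩ := relInt_nonempty σ
  choose G hG hGZ using fun Z : P.nilpotentOrbits σ => Z.2
  refine ⟨fun Z => ⟨delPart e N₀ (G Z) ⊔ rangeC N₀, hS N₀ hN₀ _ (hG Z)⟩,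
    fun Z N hN F hF => ?_, fun f hf => funext fun Z => Subtype.ext ?_⟩
  · rw [hGZ Z] at hF
    dsimp only
    rw [← hσ.delPart_sup_range_eq (hG Z) hF hN hN₀]
    exact (hσ.typedLMHS_of_mem (hG Z) hF hN).1.existsUnique_isBoundaryCycle
  · have hF : G Z ∈ (Z : Set (Filt ι)) := by rw [hGZ Z]; exact self_mem_expOrbit _
    obtain ⟨⟨C, hC, -⟩, h1⟩ := hf Z N₀ hN₀ _ hF
    have h2 := (hσ.typedLMHS (hG Z) hN₀).existsUnique_isBoundaryCycle.2 C hC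
    exact (h2.2 _).1 (((h1 C hC).2 _).2 rfl)

lemma IsTypedCone.range_eq_coneWeight (hσ : P.IsTypedCone e σ) (hF : P.GeneratesOrbit σ F)
    (hN : N ∈ relInt σ) : LinearMap.range N.mulVecLin = coneWeight σ (-2) := by
  rw [← hσ.weight_eq_coneWeight hF hN, weight, if_neg (by norm_num), if_neg (by norm_num),
    if_pos rfl]

/-- Membership in a boundary component may be checked after the twist to the `ℝ`-split case. -/
lemma TypedLMHS.exists_isSplit (h : P.TypedLMHS e N F) :
    ∃ F', P.TypedLMHS e N F' ∧ IsSplit N F' ∧ delPart e N F' = delPart e N F := by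
  obtain ⟨δ, hδ, -⟩ := h.existsUnique_isDelta
  exact ⟨_, h.of_isDelta hδ⟩

end PolData

end HodgeCycle

end

open HodgeCycle in
theorem corollary2p7 {ι : Type*} [Fintype ι] [DecidableEq ι] (P : PolData ι)
    (σ : PointedCone ℝ (Matrix ι ι ℝ)) :
    (P.IsEvenCone σ →
      ((P.nilpotentOrbits σ).Nonempty → ∀ N ∈ relInt σ, ∀ k, weight N k = coneWeight σ k) ∧
      ∃! f : P.nilpotentOrbits σ → P.satake (coneWeight σ (-2)),
        ∀ Z : P.nilpotentOrbits σ, ∀ N ∈ relInt σ, ∀ F ∈ (Z : Set (Filt ι)),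
          (∃! C, P.IsBoundaryCycle N F C) ∧
          ∀ C, P.IsBoundaryCycle N F C → C ∈ P.cycleSpaceClosure ∧
            ∀ V, P.EvenProj C V ↔ V = (f Z : Submodule ℂ (ι → ℂ))) ∧
    (P.IsOddCone σ →
      ((P.nilpotentOrbits σ).Nonempty → ∀ N ∈ relInt σ, ∀ k, weight N k = coneWeight σ k) ∧
      ∃! f : P.nilpotentOrbits σ → P.satakeConj (coneWeight σ (-2)),
        ∀ Z : P.nilpotentOrbits σ, ∀ N ∈ relInt σ, ∀ F ∈ (Z : Set (Filt ι)),
          (∃! C, P.IsBoundaryCycle N F C) ∧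
          ∀ C, P.IsBoundaryCycle N F C → C ∈ P.cycleSpaceClosure ∧
            ∀ W, P.OddProj C W ↔ W = (f Z : Submodule ℂ (ι → ℂ))) := by
  simp only [PolData.evenProj_iff, PolData.oddProj_iff, PolData.isEvenCone_iff,
    PolData.isOddCone_iff]
  refine ⟨fun hσ => ⟨?_, hσ.existsUnique_map fun N hN F hF => ?_⟩,
    fun hσ => ⟨?_, hσ.existsUnique_map fun N hN F hF => ?_⟩⟩
  · rintro ⟨_, F, hF, -⟩ N hN k
    exact hσ.weight_eq_coneWeight hF hN k
  · obtain ⟨F', h', hs, hpart⟩ := (hσ.typedLMHS hF hN).exists_isSplit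
    rw [← hpart, ← hσ.range_eq_coneWeight hF hN]
    exact h'.mem_satake hs
  · rintro ⟨_, F, hF, -⟩ N hN k
    exact hσ.weight_eq_coneWeight hF hN k
  · obtain ⟨F', h', hs, hpart⟩ := (hσ.typedLMHS hF hN).exists_isSplit
    rw [← hpart, ← hσ.range_eq_coneWeight hF hN]
    exact h'.mem_satakeConj hs
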